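/- For two families $f,g$ of real numbers indexed by $\mathbb Z$ write $f(n)\lesssim g(n)$ if there is a constant $C\ge 0$ with $f(n)\le C\,g(n)$ for all $n$ with $|n|$ large enough, and $f(n)\asymp g(n)$ if there are constants $c_1,c_2>0$ with $c_1f(n)\le g(n)\le c_2f(n)$ for all $n$ with $|n|$ large enough. A meromorphic inner function is a bounded analytic function on $\mathbb C_+$ with unit modulus almost everywhere on $\mathbb R$ that has a meromorphic continuation to $\mathbb C$; its spectrum is $\{x\in\mathbb R:\Theta(x)=1\}$. For a positive measure $\mu$ on $\mathbb R$ with $\int\frac{d\mu(t)}{1+t^2}<\infty$ let $$K\mu(z)=\frac1{\pi i}\int_{\mathbb R}\Big(\frac1{t-z}-\frac t{1+t^2}\Big)\,d\mu(t),$$ and for a bounded measurable $u:\mathbb R\to\mathbb R$ let $Ku$ be given by the same formula with $u(t)\,dt$ in place of $d\mu(t)$. Let $\{a_n\}_{n\in\mathbb Z}$ be a strictly increasing two-sided sequence of real numbers, and put $\Delta_n=a_{n+1}-a_n$ for $n>0$, $\Delta_n=a_n-a_{n-1}$ for $n\le 0$, and $b_n=\frac{a_n+a_{n+1}}2$. Suppose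 that $\Delta_n>e$ for all $n$ with $|n|$ large enough (so that $\ln\ln\Delta_n>0$), that $\Delta_{n+1}\asymp\Delta_n$, and that $$\frac{\ln|a_n|}{\ln\ln\Delta_n}\lesssim\Delta_n\lesssim\ln|a_n| .$$ Let $E=\bigcup_n(a_n,b_n)$ and $u=1_E-\frac12$. Then for every $c\in\mathbb R$ there is a meromorphic inner function $\Theta$ on $\mathbb C_+$ such that 1. the spectrum of $\Theta$ is $\{a_n\}_{n\in\mathbb Z}$; 2. $|\Theta'|$ is uniformly bounded on $\mathbb R$; 3. $\Theta$ is given by Krein's shift formula $\displaystyle\frac1{\pi i}\log\frac{1+\Theta}{1-\Theta}=Ku+ic$ on $\mathbb C_+$, with the principal branch of the logarithm; 4. there are positive numbers $\alpha_n,\beta_n$ $(n\in\mathbb Z)$ such that the measures $\mu_1=\sum_n\alpha_n\delta_{a_n}$ and $\mu_{-1}=\sum_n\beta_n\delta_{b_n}$ satisfy $\int\frac{d\mu_{\pm1}(t)}{1+t^2}<\infty$ and are the Clark measures of $\Theta$, that is, on $\mathbb C_+$, $$\frac{1+\Theta}{1-\Theta}=K\mu_1+id_1,\qquad \frac{1-\Theta}{1+\Theta}=K\mu_{-1}+id_{-1}$$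 for some real constants $d_1,d_{-1}$, and $\alpha_n\lesssim\Delta_n\ln\Delta_n$ and $\beta_n\lesssim\Delta_n\ln\Delta_n$. -/

import Mathlib

open Filter MeasureTheory

noncomputable section

namespace MIF

/-- `f ≲ g` for families indexed by `ℤ`: there is a constant `c ≥ 0` with `f n ≤ c * g n`
for all `n` with `|n|` large enough (that is, for all but finitely many `n`). -/
def LessSim (f g : ℤ → ℝ) : Prop :=
  ∃ c : ℝ, 0 ≤ c ∧ ∀ᶠ n in cofinite, f n ≤ c * g n

/-- `f ≍ g` for families indexed by `ℤ`: there are constants `c₁, c₂ > 0` with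
`c₁ * f n ≤ g n ≤ c₂ * f n` for all `n` with `|n|` large enough. -/
def AsympEq (f g : ℤ → ℝ) : Prop :=
  ∃ c₁ c₂ : ℝ, 0 < c₁ ∧ 0 < c₂ ∧ ∀ᶠ n in cofinite, c₁ * f n ≤ g n ∧ g n ≤ c₂ * f n

/-- The gaps `Δ n` of a two-sided sequence. -/
def gap (a : ℤ → ℝ) (n : ℤ) : ℝ :=
  if 0 < n then a (n + 1) - a n else a n - a (n - 1)

/-- The midpoints `b n` of successive points of the sequence. -/
def midpt (a : ℤ → ℝ) (n : ℤ) : ℝ :=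
  (a n + a (n + 1)) / 2

/-- The set `E = ⋃ n, (a n, b n)`. -/
def halfGaps (a : ℤ → ℝ) : Set ℝ :=
  ⋃ n : ℤ, Set.Ioo (a n) (midpt a n)

/-- Krein's shift function `u = 1_E - 1/2`. -/
def shiftFun (a : ℤ → ℝ) (t : ℝ) : ℝ :=
  (halfGaps a).indicator (fun _ => (1 : ℝ)) t - 1 / 2

/-- The kernel `1 / (t - z) - t / (1 + t ^ 2)`. -/
def cauchyKernel (z : ℂ) (t : ℝ) : ℂ :=
  1 / ((t : ℂ) - z) - (t : ℂ) / (1 + (t : ℂ) ^ 2)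

/-- The Cauchy transform `Kμ` of a positive measure on the line. -/
def cauchyMeasure (μ : Measure ℝ) (z : ℂ) : ℂ :=
  1 / ((Real.pi : ℂ) * Complex.I) * ∫ t : ℝ, cauchyKernel z t ∂μ

/-- The Cauchy transform `Ku` of a real function, i.e. of the signed measure `u(t) dt`. -/
def cauchyFun (u : ℝ → ℝ) (z : ℂ) : ℂ :=
  1 / ((Real.pi : ℂ) * Complex.I) * ∫ t : ℝ, (u t : ℂ) * cauchyKernel z t

/-- `Θ : ℂ → ℂ` is a meromorphic inner function on the upper half-plane (given together with its
meromorphic continuation to `ℂ`). Since `Θ` is bounded on the upper half-plane, the continuation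
has no pole on the real line; `analytic` says this and that `Θ` takes there the values of the
continuation (the values of a merely meromorphic function are irrelevant on a discrete set). -/
structure IsMeromorphicInner (Θ : ℂ → ℂ) : Prop where
  analytic : AnalyticOnNhd ℂ Θ {z : ℂ | 0 ≤ z.im}
  bounded : ∃ C : ℝ, ∀ z : ℂ, 0 < z.im → ‖Θ z‖ ≤ C
  unimodular : ∀ᵐ x : ℝ, ‖Θ (x : ℂ)‖ = 1
  meromorphic : MeromorphicOn Θ Set.univ

/-- The spectrum `{x ∈ ℝ : Θ x = 1}`. -/
def innerSpectrum (Θ : ℂ → ℂ) : Set ℝ :=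
  {x : ℝ | Θ (x : ℂ) = 1}

/-- `μ` is the Aleksandrov-Clark measure of `Θ` at the unimodular number `ζ`, without mass at
infinity: `μ` is Poisson finite and `(ζ + Θ) / (ζ - Θ) = Kμ + i d` on the upper half-plane for a
real constant `d` (Herglotz representation). For `ζ = 1` the left-hand side is
`(1 + Θ) / (1 - Θ)`, for `ζ = -1` it is `(1 - Θ) / (1 + Θ)`. -/
def IsClarkMeasure (Θ : ℂ → ℂ) (ζ : ℂ) (μ : Measure ℝ) : Prop :=
  Integrable (fun t : ℝ => 1 / (1 + t ^ 2)) μ ∧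
    ∃ d : ℝ, ∀ z : ℂ, 0 < z.im →
      (ζ + Θ z) / (ζ - Θ z) = cauchyMeasure μ z + Complex.I * (d : ℂ)

/-- The discrete measure `∑ n, w n δ_{x n}`. -/
def pointMasses (x w : ℤ → ℝ) : Measure ℝ :=
  Measure.sum fun n : ℤ => ENNReal.ofReal (w n) • Measure.dirac (x n)

end MIF

end

/-! Krein's formula determines Θ: it must be (F - 1)/(F + 1) with F = exp(∫ u k_z dt - πc), where
k_z is the Cauchy kernel. Since ∫ k_z = πi, the constant -1/2 in u contributes the factor -i, and
each interval (a_n, b_n) contributes a Möbius factor with zero b_n and pole a_n. So F is -i e^{-πc}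
times a product of normalized factors (`kreinFun_eq_exp`), which converges because the steps of the
sequence are at most logarithmic. As |u| = 1/2, Re F ≥ 0 on the upper half-plane; F is imaginary on
the line; hence Θ is inner and equals 1 exactly at the poles of F.

Size of F. Up to a telescoping quotient, the squared modulus of a factor is ρ_n(z)/ρ_n(i), where
ρ_n(z) = |b_n - z|²/(|a_n - z||a_{n+1} - z|). Products of the ρ_n(iR) are bounded above and below
uniformly in R ≥ 1. For real x outside [a_n, a_{n+1}] one has ρ_n(x) = 1 + (a_{n+1} - a_n)²/(4|a_n -
x||a_{n+1} - x|) ≥ 1, so a lower bound for |F(x)| needs only the one or two ratios next to x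
(`exists_norm_fullProd_bounds`). For an upper bound the far ratios must be controlled: if x keeps a
distance of order Δ_n from them, their product is at most exp(O(√(log|x|/Δ_n))), and log|a_n| ≲ Δ_n
log log Δ_n turns this into O(log Δ_n) (`exists_prod_ratio_le_log_gap`).

Derivative. On the line |Θ'| = 2|F|/(1 + |F|²) · |F'/F|. Two telescoping sums bound F'/F by the
reciprocal distances to a_n, b_n, a_{n+1} plus a constant. Near a pole the singularity is cancelled
because |F||x - a_n| is bounded below; near b_n because |F| ≤ const · |x - b_n|, which is where the
upper bound enters.

Clark measures. Finite products have partial fractions with residues of one sign, that is, discrete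
Herglotz representations. Their uniform bound O(√R) at iR keeps mass from escaping to infinity, so F
and 1/F inherit such representations (`exists_cauchyMeasure_eq_of_tendsto`). The masses are π lim
|F||x - a_n| and π lim |x - b_n|/|F|, and the size estimates bound them. -/

namespace MIF

/-! ### Sequences with at most logarithmic steps -/

/-- The distance from `a k` to its successor. -/
def step (a : ℤ → ℝ) (k : ℤ) : ℝ := a (k + 1) - a k

/-- Two-sided sequences whose steps are bounded below, comparable with the neighbouring steps, and
at most logarithmic. -/
structure LogSpaced (a : ℤ → ℝ) (δ C : ℝ) : Prop where
  pos : 0 < δ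
  one_le : 1 ≤ C
  le_step : ∀ k, δ ≤ step a k
  step_succ_le : ∀ k, step a (k + 1) ≤ C * step a k
  step_le_succ : ∀ k, step a k ≤ C * step a (k + 1)
  step_le_log : ∀ k, step a k ≤ C * Real.log (2 + |a k|)
  step_le_log_succ : ∀ k, step a k ≤ C * Real.log (2 + |a (k + 1)|)

theorem log_le_four_mul_sqrt_sqrt {y : ℝ} (hy : 0 < y) : Real.log y ≤ 4 * √(√y) := by
  have h1 : Real.log (√(√y)) = Real.log y / 4 := by
    rw [Real.log_sqrt (Real.sqrt_nonneg _), Real.log_sqrt hy.le]; ring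
  have h2 := Real.log_le_self (Real.sqrt_nonneg (√y))
  linarith

theorem midpt_eq_add_step (a : ℤ → ℝ) (k : ℤ) : midpt a k = a k + step a k / 2 := by
  simp only [midpt, step]; ring

theorem midpt_eq_sub_step (a : ℤ → ℝ) (k : ℤ) : midpt a k = a (k + 1) - step a k / 2 := by
  simp only [midpt, step]; ring

/-- The logarithm is at most four times the fourth root. The fourth root makes the squared step
O(√|a|), small enough for the series of step²/a² to converge. -/
theorem sq_le_of_le_mul_log {d C t : ℝ} (hC : 1 ≤ C) (hd : 0 < d) (ht : 0 ≤ t)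
    (h : d ≤ C * Real.log (2 + t)) : d ^ 2 ≤ 32 * C ^ 2 * √(1 + t) := by
  have h1 := log_le_four_mul_sqrt_sqrt (show 0 < 2 + t by positivity)
  have h2 : d ≤ C * (4 * √(√(2 + t))) := h.trans (by gcongr)
  have h3 : d ^ 2 ≤ (C * (4 * √(√(2 + t)))) ^ 2 := by gcongr
  have h4 : (√(√(2 + t))) ^ 2 = √(2 + t) := Real.sq_sqrt (Real.sqrt_nonneg _)
  have h5 : √(2 + t) ≤ 2 * √(1 + t) := by
    rw [Real.sqrt_le_left (by positivity), mul_pow, Real.sq_sqrt (by positivity)]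
    linarith
  calc d ^ 2 ≤ (C * (4 * √(√(2 + t)))) ^ 2 := h3
    _ = 16 * C ^ 2 * √(2 + t) := by rw [mul_pow, mul_pow, h4]; ring
    _ ≤ 16 * C ^ 2 * (2 * √(1 + t)) := by gcongr
    _ = _ := by ring

theorem le_half_add_of_sq_le {d C t : ℝ} (hC : 1 ≤ C) (ht : 0 ≤ t)
    (h : d ^ 2 ≤ 32 * C ^ 2 * √(1 + t)) : d ≤ (1 + t) / 2 + 16 * C ^ 2 := by
  have h1 : √(1 + t) ≤ 1 + t := by
    rw [Real.sqrt_le_left (by positivity)]; nlinarith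
  have h2 : d ^ 2 ≤ 32 * C ^ 2 * (1 + t) := h.trans (by gcongr)
  by_contra! hcon
  have : ((1 + t) / 2 + 16 * C ^ 2) ^ 2 < d ^ 2 := by gcongr
  nlinarith [sq_nonneg ((1 + t) / 2 - 16 * C ^ 2)]

namespace LogSpaced

variable {a : ℤ → ℝ} {δ C : ℝ}

theorem step_pos (h : LogSpaced a δ C) (k : ℤ) : 0 < step a k := h.pos.trans_le (h.le_step k)

theorem lt_succ (h : LogSpaced a δ C) (k : ℤ) : a k < a (k + 1) := sub_pos.1 (h.step_pos k)

theorem strictMono (h : LogSpaced a δ C) : StrictMono a := strictMono_int_of_lt_succ h.lt_succ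

theorem lt_midpt (h : LogSpaced a δ C) (k : ℤ) : a k < midpt a k := by
  have := h.lt_succ k; unfold midpt; linarith

theorem midpt_lt (h : LogSpaced a δ C) (k : ℤ) : midpt a k < a (k + 1) := by
  have := h.lt_succ k; unfold midpt; linarith

theorem midpt_strictMono (h : LogSpaced a δ C) : StrictMono (midpt a) :=
  strictMono_int_of_lt_succ fun k => (h.midpt_lt k).trans (h.lt_midpt (k + 1))

theorem step_sq_le (h : LogSpaced a δ C) (k : ℤ) : step a k ^ 2 ≤ 32 * C ^ 2 * √(1 + |a k|) :=
  sq_le_of_le_mul_log h.one_le (h.step_pos k) (abs_nonneg _) (h.step_le_log k)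

theorem step_le_half (h : LogSpaced a δ C) (k : ℤ) :
    step a k ≤ (1 + |a k|) / 2 + 16 * C ^ 2 :=
  le_half_add_of_sq_le h.one_le (abs_nonneg _) (h.step_sq_le k)

/-- A step is at most half of 1 + |a k| plus a constant, so a move by at most one step cannot shrink
1 + |a k| by more than a constant factor. -/
theorem one_add_abs_le_of_sub_le (h : LogSpaced a δ C) (k : ℤ) {x : ℝ}
    (hx : |a k - x| ≤ step a k) : 1 + |a k| ≤ (2 + 32 * C ^ 2) * (1 + |x|) := by
  have h1 := h.step_le_half k
  have h2 : |a k| ≤ |a k - x| + |x| := by simpa using abs_add_le (a k - x) x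
  nlinarith [abs_nonneg x, mul_nonneg (sq_nonneg C) (abs_nonneg x)]

theorem one_add_abs_le_succ (h : LogSpaced a δ C) (k : ℤ) :
    1 + |a k| ≤ (2 + 32 * C ^ 2) * (1 + |a (k + 1)|) := by
  refine h.one_add_abs_le_of_sub_le k ?_
  rw [abs_sub_comm, abs_of_pos (sub_pos.2 (h.lt_succ k))]; rfl

theorem one_add_abs_le_midpt (h : LogSpaced a δ C) (k : ℤ) :
    1 + |a k| ≤ (2 + 32 * C ^ 2) * (1 + |midpt a k|) := by
  refine h.one_add_abs_le_of_sub_le k ?_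
  rw [abs_sub_comm, abs_of_pos (sub_pos.2 (h.lt_midpt k)), midpt_eq_add_step]
  linarith [h.step_pos k]

theorem mul_le_sub (h : LogSpaced a δ C) (k : ℤ) (j : ℕ) : δ * j ≤ a (k + j) - a k := by
  induction j with
  | zero => simp
  | succ j ih =>
    have := h.le_step (k + j)
    unfold step at this
    push_cast
    rw [← add_assoc]
    linarith

theorem mul_abs_le (h : LogSpaced a δ C) (k : ℤ) : δ * |(k : ℝ)| ≤ |a k| + |a 0| := by
  rcases le_total 0 k with hk | hk
  · obtain ⟨j, rfl⟩ := Int.eq_ofNat_of_zero_le hk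
    have := h.mul_le_sub 0 j
    simp only [zero_add] at this
    simp only [Int.cast_natCast, Nat.abs_cast]
    linarith [le_abs_self (a j), neg_abs_le (a 0)]
  · obtain ⟨j, rfl⟩ := Int.exists_eq_neg_ofNat hk
    have := h.mul_le_sub (-j) j
    simp only [neg_add_cancel] at this
    simp only [Int.cast_neg, Int.cast_natCast, abs_neg, Nat.abs_cast]
    linarith [le_abs_self (a 0), neg_abs_le (a (-j))]

theorem tendsto_abs (h : LogSpaced a δ C) : Tendsto (fun k => |a k|) cofinite atTop := by
  have h1 : Tendsto (fun k : ℤ => δ * |(k : ℝ)| + -|a 0|) cofinite atTop := by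
    refine tendsto_atTop_add_const_right _ _ (Tendsto.const_mul_atTop h.pos ?_)
    have := tendsto_norm_cocompact_atTop.comp Int.tendsto_coe_cofinite
    simpa [Function.comp_def] using this
  refine tendsto_atTop_mono (fun k => ?_) h1
  linarith [h.mul_abs_le k]

theorem tendsto_abs_midpt (h : LogSpaced a δ C) :
    Tendsto (fun k => |midpt a k|) cofinite atTop := by
  have hK : 0 < 2 + 32 * C ^ 2 := by positivity
  have h1 : Tendsto (fun k => |a k| / (2 + 32 * C ^ 2) + -1) cofinite atTop :=
    tendsto_atTop_add_const_right _ _ (h.tendsto_abs.atTop_div_const hK)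
  refine tendsto_atTop_mono (fun k => ?_) h1
  have := h.one_add_abs_le_midpt k
  have h2 : |a k| / (2 + 32 * C ^ 2) ≤ 1 + |midpt a k| := by
    rw [div_le_iff₀ hK]; linarith
  linarith

theorem tendsto_atTop (h : LogSpaced a δ C) : Tendsto (fun N : ℕ => a N) Filter.atTop atTop := by
  have h1 : Tendsto (fun N : ℕ => a 0 + δ * N) Filter.atTop atTop :=
    tendsto_atTop_add_const_left _ _ (tendsto_natCast_atTop_atTop.const_mul_atTop h.pos)
  refine tendsto_atTop_mono (fun N => ?_) h1
  have := h.mul_le_sub 0 N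
  simp only [zero_add] at this
  linarith

theorem tendsto_atBot (h : LogSpaced a δ C) :
    Tendsto (fun N : ℕ => a (-N)) Filter.atTop atBot := by
  have h1 : Tendsto (fun N : ℕ => -a (-N)) Filter.atTop atTop := by
    have h1 : Tendsto (fun N : ℕ => -a 0 + δ * N) Filter.atTop atTop :=
      tendsto_atTop_add_const_left _ _ (tendsto_natCast_atTop_atTop.const_mul_atTop h.pos)
    refine tendsto_atTop_mono (fun N => ?_) h1
    have := h.mul_le_sub (-N) N
    simp only [neg_add_cancel] at this
    linarith
  simpa [Function.comp_def] using tendsto_neg_atTop_atBot.comp h1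

theorem exists_mem_Ico (h : LogSpaced a δ C) (x : ℝ) : ∃ n, a n ≤ x ∧ x < a (n + 1) := by
  obtain ⟨n, hn, hmax⟩ : ∃ n, a n ≤ x ∧ ∀ m, a m ≤ x → m ≤ n := by
    obtain ⟨N, hN⟩ := (h.tendsto_atTop.eventually_gt_atTop x).exists
    obtain ⟨M, hM⟩ := (h.tendsto_atBot.eventually_le_atBot x).exists
    refine Int.exists_greatest_of_bdd ⟨N, fun z hz => ?_⟩ ⟨_, hM⟩
    exact (h.strictMono.lt_iff_lt.1 (hz.trans_lt hN)).le
  refine ⟨n, hn, not_le.1 fun hle => ?_⟩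
  have := hmax _ hle
  omega

/-- The terms are O(|k|^(-3/2)): the squared step is O(√|a k|) and |a k| grows at least linearly.
The convergence of the products and the bounds on the imaginary axis rest on this series. -/
theorem summable_sq_step (h : LogSpaced a δ C) :
    Summable fun k => step a k ^ 2 / (1 + |a k|) ^ 2 := by
  -- Dividing by 1 + |a 0| absorbs the offset, since δ|k| ≤ |a k| + |a 0| ≤ (1 + |a 0|)(1 + |a k|).
  set c := δ / (1 + |a 0|) with hc
  have hc0 : 0 < c := by have := h.pos; positivity
  have hs : Summable fun k : ℤ => 32 * C ^ 2 * c ^ (-(3 / 2) : ℝ) * |(k : ℝ)| ^ (-(3 / 2) : ℝ) :=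
    (Real.summable_abs_int_rpow (b := 3 / 2) (by norm_num)).mul_left _
  refine hs.of_norm_bounded_eventually ?_
  filter_upwards [eventually_cofinite_ne (0 : ℤ)] with k hk
  have hk' : 0 < |(k : ℝ)| := abs_pos.2 (Int.cast_ne_zero.2 hk)
  have h1 : c * |(k : ℝ)| ≤ 1 + |a k| := by
    rw [hc, div_mul_eq_mul_div, div_le_iff₀ (by positivity)]
    nlinarith [h.mul_abs_le k, abs_nonneg (a k), abs_nonneg (a 0)]
  have hy : 0 < 1 + |a k| := by positivity
  have h2 : √(1 + |a k|) / (1 + |a k|) ^ 2 = (1 + |a k|) ^ (-(3 / 2) : ℝ) := by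
    rw [Real.sqrt_eq_rpow, ← Real.rpow_natCast, ← Real.rpow_sub hy]
    norm_num
  rw [Real.norm_of_nonneg (by positivity)]
  calc step a k ^ 2 / (1 + |a k|) ^ 2 ≤ 32 * C ^ 2 * √(1 + |a k|) / (1 + |a k|) ^ 2 := by
        gcongr; exact h.step_sq_le k
    _ = 32 * C ^ 2 * (1 + |a k|) ^ (-(3 / 2) : ℝ) := by rw [← h2]; ring
    _ ≤ 32 * C ^ 2 * (c * |(k : ℝ)|) ^ (-(3 / 2) : ℝ) := by
        gcongr ?_ * ?_
        exact Real.rpow_le_rpow_of_nonpos (by positivity) h1 (by norm_num)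
    _ = _ := by rw [Real.mul_rpow hc0.le hk'.le]; ring

end LogSpaced

/-! ### The normalized infinite product -/

/-- The normalizing constants `√(1 + a k ^ 2) / √(1 + b k ^ 2)`. -/
noncomputable def normRatio (a : ℤ → ℝ) (k : ℤ) : ℝ := √(1 + a k ^ 2) / √(1 + midpt a k ^ 2)

/-- The normalized factor with the zero `b k` and the pole `a k`. -/
noncomputable def factor (a : ℤ → ℝ) (k : ℤ) (z : ℂ) : ℂ :=
  ((midpt a k : ℂ) - z) / ((a k : ℂ) - z) * (normRatio a k : ℂ)

/-- The product of all factors. -/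
noncomputable def fullProd (a : ℤ → ℝ) (z : ℂ) : ℂ := ∏' k, factor a k z

/-- The product of all factors but the `n`-th one. -/
noncomputable def prodExcept (a : ℤ → ℝ) (n : ℤ) (z : ℂ) : ℂ :=
  ∏' k, if k = n then 1 else factor a k z

/-- The complement of `{a k | k ≠ n}`. -/
def awayFrom (a : ℤ → ℝ) (n : ℤ) : Set ℂ := {z | ∀ k, k ≠ n → z ≠ a k}

theorem normRatio_pos (a : ℤ → ℝ) (k : ℤ) : 0 < normRatio a k := by
  unfold normRatio; positivity

theorem abs_le_sqrt_one_add_sq (x : ℝ) : |x| ≤ √(1 + x ^ 2) :=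
  Real.abs_le_sqrt (by linarith)

theorem sqrt_one_add_sq_le (x : ℝ) : √(1 + x ^ 2) ≤ 1 + |x| := by
  rw [Real.sqrt_le_left (by positivity)]
  nlinarith [abs_nonneg x, sq_abs x]

theorem half_le_sqrt_one_add_sq (x : ℝ) : (1 + |x|) / 2 ≤ √(1 + x ^ 2) := by
  apply Real.le_sqrt_of_sq_le
  nlinarith [abs_nonneg x, sq_abs x, sq_nonneg (1 - |x|)]

theorem one_le_sqrt_one_add_sq (x : ℝ) : 1 ≤ √(1 + x ^ 2) :=
  Real.one_le_sqrt.2 (by nlinarith)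

/-- This is the numerator of a normalized factor minus 1. Multiplication by √(1 + a²) + √(1 + b²)
brings out b - a; when a and b have the same sign, √(1 + a²)√(1 + b²) - ab has only linear size. -/
theorem norm_sub_mul_sqrt_sub_le {a b : ℝ} (hab : a ≤ b) (hs : 0 ≤ a * b) (z : ℂ) :
    ‖((b : ℂ) - z) * (√(1 + a ^ 2) : ℝ) - ((a : ℂ) - z) * (√(1 + b ^ 2) : ℝ)‖ ≤
      (b - a) * (2 + ‖z‖) := by
  set u := √(1 + a ^ 2) with hu
  set v := √(1 + b ^ 2) with hv
  have hu2 : u ^ 2 = 1 + a ^ 2 := Real.sq_sqrt (by positivity)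
  have hv2 : v ^ 2 = 1 + b ^ 2 := Real.sq_sqrt (by positivity)
  have hu1 : 1 ≤ u := one_le_sqrt_one_add_sq a
  have hv1 : 1 ≤ v := one_le_sqrt_one_add_sq b
  have hau : |a| ≤ u := abs_le_sqrt_one_add_sq a
  have hbv : |b| ≤ v := abs_le_sqrt_one_add_sq b
  have hu3 : u ≤ 1 + |a| := sqrt_one_add_sq_le a
  have hv3 : v ≤ 1 + |b| := sqrt_one_add_sq_le b
  have hid : (((b : ℂ) - z) * (u : ℝ) - ((a : ℂ) - z) * (v : ℝ)) * ((u + v : ℝ) : ℂ) =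
      ((b - a : ℝ) : ℂ) * (((1 + (u * v - a * b) : ℝ) : ℂ) + z * ((a + b : ℝ) : ℂ)) := by
    have h1 : (u : ℂ) ^ 2 = 1 + (a : ℂ) ^ 2 := by exact_mod_cast hu2
    have h2 : (v : ℂ) ^ 2 = 1 + (b : ℂ) ^ 2 := by exact_mod_cast hv2
    push_cast
    linear_combination ((b : ℂ) - z) * h1 - ((a : ℂ) - z) * h2
  have hn := congrArg norm hid
  rw [norm_mul, norm_mul, Complex.norm_real, Complex.norm_real,
    Real.norm_of_nonneg (by linarith : 0 ≤ u + v), Real.norm_of_nonneg (by linarith : 0 ≤ b - a)]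
    at hn
  have hm0 : a * b ≤ u * v :=
    (le_abs_self _).trans ((abs_mul a b).le.trans (by gcongr))
  have hm1 : u * v - a * b ≤ 1 + |a| + |b| := by
    have : u * v ≤ (1 + |a|) * (1 + |b|) := by gcongr
    have h3 : |a| * |b| = a * b := by rw [← abs_mul, abs_of_nonneg hs]
    nlinarith
  have h4 : ‖((1 + (u * v - a * b) : ℝ) : ℂ) + z * ((a + b : ℝ) : ℂ)‖ ≤ (2 + ‖z‖) * (u + v) := by
    refine (norm_add_le _ _).trans ?_
    rw [norm_mul, Complex.norm_real, Complex.norm_real, Real.norm_of_nonneg (by linarith),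
      Real.norm_eq_abs]
    have := mul_le_mul_of_nonneg_left ((abs_add_le a b).trans (add_le_add hau hbv)) (norm_nonneg z)
    nlinarith
  have h5 : ‖((b : ℂ) - z) * (u : ℝ) - ((a : ℂ) - z) * (v : ℝ)‖ * (u + v) ≤
      ((b - a) * (2 + ‖z‖)) * (u + v) := by
    rw [hn, mul_assoc]
    exact mul_le_mul_of_nonneg_left h4 (by linarith)
  exact le_of_mul_le_mul_right h5 (by linarith)

theorem factor_ne_zero {a : ℤ → ℝ} {k : ℤ} {z : ℂ} (ha : z ≠ a k) (hb : z ≠ midpt a k) :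
    factor a k z ≠ 0 := by
  have := (normRatio_pos a k).ne'
  exact mul_ne_zero (div_ne_zero (sub_ne_zero.2 hb.symm) (sub_ne_zero.2 ha.symm))
    (by exact_mod_cast this)

theorem differentiableAt_factor {a : ℤ → ℝ} {k : ℤ} {z : ℂ} (ha : z ≠ a k) :
    DifferentiableAt ℂ (factor a k) z := by
  unfold factor
  have : (a k : ℂ) - z ≠ 0 := sub_ne_zero.2 ha.symm
  fun_prop (disch := assumption)

theorem factor_conj (a : ℤ → ℝ) (k : ℤ) (x : ℝ) :
    factor a k x = (((midpt a k - x) / (a k - x) * normRatio a k : ℝ) : ℂ) := by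
  unfold factor; push_cast; rfl

namespace LogSpaced

variable {a : ℤ → ℝ} {δ C : ℝ}

/-- The normalization improves the deviation from 1 from order step/|a k| to order step/|a k|².
Since step ≥ δ, the latter is dominated by the series already known to converge. -/
theorem norm_factor_sub_one_le (h : LogSpaced a δ C) (R : ℝ) : ∀ᶠ k in cofinite, ∀ z : ℂ, ‖z‖ ≤ R →
    z ≠ a k ∧ ‖factor a k z - 1‖ ≤
      4 * (2 + 32 * C ^ 2) * (2 + R) / δ * (step a k ^ 2 / (1 + |a k|) ^ 2) := by
  -- The first threshold keeps `a k` far from the disc of radius R; the second prevents the midpoint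
  -- from having the opposite sign to `a k`.
  filter_upwards [h.tendsto_abs.eventually_ge_atTop (2 * R + 1),
    h.tendsto_abs.eventually_ge_atTop (1 + 11 * C ^ 2)] with k h1 h2 z hz
  have hR : 0 ≤ R := (norm_nonneg z).trans hz
  have hδ := h.pos
  have hd := h.step_pos k
  have hs : 0 ≤ a k * midpt a k := by
    have h3 := h.step_le_half k
    rw [midpt_eq_add_step]
    have h4 : step a k / 2 ≤ |a k| := by nlinarith
    nlinarith [neg_abs_le (a k), sq_abs (a k), abs_nonneg (a k), abs_mul_abs_self (a k)]
  have haz : (1 + |a k|) / 4 ≤ ‖(a k : ℂ) - z‖ := by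
    have := norm_sub_norm_le (a k : ℂ) z
    rw [Complex.norm_real, Real.norm_eq_abs] at this
    nlinarith
  have hne : (a k : ℂ) - z ≠ 0 := by
    rw [← norm_pos_iff]; exact lt_of_lt_of_le (by positivity) haz
  set K := 2 + 32 * C ^ 2 with hK
  have hK0 : 0 < K := by positivity
  have hw : (1 + |a k|) / (2 * K) ≤ √(1 + midpt a k ^ 2) := by
    refine le_trans ?_ (half_le_sqrt_one_add_sq _)
    rw [div_le_div_iff₀ (by positivity) (by norm_num)]
    nlinarith [h.one_add_abs_le_midpt k]
  have hw0 : (√(1 + midpt a k ^ 2) : ℂ) ≠ 0 := by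
    exact_mod_cast (Real.sqrt_pos.2 (by positivity)).ne'
  refine ⟨(sub_ne_zero.1 hne).symm, ?_⟩
  have hid : factor a k z - 1 = (((midpt a k : ℂ) - z) * (√(1 + a k ^ 2) : ℝ) -
      ((a k : ℂ) - z) * (√(1 + midpt a k ^ 2) : ℝ)) / (((a k : ℂ) - z) *
        (√(1 + midpt a k ^ 2) : ℝ)) := by
    unfold factor normRatio
    push_cast
    field_simp
  rw [hid, norm_div, norm_mul, Complex.norm_real, Real.norm_of_nonneg (Real.sqrt_nonneg _)]
  have hnum := norm_sub_mul_sqrt_sub_le (h.lt_midpt k).le hs z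
  have hb : midpt a k - a k = step a k / 2 := by rw [midpt_eq_add_step]; ring
  rw [hb] at hnum
  calc _ ≤ (step a k / 2 * (2 + R)) / ((1 + |a k|) / 4 * ((1 + |a k|) / (2 * K))) := by
        gcongr
        exact hnum.trans (by gcongr)
    _ = 4 * K * (2 + R) * (step a k / (1 + |a k|) ^ 2) := by field_simp
    _ ≤ 4 * K * (2 + R) * ((step a k ^ 2 / δ) / (1 + |a k|) ^ 2) := by
        gcongr
        rw [le_div_iff₀ hδ]
        nlinarith [h.le_step k]
    _ = _ := by ring

theorem isOpen_awayFrom (h : LogSpaced a δ C) (n : ℤ) : IsOpen (awayFrom a n) := by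
  have : awayFrom a n = ((fun k => (a k : ℂ)) '' {k | k ≠ n})ᶜ := by
    ext z; simp only [awayFrom, Set.mem_ofPred_eq, Set.mem_compl_iff, Set.mem_image, not_exists,
      not_and]
    exact forall₂_congr fun k _ => by rw [ne_comm]
  rw [this, isOpen_compl_iff]
  refine Metric.isClosed_of_pairwise_le_dist h.pos ?_
  rintro _ ⟨j, -, rfl⟩ _ ⟨k, -, rfl⟩ hjk
  have hjk' : j ≠ k := fun e => hjk (by rw [e])
  have key : ∀ j k : ℤ, j < k → δ ≤ a k - a j := by
    intro j k hlt
    have h1 := h.strictMono.monotone (show j + 1 ≤ k by omega)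
    have h2 := h.le_step j
    unfold step at h2
    linarith
  rw [Complex.dist_eq, ← Complex.ofReal_sub, Complex.norm_real, Real.norm_eq_abs]
  rcases lt_or_gt_of_ne hjk' with hlt | hlt
  · rw [abs_sub_comm]; exact (key j k hlt).trans (le_abs_self _)
  · exact (key k j hlt).trans (le_abs_self _)

theorem exists_mem_awayFrom (h : LogSpaced a δ C) (z : ℂ) : ∃ n, z ∈ awayFrom a n := by
  by_cases hz : ∃ n, z = a n
  · obtain ⟨n, rfl⟩ := hz
    exact ⟨n, fun k hk e => hk (h.strictMono.injective (Complex.ofReal_injective e)).symm⟩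
  · exact ⟨0, fun k _ e => hz ⟨k, e⟩⟩

theorem multipliableLocallyUniformlyOn (h : LogSpaced a δ C) (n : ℤ) (R : ℝ) :
    MultipliableLocallyUniformlyOn (fun k z => if k = n then 1 else factor a k z)
      (awayFrom a n ∩ Metric.ball 0 R) := by
  have key := Summable.multipliableLocallyUniformlyOn_one_add
    (K := awayFrom a n ∩ Metric.ball 0 R)
    (f := fun k z => (if k = n then 1 else factor a k z) - 1)
    ((h.isOpen_awayFrom n).inter Metric.isOpen_ball)
    (h.summable_sq_step.mul_left (4 * (2 + 32 * C ^ 2) * (2 + R) / δ)) ?_ ?_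
  · simpa using key
  · filter_upwards [h.norm_factor_sub_one_le R, eventually_cofinite_ne n] with k hk hkn z hz
    rw [if_neg hkn]
    exact (hk z (mem_ball_zero_iff.1 hz.2).le).2
  · intro k
    by_cases hk : k = n
    · simp only [hk, if_true]; exact continuousOn_const
    · simp only [hk, if_false]
      exact fun z hz => ((differentiableAt_factor (hz.1 k hk)).continuousAt.sub
        continuousAt_const).continuousWithinAt

theorem differentiableOn_ite_factor (n : ℤ) (R : ℝ) (k : ℤ) : DifferentiableOn ℂ
    (fun z => if k = n then 1 else factor a k z) (awayFrom a n ∩ Metric.ball 0 R) := by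
  by_cases hk : k = n
  · simp only [hk, if_true]; exact differentiableOn_const _
  · simp only [hk, if_false]
    exact fun z hz => (differentiableAt_factor (hz.1 k hk)).differentiableWithinAt

theorem hasProd_prodExcept (h : LogSpaced a δ C) {n : ℤ} {z : ℂ} (hz : z ∈ awayFrom a n) :
    HasProd (fun k => if k = n then 1 else factor a k z) (prodExcept a n z) :=
  ((h.multipliableLocallyUniformlyOn n (‖z‖ + 1)).multipliable
    ⟨hz, by simp⟩).hasProd

theorem differentiableOn_prodExcept (h : LogSpaced a δ C) (n : ℤ) :
    DifferentiableOn ℂ (prodExcept a n) (awayFrom a n) := by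
  intro z hz
  have ho := (h.isOpen_awayFrom n).inter (Metric.isOpen_ball (x := (0 : ℂ)) (ε := ‖z‖ + 1))
  have hm := (h.multipliableLocallyUniformlyOn n (‖z‖ + 1)).hasProdLocallyUniformlyOn
  rw [hasProdLocallyUniformlyOn_iff_tendstoLocallyUniformlyOn] at hm
  have hd := hm.differentiableOn
    (.of_forall fun s => DifferentiableOn.fun_finsetProd fun k _ =>
      differentiableOn_ite_factor n _ k) ho
  exact ((hd z ⟨hz, by simp⟩).differentiableAt (ho.mem_nhds ⟨hz, by simp⟩)).differentiableWithinAt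

theorem analyticAt_prodExcept (h : LogSpaced a δ C) {n : ℤ} {z : ℂ} (hz : z ∈ awayFrom a n) :
    AnalyticAt ℂ (prodExcept a n) z :=
  (h.differentiableOn_prodExcept n).analyticAt ((h.isOpen_awayFrom n).mem_nhds hz)

theorem summable_norm_factor_sub_one (h : LogSpaced a δ C) (z : ℂ) :
    Summable fun k => ‖factor a k z - 1‖ := by
  refine (h.summable_sq_step.mul_left
    (4 * (2 + 32 * C ^ 2) * (2 + ‖z‖) / δ)).of_norm_bounded_eventually ?_
  filter_upwards [h.norm_factor_sub_one_le ‖z‖] with k hk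
  simpa using (hk z le_rfl).2

/-- This includes the poles: there one factor has the default value 0 of a division by zero, so
`fullProd` vanishes, and summability only concerns the tail. -/
theorem hasProd_factor (h : LogSpaced a δ C) (z : ℂ) :
    HasProd (fun k => factor a k z) (fullProd a z) := by
  have := multipliable_one_add_of_summable (h.summable_norm_factor_sub_one z)
  simpa [fullProd] using this.hasProd

theorem fullProd_eq (h : LogSpaced a δ C) {n : ℤ} {z : ℂ} (hz : z ∈ awayFrom a n) :
    fullProd a z = factor a n z * prodExcept a n z := by
  have hm : Multipliable (Function.update (fun k => factor a k z) n 1) := by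
    convert (h.hasProd_prodExcept hz).multipliable using 2 with k
    simp [Function.update_apply]
  exact hm.tprod_eq_mul_tprod_ite' n

theorem prodExcept_ne_zero (h : LogSpaced a δ C) {n : ℤ} {z : ℂ} (hz : z ∈ awayFrom a n)
    (hb : ∀ k, k ≠ n → z ≠ midpt a k) : prodExcept a n z ≠ 0 := by
  have key := tprod_one_add_ne_zero_of_summable
    (f := fun k => (if k = n then 1 else factor a k z) - 1) ?_ ?_
  · simpa [prodExcept] using key
  · intro k
    by_cases hk : k = n
    · simp [hk]
    · simpa [hk] using factor_ne_zero (hz k hk) (hb k hk)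
  · refine (h.summable_norm_factor_sub_one z).of_norm_bounded fun k => ?_
    by_cases hk : k = n <;> simp [hk]

end LogSpaced

/-! ### The Cauchy kernel and the exponential form of the product -/

theorem ofReal_sub_ne_zero {z : ℂ} (hz : 0 < z.im) (t : ℝ) : (t : ℂ) - z ≠ 0 := by
  intro h
  have := congrArg Complex.im h
  simp at this
  exact hz.ne' this

theorem one_add_ofReal_sq_ne_zero (t : ℝ) : (1 : ℂ) + (t : ℂ) ^ 2 ≠ 0 := by
  have : (1 + t ^ 2 : ℝ) ≠ 0 := by positivity
  exact_mod_cast this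

theorem im_le_norm_ofReal_sub (z : ℂ) (t : ℝ) : z.im ≤ ‖(t : ℂ) - z‖ := by
  have := Complex.abs_im_le_norm ((t : ℂ) - z)
  simp only [Complex.sub_im, Complex.ofReal_im, zero_sub, abs_neg] at this
  exact (le_abs_self _).trans this

theorem cauchyKernel_eq {z : ℂ} (hz : 0 < z.im) (t : ℝ) :
    cauchyKernel z t = (1 + t * z) / (((t : ℂ) - z) * (1 + (t : ℂ) ^ 2)) := by
  have h1 := ofReal_sub_ne_zero hz t
  have h2 := one_add_ofReal_sq_ne_zero t
  unfold cauchyKernel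
  field_simp
  ring

theorem exists_norm_cauchyKernel_le {z : ℂ} (hz : 0 < z.im) :
    ∃ M : ℝ, 0 ≤ M ∧ ∀ t : ℝ, ‖cauchyKernel z t‖ ≤ M * (1 / (1 + t ^ 2)) := by
  refine ⟨‖z‖ + ‖1 + z ^ 2‖ / z.im, by positivity, fun t => ?_⟩
  have h1 := ofReal_sub_ne_zero hz t
  have h0 : 0 < ‖(t : ℂ) - z‖ := norm_pos_iff.2 h1
  have h2 : ‖(1 : ℂ) + (t : ℂ) ^ 2‖ = 1 + t ^ 2 := by
    rw [show (1 : ℂ) + (t : ℂ) ^ 2 = ((1 + t ^ 2 : ℝ) : ℂ) by push_cast; rfl, Complex.norm_real,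
      Real.norm_of_nonneg (by positivity)]
  have h3 : ‖1 + t * z‖ ≤ (‖z‖ + ‖1 + z ^ 2‖ / z.im) * ‖(t : ℂ) - z‖ := by
    have : 1 + t * z = z * (t - z) + (1 + z ^ 2) := by ring
    rw [this]
    refine (norm_add_le _ _).trans ?_
    rw [norm_mul, add_mul]
    gcongr
    rw [div_mul_eq_mul_div, le_div_iff₀ hz]
    gcongr
    exact im_le_norm_ofReal_sub z t
  rw [cauchyKernel_eq hz, norm_div, norm_mul, h2, mul_one_div]
  rw [div_le_div_iff₀ (by positivity) (by positivity)]
  calc _ ≤ ((‖z‖ + ‖1 + z ^ 2‖ / z.im) * ‖(t : ℂ) - z‖) * (1 + t ^ 2) := by gcongr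
    _ = _ := by ring

theorem continuous_cauchyKernel {z : ℂ} (hz : 0 < z.im) : Continuous (cauchyKernel z) := by
  unfold cauchyKernel
  refine .sub (.div (by fun_prop) (by fun_prop) (ofReal_sub_ne_zero hz))
    (.div (by fun_prop) (by fun_prop) one_add_ofReal_sq_ne_zero)

theorem integrable_cauchyKernel {z : ℂ} (hz : 0 < z.im) : Integrable (cauchyKernel z) := by
  obtain ⟨M, -, hM⟩ := exists_norm_cauchyKernel_le hz
  refine Integrable.mono' (integrable_inv_one_add_sq.const_mul M)
    (continuous_cauchyKernel hz).aestronglyMeasurable (.of_forall fun t => ?_)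
  simpa using hM t

theorem cauchyKernel_im_nonneg {z : ℂ} (hz : 0 < z.im) (t : ℝ) : 0 ≤ (cauchyKernel z t).im := by
  have h2 : (t : ℂ) / (1 + (t : ℂ) ^ 2) = ((t / (1 + t ^ 2) : ℝ) : ℂ) := by push_cast; rfl
  unfold cauchyKernel
  rw [h2, Complex.sub_im, Complex.ofReal_im, sub_zero, one_div, Complex.inv_im]
  simp only [Complex.sub_im, Complex.ofReal_im, zero_sub, neg_neg]
  exact div_nonneg hz.le (Complex.normSq_nonneg _)

/-- A primitive of the Cauchy kernel. -/
noncomputable def cauchyPrimitive (z : ℂ) (t : ℝ) : ℂ :=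
  Complex.log (Complex.I * ((t : ℂ) - z)) - (Real.log (1 + t ^ 2) / 2 : ℝ)

/-- The real part of i(t - z) is Im z > 0. The rotation by i keeps the principal logarithm smooth
along the whole line. -/
theorem I_mul_mem_slitPlane {z : ℂ} (hz : 0 < z.im) (t : ℝ) :
    Complex.I * ((t : ℂ) - z) ∈ Complex.slitPlane := by
  left
  simpa using hz

theorem hasDerivAt_cauchyPrimitive {z : ℂ} (hz : 0 < z.im) (t : ℝ) :
    HasDerivAt (cauchyPrimitive z) (cauchyKernel z t) t := by
  have h0 : HasDerivAt (fun t : ℝ => Complex.I * ((t : ℂ) - z)) (Complex.I * 1) t :=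
    ((Complex.ofRealCLM.hasDerivAt (x := t)).sub_const z).const_mul Complex.I
  have h1 := h0.clog_real (I_mul_mem_slitPlane hz t)
  have h2 : HasDerivAt (fun t : ℝ => Real.log (1 + t ^ 2) / 2) ((2 * t) / (1 + t ^ 2) / 2) t := by
    have h3 : HasDerivAt (fun t : ℝ => 1 + t ^ 2) (2 * t) t := by
      simpa using (hasDerivAt_pow 2 t).const_add 1
    exact (h3.log (by positivity)).div_const 2
  have h4 := h1.sub h2.ofReal_comp
  refine h4.congr_deriv ?_
  have := ofReal_sub_ne_zero hz t
  unfold cauchyKernel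
  push_cast
  congr 1
  · rw [mul_one, ← div_div, div_self Complex.I_ne_zero]
  · ring

/-- In a single logarithm the argument stays bounded and tends to ±i at ±∞, which makes the limits
of the primitive visible. -/
theorem cauchyPrimitive_eq {z : ℂ} (hz : 0 < z.im) (t : ℝ) :
    cauchyPrimitive z t =
      Complex.log (Complex.I * (((t / √(1 + t ^ 2) : ℝ) : ℂ) - z * ((√(1 + t ^ 2))⁻¹ : ℝ))) := by
  have hs : 0 < √(1 + t ^ 2) := by positivity
  have h1 : Complex.I * (((t / √(1 + t ^ 2) : ℝ) : ℂ) - z * ((√(1 + t ^ 2))⁻¹ : ℝ)) =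
      ((√(1 + t ^ 2))⁻¹ : ℝ) * (Complex.I * ((t : ℂ) - z)) := by
    rw [div_eq_mul_inv]; push_cast; ring
  rw [h1, Complex.log_ofReal_mul (inv_pos.2 hs)
    (mul_ne_zero Complex.I_ne_zero (ofReal_sub_ne_zero hz t)), Real.log_inv,
    Real.log_sqrt (by positivity)]
  unfold cauchyPrimitive
  push_cast
  ring

theorem tendsto_inv_sqrt_one_add_sq {l : Filter ℝ} (hl : Tendsto (fun t : ℝ => |t|) l atTop) :
    Tendsto (fun t : ℝ => (√(1 + t ^ 2))⁻¹) l (nhds 0) :=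
  tendsto_inv_atTop_zero.comp (tendsto_atTop_mono abs_le_sqrt_one_add_sq hl)

theorem tendsto_abs_div_sqrt {l : Filter ℝ} (hl : Tendsto (fun t : ℝ => |t|) l atTop) :
    Tendsto (fun t : ℝ => |t| / √(1 + t ^ 2)) l (nhds 1) := by
  have h0 := tendsto_inv_sqrt_one_add_sq hl
  have h1 : Tendsto (fun t : ℝ => √(1 - ((√(1 + t ^ 2))⁻¹) ^ 2)) l (nhds 1) := by
    have := ((h0.pow 2).const_sub 1).sqrt
    simpa using this
  refine h1.congr fun t => ?_
  have hs : √(1 + t ^ 2) ≠ 0 := by positivity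
  have hs2 : √(1 + t ^ 2) ^ 2 = 1 + t ^ 2 := Real.sq_sqrt (by positivity)
  rw [← Real.sqrt_sq (show 0 ≤ |t| / √(1 + t ^ 2) by positivity)]
  congr 1
  rw [div_pow, inv_pow, hs2, sq_abs]
  have : (1 + t ^ 2) ≠ 0 := by positivity
  field_simp
  ring

theorem tendsto_cauchyPrimitive {z : ℂ} (hz : 0 < z.im) {l : Filter ℝ} {s : ℝ}
    (hl : Tendsto (fun t : ℝ => |t|) l atTop) (hs : s = 1 ∨ s = -1)
    (hsgn : ∀ᶠ t in l, t = s * |t|) :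
    Tendsto (cauchyPrimitive z) l (nhds (s * (Real.pi / 2) * Complex.I)) := by
  have h1 : Tendsto (fun t : ℝ => t / √(1 + t ^ 2)) l (nhds s) := by
    have := (tendsto_abs_div_sqrt hl).const_mul s
    rw [mul_one] at this
    refine this.congr' (hsgn.mono fun t ht => ?_)
    dsimp only
    rw [← mul_div_assoc, ← ht]
  have h2 : Tendsto (fun t : ℝ => Complex.I * (((t / √(1 + t ^ 2) : ℝ) : ℂ) -
      z * ((√(1 + t ^ 2))⁻¹ : ℝ))) l (nhds (Complex.I * ((s : ℂ) - z * (0 : ℝ)))) := by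
    refine Tendsto.const_mul _ (Tendsto.sub ?_ (Tendsto.const_mul _ ?_))
    · exact (Complex.continuous_ofReal.tendsto _).comp h1
    · exact (Complex.continuous_ofReal.tendsto _).comp (tendsto_inv_sqrt_one_add_sq hl)
  have h3 : Complex.I * ((s : ℂ) - z * (0 : ℝ)) = Complex.I * s := by simp
  rw [h3] at h2
  have hmem : Complex.I * s ∈ Complex.slitPlane := by
    right
    rcases hs with rfl | rfl <;> simp
  have h4 := h2.clog hmem
  have h5 : Complex.log (Complex.I * s) = s * (Real.pi / 2) * Complex.I := by
    rcases hs with rfl | rfl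
    · simp [Complex.log_I]
    · simp [Complex.log_neg_I]
  rw [h5] at h4
  exact h4.congr fun t => (cauchyPrimitive_eq hz t).symm

theorem integral_cauchyKernel {z : ℂ} (hz : 0 < z.im) :
    ∫ t : ℝ, cauchyKernel z t = Real.pi * Complex.I := by
  rw [integral_of_hasDerivAt_of_tendsto (hasDerivAt_cauchyPrimitive hz) (integrable_cauchyKernel hz)
    (tendsto_cauchyPrimitive hz tendsto_abs_atBot_atTop (.inr rfl) ?_)
    (tendsto_cauchyPrimitive hz tendsto_abs_atTop_atTop (.inl rfl) ?_)]
  · push_cast; ring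
  · filter_upwards [eventually_le_atBot 0] with t ht
    rw [abs_of_nonpos ht]; ring
  · filter_upwards [eventually_ge_atTop 0] with t ht
    rw [abs_of_nonneg ht]; ring

theorem setIntegral_cauchyKernel {z : ℂ} (hz : 0 < z.im) {s t : ℝ} (hst : s ≤ t) :
    ∫ x in Set.Ioo s t, cauchyKernel z x = cauchyPrimitive z t - cauchyPrimitive z s := by
  rw [← integral_Ioc_eq_integral_Ioo, ← intervalIntegral.integral_of_le hst]
  exact intervalIntegral.integral_eq_sub_of_hasDerivAt
    (fun x _ => hasDerivAt_cauchyPrimitive hz x)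
    ((continuous_cauchyKernel hz).intervalIntegrable _ _)

theorem exp_cauchyPrimitive {z : ℂ} (hz : 0 < z.im) (t : ℝ) :
    Complex.exp (cauchyPrimitive z t) = Complex.I * ((t : ℂ) - z) / (√(1 + t ^ 2) : ℝ) := by
  unfold cauchyPrimitive
  rw [Complex.exp_sub, Complex.exp_log (mul_ne_zero Complex.I_ne_zero (ofReal_sub_ne_zero hz t)),
    ← Complex.ofReal_exp, ← Real.log_sqrt (by positivity), Real.exp_log (by positivity)]

/-- This explains `normRatio`: the term t/(1 + t²) of the kernel integrates to the logarithm of √(1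
+ t²). -/
theorem exp_setIntegral_cauchyKernel {a : ℤ → ℝ} (k : ℤ) (hk : a k ≤ midpt a k) {z : ℂ}
    (hz : 0 < z.im) :
    Complex.exp (∫ x in Set.Ioo (a k) (midpt a k), cauchyKernel z x) = factor a k z := by
  have h1 := ofReal_sub_ne_zero hz (a k)
  have h2 : (√(1 + midpt a k ^ 2) : ℂ) ≠ 0 := by
    exact_mod_cast (Real.sqrt_pos.2 (by positivity)).ne'
  have h3 : (√(1 + a k ^ 2) : ℂ) ≠ 0 := by
    exact_mod_cast (Real.sqrt_pos.2 (by positivity)).ne'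
  have h4 := Complex.I_ne_zero
  rw [setIntegral_cauchyKernel hz hk, Complex.exp_sub, exp_cauchyPrimitive hz,
    exp_cauchyPrimitive hz]
  unfold factor normRatio
  push_cast
  field_simp

theorem measurableSet_halfGaps (a : ℤ → ℝ) : MeasurableSet (halfGaps a) :=
  .iUnion fun _ => measurableSet_Ioo

theorem abs_shiftFun (a : ℤ → ℝ) (t : ℝ) : |shiftFun a t| = 1 / 2 := by
  unfold shiftFun
  by_cases ht : t ∈ halfGaps a
  · rw [Set.indicator_of_mem ht]; norm_num
  · rw [Set.indicator_of_notMem ht]; norm_num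

theorem integral_shiftFun_mul (a : ℤ → ℝ) {z : ℂ} (hz : 0 < z.im) :
    ∫ t : ℝ, (shiftFun a t : ℂ) * cauchyKernel z t =
      (∫ t in halfGaps a, cauchyKernel z t) - Real.pi / 2 * Complex.I := by
  have hi := integrable_cauchyKernel hz
  have h1 : ∀ t : ℝ, (shiftFun a t : ℂ) * cauchyKernel z t =
      (halfGaps a).indicator (cauchyKernel z) t - 1 / 2 * cauchyKernel z t := by
    intro t
    unfold shiftFun
    by_cases ht : t ∈ halfGaps a
    · simp only [Set.indicator_of_mem ht]; push_cast; ring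
    · simp only [Set.indicator_of_notMem ht]; push_cast; ring
  simp_rw [h1]
  rw [integral_sub (hi.indicator (measurableSet_halfGaps a)) (hi.const_mul _),
    integral_indicator (measurableSet_halfGaps a), integral_const_mul, integral_cauchyKernel hz]
  ring

/-- The imaginary part of the kernel is nonnegative with total integral π, and |u| = 1/2. The bound
gives Re F ≥ 0 and keeps the exponent in the strip where the principal logarithm inverts exp. -/
theorem abs_im_integral_shiftFun_le (a : ℤ → ℝ) {z : ℂ} (hz : 0 < z.im) :
    |(∫ t : ℝ, (shiftFun a t : ℂ) * cauchyKernel z t).im| ≤ Real.pi / 2 := by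
  have hi := integrable_cauchyKernel hz
  have hm : Measurable (shiftFun a) :=
    (measurable_const.indicator (measurableSet_halfGaps a)).sub_const _
  have hint : Integrable fun t : ℝ => (shiftFun a t : ℂ) * cauchyKernel z t := by
    refine hi.bdd_mul (c := 1 / 2)
      (Complex.measurable_ofReal.comp hm).aestronglyMeasurable (.of_forall fun t => ?_)
    rw [Complex.norm_real, Real.norm_eq_abs, abs_shiftFun]
  have h1 : (∫ t : ℝ, (shiftFun a t : ℂ) * cauchyKernel z t).im =
      ∫ t : ℝ, shiftFun a t * (cauchyKernel z t).im := by
    rw [← RCLike.im_eq_complex_im, ← integral_im hint]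
    simp
  have h2 : ∫ t : ℝ, (cauchyKernel z t).im = Real.pi := by
    have := integral_im hi
    simp only [RCLike.im_eq_complex_im] at this
    rw [this, integral_cauchyKernel hz]
    simp
  rw [h1, ← Real.norm_eq_abs]
  refine (norm_integral_le_of_norm_le (g := fun t => 1 / 2 * (cauchyKernel z t).im)
    (hi.im.const_mul _) (.of_forall fun t => ?_)).trans ?_
  · rw [norm_mul, Real.norm_eq_abs, abs_shiftFun, Real.norm_of_nonneg (cauchyKernel_im_nonneg hz t)]
  · rw [integral_const_mul, h2]; linarith

namespace LogSpaced

variable {a : ℤ → ℝ} {δ C : ℝ}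

theorem fullProd_eq_exp (h : LogSpaced a δ C) {z : ℂ} (hz : 0 < z.im) :
    fullProd a z = Complex.exp (∫ t in halfGaps a, cauchyKernel z t) := by
  have hd : Pairwise (Function.onFun Disjoint fun n : ℤ => Set.Ioo (a n) (midpt a n)) := by
    have key : ∀ j k : ℤ, j < k → Disjoint (Set.Ioo (a j) (midpt a j)) (Set.Ioo (a k) (midpt a k)) := by
      intro j k hjk
      have h1 := h.strictMono.monotone (show j + 1 ≤ k by omega)
      have h2 := h.midpt_lt j
      rw [Set.disjoint_left]
      rintro x ⟨-, hx⟩ ⟨hx', -⟩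
      linarith
    intro j k hjk
    rcases lt_or_gt_of_ne hjk with hlt | hlt
    · exact key j k hlt
    · exact (key k j hlt).symm
  have h1 := hasSum_integral_iUnion (μ := volume) (fun n : ℤ => measurableSet_Ioo) hd
    (integrable_cauchyKernel hz).integrableOn
  have h2 := h1.cexp
  refine HasProd.unique (h.hasProd_factor z) ?_
  change HasProd _ (Complex.exp (∫ t in ⋃ n : ℤ, Set.Ioo (a n) (midpt a n), cauchyKernel z t))
  convert h2 using 1
  ext k
  exact (exp_setIntegral_cauchyKernel k (h.lt_midpt k).le hz).symm

end LogSpaced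

/-! ### The modulus of the product: local ratios and telescoping -/

/-- The quotient `|b k - z| ^ 2 / (|a k - z| |a (k + 1) - z|)`. -/
noncomputable def ratio (a : ℤ → ℝ) (k : ℤ) (z : ℂ) : ℝ :=
  ‖(midpt a k : ℂ) - z‖ ^ 2 / (‖(a k : ℂ) - z‖ * ‖(a (k + 1) : ℂ) - z‖)

/-- The quotient `|a k - z| / |a k - i|`. -/
noncomputable def edge (a : ℤ → ℝ) (z : ℂ) (k : ℤ) : ℝ :=
  ‖(a k : ℂ) - z‖ / ‖(a k : ℂ) - Complex.I‖

theorem prod_Ico_div_int {f : ℤ → ℝ} (hf : ∀ k, f k ≠ 0) (m : ℤ) (j : ℕ) :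
    ∏ k ∈ Finset.Ico m (m + j), f (k + 1) / f k = f (m + j) / f m := by
  induction j with
  | zero => simp [hf m]
  | succ j ih =>
    have h1 : Finset.Ico m (m + (j + 1 : ℕ)) = insert (m + j) (Finset.Ico m (m + j)) := by
      ext k; simp only [Finset.mem_Ico, Finset.mem_insert]; push_cast; omega
    rw [h1, Finset.prod_insert (by simp), ih]
    have := hf (m + j)
    have := hf m
    push_cast
    rw [← add_assoc]
    field_simp

theorem prod_Ico_neg_div {f : ℤ → ℝ} (hf : ∀ k, f k ≠ 0) (N : ℕ) :
    ∏ k ∈ Finset.Ico (-N : ℤ) N, f (k + 1) / f k = f N / f (-N) := by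
  have := prod_Ico_div_int hf (-N) (2 * N)
  have h1 : (-N : ℤ) + (2 * N : ℕ) = N := by push_cast; ring
  rwa [h1] at this

theorem norm_ofReal_sub_mul_I (t R : ℝ) : ‖(t : ℂ) - R * Complex.I‖ = √(t ^ 2 + R ^ 2) := by
  rw [Complex.norm_eq_sqrt_sq_add_sq]; simp

theorem norm_ofReal_sub_I (t : ℝ) : ‖(t : ℂ) - Complex.I‖ = √(1 + t ^ 2) := by
  have := norm_ofReal_sub_mul_I t 1
  simp only [Complex.ofReal_one, one_mul, one_pow] at this
  rw [this, add_comm]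

/-- One of the two factors |a k - z| is traded for |a (k + 1) - z| at the price of a quotient that
telescopes. As |t - i| = √(1 + t²), the normalizing constants become values at i. -/
theorem norm_factor_sq {a : ℤ → ℝ} {k : ℤ} {z : ℂ} (h : z ≠ a k) (h' : z ≠ a (k + 1)) :
    ‖factor a k z‖ ^ 2 =
      ratio a k z / ratio a k Complex.I * (edge a z (k + 1) / edge a z k) := by
  have h1 : ‖(a k : ℂ) - z‖ ≠ 0 := norm_ne_zero_iff.2 (sub_ne_zero.2 h.symm)
  have h2 : ‖(a (k + 1) : ℂ) - z‖ ≠ 0 := norm_ne_zero_iff.2 (sub_ne_zero.2 h'.symm)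
  have h3 : √(1 + a k ^ 2) ≠ 0 := by positivity
  have h4 : √(1 + a (k + 1) ^ 2) ≠ 0 := by positivity
  have h5 : √(1 + midpt a k ^ 2) ≠ 0 := by positivity
  unfold factor ratio edge normRatio
  simp only [norm_ofReal_sub_I]
  rw [norm_mul, norm_div, Complex.norm_real, Real.norm_of_nonneg (by positivity)]
  field_simp

theorem norm_prod_factor_sq {a : ℤ → ℝ} {z : ℂ} (h : ∀ k, z ≠ a k) (N : ℕ) :
    ‖∏ k ∈ Finset.Ico (-N : ℤ) N, factor a k z‖ ^ 2 =
      (∏ k ∈ Finset.Ico (-N : ℤ) N, ratio a k z) /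
        (∏ k ∈ Finset.Ico (-N : ℤ) N, ratio a k Complex.I) * (edge a z N / edge a z (-N)) := by
  have hne : ∀ k, edge a z k ≠ 0 := by
    intro k
    unfold edge
    rw [norm_ofReal_sub_I]
    exact div_ne_zero (norm_ne_zero_iff.2 (sub_ne_zero.2 (h k).symm)) (by positivity)
  rw [norm_prod, ← Finset.prod_pow, ← prod_Ico_neg_div hne, ← Finset.prod_div_distrib,
    ← Finset.prod_mul_distrib]
  exact Finset.prod_congr rfl fun k _ => norm_factor_sq (h k) (h (k + 1))

/-- With midpoint b and half step e, (a² + R²)(a'² + R²) = (b² + R² + e²)² - 4b²e². So the ratio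
differs from 1 only by terms of order e² relative to squared moduli, and R ≥ 1 permits replacing R
by 1 in these errors. -/
theorem ratio_mul_I_bounds {a a' R : ℝ} (hR : 1 ≤ R) :
    Real.exp (-((a' - a) ^ 2 / 2 * (1 / (1 + a ^ 2) + 1 / (1 + a' ^ 2) +
        1 / (1 + ((a + a') / 2) ^ 2)))) ≤
      (((a + a') / 2) ^ 2 + R ^ 2) / (√(a ^ 2 + R ^ 2) * √(a' ^ 2 + R ^ 2)) ∧
    (((a + a') / 2) ^ 2 + R ^ 2) / (√(a ^ 2 + R ^ 2) * √(a' ^ 2 + R ^ 2)) ≤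
      Real.exp ((a' - a) ^ 2 / 2 * (1 / (1 + a ^ 2) + 1 / (1 + a' ^ 2) +
        1 / (1 + ((a + a') / 2) ^ 2))) := by
  set b := (a + a') / 2 with hb
  set e := (a' - a) / 2 with he
  have ha : a = b - e := by rw [hb, he]; ring
  have ha' : a' = b + e := by rw [hb, he]; ring
  have he2 : (a' - a) ^ 2 / 2 = 2 * e ^ 2 := by rw [he]; ring
  rw [he2]
  clear_value b e
  have hR2 : 1 ≤ R ^ 2 := by nlinarith
  have hB : 0 < b ^ 2 + R ^ 2 := by positivity
  have hA : 0 < a ^ 2 + R ^ 2 := by positivity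
  have hA' : 0 < a' ^ 2 + R ^ 2 := by positivity
  rw [← Real.sqrt_mul hA.le]
  have hAA : 0 < (a ^ 2 + R ^ 2) * (a' ^ 2 + R ^ 2) := by positivity
  have hS : 0 < √((a ^ 2 + R ^ 2) * (a' ^ 2 + R ^ 2)) := Real.sqrt_pos.2 hAA
  constructor
  · have h1 : √((a ^ 2 + R ^ 2) * (a' ^ 2 + R ^ 2)) ≤ b ^ 2 + R ^ 2 + e ^ 2 := by
      rw [Real.sqrt_le_left (by positivity)]
      subst ha ha'
      nlinarith [mul_nonneg (sq_nonneg b) (sq_nonneg e)]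
    have h2 : b ^ 2 + R ^ 2 + e ^ 2 ≤ (b ^ 2 + R ^ 2) * Real.exp (e ^ 2 / (1 + b ^ 2)) := by
      have h3 := Real.add_one_le_exp (e ^ 2 / (1 + b ^ 2))
      have h4 : e ^ 2 ≤ (b ^ 2 + R ^ 2) * (e ^ 2 / (1 + b ^ 2)) := by
        rw [mul_div_assoc', le_div_iff₀ (by positivity)]
        nlinarith [sq_nonneg e]
      nlinarith
    have h5 : Real.exp (e ^ 2 / (1 + b ^ 2)) ≤
        Real.exp (2 * e ^ 2 * (1 / (1 + a ^ 2) + 1 / (1 + a' ^ 2) + 1 / (1 + b ^ 2))) := by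
      apply Real.exp_le_exp.2
      have h6 : 0 ≤ 1 / (1 + a ^ 2) := by positivity
      have h7 : 0 ≤ 1 / (1 + a' ^ 2) := by positivity
      have h8 : 0 ≤ 1 / (1 + b ^ 2) := by positivity
      rw [div_eq_mul_one_div]
      nlinarith [mul_nonneg (sq_nonneg e) h6, mul_nonneg (sq_nonneg e) h7,
        mul_nonneg (sq_nonneg e) h8]
    rw [Real.exp_neg, inv_le_comm₀ (Real.exp_pos _) (by positivity), inv_div, div_le_iff₀ hB]
    calc _ ≤ (b ^ 2 + R ^ 2) * Real.exp (e ^ 2 / (1 + b ^ 2)) := h1.trans h2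
      _ ≤ _ := by rw [mul_comm]; gcongr
  · rw [div_le_iff₀ hS]
    set E := 2 * e ^ 2 * (1 / (1 + a ^ 2) + 1 / (1 + a' ^ 2) + 1 / (1 + b ^ 2)) with hE
    have hm : b ^ 2 * e ^ 2 * 4 ≤
        ((a ^ 2 + R ^ 2) * (a' ^ 2 + R ^ 2)) * (4 * e ^ 2 * (1 / (1 + a ^ 2) + 1 / (1 + a' ^ 2))) := by
      have hb2 : b ^ 2 ≤ (a ^ 2 + R ^ 2) + (a' ^ 2 + R ^ 2) := by
        subst ha ha'; nlinarith [sq_nonneg e, sq_nonneg b]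
      have hx : 1 ≤ (a ^ 2 + R ^ 2) * (1 / (1 + a ^ 2)) := by
        rw [mul_one_div, le_div_iff₀ (by positivity)]; linarith
      have hx' : 1 ≤ (a' ^ 2 + R ^ 2) * (1 / (1 + a' ^ 2)) := by
        rw [mul_one_div, le_div_iff₀ (by positivity)]; linarith
      have : (a ^ 2 + R ^ 2) + (a' ^ 2 + R ^ 2) ≤
          ((a ^ 2 + R ^ 2) * (a' ^ 2 + R ^ 2)) * (1 / (1 + a ^ 2) + 1 / (1 + a' ^ 2)) := by
        nlinarith [mul_le_mul_of_nonneg_left hx hA'.le, mul_le_mul_of_nonneg_left hx' hA.le]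
      nlinarith [mul_le_mul_of_nonneg_left (hb2.trans this) (sq_nonneg e)]
    have h1 : (b ^ 2 + R ^ 2) ^ 2 ≤ ((a ^ 2 + R ^ 2) * (a' ^ 2 + R ^ 2)) + b ^ 2 * e ^ 2 * 4 := by
      subst ha ha'
      nlinarith [mul_nonneg (sq_nonneg e) hB.le, sq_nonneg (e ^ 2)]
    have h2 : 4 * e ^ 2 * (1 / (1 + a ^ 2) + 1 / (1 + a' ^ 2)) ≤ 2 * E := by
      rw [hE]
      have : 0 ≤ e ^ 2 * (1 / (1 + b ^ 2)) := by positivity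
      nlinarith
    have h3 : (b ^ 2 + R ^ 2) ^ 2 ≤
        (Real.exp E * √((a ^ 2 + R ^ 2) * (a' ^ 2 + R ^ 2))) ^ 2 := by
      rw [mul_pow, Real.sq_sqrt hAA.le, ← Real.exp_nat_mul]
      have h4 := Real.add_one_le_exp (2 * E)
      push_cast
      nlinarith [mul_le_mul_of_nonneg_left (h2.trans (by linarith : 2 * E ≤ Real.exp (2 * E) - 1))
        hAA.le]
    exact (sq_le_sq₀ hB.le (by positivity)).1 h3

namespace LogSpaced

variable {a : ℤ → ℝ} {δ C : ℝ}

theorem abs_log_ratio_le (h : LogSpaced a δ C) (k : ℤ) {R : ℝ} (hR : 1 ≤ R) :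
    Real.exp (-((1 + 2 * (2 + 32 * C ^ 2) ^ 2) * (step a k ^ 2 / (1 + |a k|) ^ 2))) ≤
      ratio a k (R * Complex.I) ∧
    ratio a k (R * Complex.I) ≤
      Real.exp ((1 + 2 * (2 + 32 * C ^ 2) ^ 2) * (step a k ^ 2 / (1 + |a k|) ^ 2)) := by
  have key := ratio_mul_I_bounds (a := a k) (a' := a (k + 1)) hR
  have he : ratio a k (R * Complex.I) = (((a k + a (k + 1)) / 2) ^ 2 + R ^ 2) /
      (√(a k ^ 2 + R ^ 2) * √(a (k + 1) ^ 2 + R ^ 2)) := by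
    unfold ratio
    simp only [norm_ofReal_sub_mul_I]
    rw [Real.sq_sqrt (by positivity)]
    rfl
  rw [he]
  set K := 2 + 32 * C ^ 2 with hK
  have hK0 : 0 < K := by positivity
  have gen : ∀ x : ℝ, 1 + |a k| ≤ K * (1 + |x|) → 1 / (1 + x ^ 2) ≤ 2 * K ^ 2 / (1 + |a k|) ^ 2 := by
    intro x hx
    rw [div_le_div_iff₀ (by positivity) (by positivity)]
    have h1 : (1 + |a k|) ^ 2 ≤ (K * (1 + |x|)) ^ 2 := by gcongr
    have h2 : (1 + |x|) ^ 2 ≤ 2 * (1 + x ^ 2) := by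
      nlinarith [sq_abs x, sq_nonneg (1 - |x|)]
    nlinarith [mul_le_mul_of_nonneg_left h2 (sq_nonneg K)]
  have g1 : 1 / (1 + a k ^ 2) ≤ 2 / (1 + |a k|) ^ 2 := by
    rw [div_le_div_iff₀ (by positivity) (by positivity)]
    nlinarith [sq_abs (a k), sq_nonneg (1 - |a k|)]
  have g2 := gen _ (h.one_add_abs_le_succ k)
  have g3 := gen _ (h.one_add_abs_le_midpt k)
  have hexp : (a (k + 1) - a k) ^ 2 / 2 * (1 / (1 + a k ^ 2) + 1 / (1 + a (k + 1) ^ 2) +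
        1 / (1 + ((a k + a (k + 1)) / 2) ^ 2)) ≤
      (1 + 2 * K ^ 2) * (step a k ^ 2 / (1 + |a k|) ^ 2) := by
    change step a k ^ 2 / 2 * (1 / (1 + a k ^ 2) + 1 / (1 + a (k + 1) ^ 2) +
        1 / (1 + midpt a k ^ 2)) ≤ _
    calc _ ≤ step a k ^ 2 / 2 * (2 / (1 + |a k|) ^ 2 + 2 * K ^ 2 / (1 + |a k|) ^ 2 +
          2 * K ^ 2 / (1 + |a k|) ^ 2) := by gcongr
      _ = _ := by ring
  exact ⟨(Real.exp_le_exp.2 (neg_le_neg hexp)).trans key.1, key.2.trans (Real.exp_le_exp.2 hexp)⟩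

theorem exists_prod_ratio_bounds (h : LogSpaced a δ C) : ∃ K : ℝ, 1 ≤ K ∧ ∀ R : ℝ, 1 ≤ R →
    ∀ s : Finset ℤ, K⁻¹ ≤ ∏ k ∈ s, ratio a k (R * Complex.I) ∧
      ∏ k ∈ s, ratio a k (R * Complex.I) ≤ K := by
  set D := 1 + 2 * (2 + 32 * C ^ 2) ^ 2 with hD
  have hD0 : 0 < D := by positivity
  set f : ℤ → ℝ := fun k => D * (step a k ^ 2 / (1 + |a k|) ^ 2) with hf
  have hf0 : ∀ k, 0 ≤ f k := fun k => by positivity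
  have hs : Summable f := h.summable_sq_step.mul_left D
  refine ⟨Real.exp (∑' k, f k), Real.one_le_exp (tsum_nonneg hf0), fun R hR s => ⟨?_, ?_⟩⟩
  · rw [← Real.exp_neg]
    calc _ ≤ Real.exp (-∑ k ∈ s, f k) := by
          apply Real.exp_le_exp.2
          exact neg_le_neg (hs.sum_le_tsum s fun k _ => hf0 k)
      _ = ∏ k ∈ s, Real.exp (-f k) := by rw [← Real.exp_sum, Finset.sum_neg_distrib]
      _ ≤ _ := Finset.prod_le_prod (fun k _ => (Real.exp_pos _).le)
          fun k _ => (h.abs_log_ratio_le k hR).1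
  · calc _ ≤ ∏ k ∈ s, Real.exp (f k) := Finset.prod_le_prod
            (fun k _ => (Real.exp_pos _).le.trans (h.abs_log_ratio_le k hR).1)
            fun k _ => (h.abs_log_ratio_le k hR).2
      _ = Real.exp (∑ k ∈ s, f k) := by rw [← Real.exp_sum]
      _ ≤ _ := Real.exp_le_exp.2 (hs.sum_le_tsum s fun k _ => hf0 k)

theorem edge_mul_I_bounds (a : ℤ → ℝ) (k : ℤ) {R : ℝ} (hR : 1 ≤ R) :
    1 ≤ edge a (R * Complex.I) k ∧ edge a (R * Complex.I) k ≤ R := by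
  have hs : 0 < √(1 + a k ^ 2) := by positivity
  unfold edge
  rw [norm_ofReal_sub_I, norm_ofReal_sub_mul_I, one_le_div hs, div_le_iff₀ hs]
  constructor
  · apply Real.sqrt_le_sqrt; nlinarith
  · rw [Real.sqrt_le_left (by positivity), mul_pow, Real.sq_sqrt (by positivity)]
    nlinarith [mul_nonneg (sq_nonneg (a k)) (by nlinarith : 0 ≤ R ^ 2 - 1)]

/-- The ratios contribute a bounded factor and the two edges at most R either way. Growth and decay
of order √R, slower than R, will exclude a linear term in the Herglotz representations. -/
theorem exists_norm_prod_factor_mul_I_bounds (h : LogSpaced a δ C) : ∃ K : ℝ, 1 ≤ K ∧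
    ∀ R : ℝ, 1 ≤ R → ∀ N : ℕ,
      (K * R)⁻¹ ≤ ‖∏ k ∈ Finset.Ico (-N : ℤ) N, factor a k (R * Complex.I)‖ ^ 2 ∧
      ‖∏ k ∈ Finset.Ico (-N : ℤ) N, factor a k (R * Complex.I)‖ ^ 2 ≤ K * R := by
  obtain ⟨K, hK1, hK⟩ := h.exists_prod_ratio_bounds
  have hK0 : 0 < K := by linarith
  refine ⟨K * K, by nlinarith, fun R hR N => ?_⟩
  have hR0 : 0 < R := by linarith
  have hne : ∀ k, (R * Complex.I : ℂ) ≠ a k := by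
    intro k e
    have := congrArg Complex.im e
    simp at this
    linarith
  rw [norm_prod_factor_sq hne]
  obtain ⟨u1, u2⟩ := hK R hR (Finset.Ico (-N : ℤ) N)
  obtain ⟨v1, v2⟩ := hK 1 le_rfl (Finset.Ico (-N : ℤ) N)
  simp only [Complex.ofReal_one, one_mul] at v1 v2
  obtain ⟨e1, e2⟩ := edge_mul_I_bounds a N hR
  obtain ⟨f1, f2⟩ := edge_mul_I_bounds a (-N) hR
  set U := ∏ k ∈ Finset.Ico (-N : ℤ) N, ratio a k (R * Complex.I)
  set V := ∏ k ∈ Finset.Ico (-N : ℤ) N, ratio a k Complex.I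
  have hKi : 0 < K⁻¹ := inv_pos.2 hK0
  have hV : 0 < V := hKi.trans_le v1
  have hU : 0 < U := hKi.trans_le u1
  constructor
  · calc (K * K * R)⁻¹ = K⁻¹ / K * (1 / R) := by field_simp
      _ ≤ U / V * (edge a (R * Complex.I) N / edge a (R * Complex.I) (-N)) := by gcongr
  · calc U / V * (edge a (R * Complex.I) N / edge a (R * Complex.I) (-N)) ≤ K / K⁻¹ * (R / 1) := by
          gcongr
      _ = K * K * R := by field_simp

end LogSpaced

theorem tendsto_norm_sub_div_norm_sub {l : Filter ℝ} (hl : Tendsto (fun t : ℝ => |t|) l atTop)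
    (z : ℂ) : Tendsto (fun t : ℝ => ‖(t : ℂ) - z‖ / ‖(t : ℂ) - Complex.I‖) l (nhds 1) := by
  have h0 := (tendsto_inv_sqrt_one_add_sq hl).const_mul ‖z - Complex.I‖
  rw [mul_zero] at h0
  rw [tendsto_iff_norm_sub_tendsto_zero]
  refine squeeze_zero (fun _ => norm_nonneg _) (fun t => ?_) h0
  have hs : 0 < √(1 + t ^ 2) := by positivity
  rw [norm_ofReal_sub_I, div_sub_one hs.ne', norm_div, Real.norm_of_nonneg hs.le, div_eq_mul_inv,
    ← norm_ofReal_sub_I]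
  gcongr
  refine (abs_norm_sub_norm_le _ _).trans ?_
  rw [← norm_neg]
  exact (congrArg norm (by ring)).le

theorem ratio_ofReal (a : ℤ → ℝ) (k : ℤ) (x : ℝ) :
    ratio a k x = (midpt a k - x) ^ 2 / (|a k - x| * |a (k + 1) - x|) := by
  unfold ratio
  simp only [← Complex.ofReal_sub, Complex.norm_real, Real.norm_eq_abs, sq_abs]

/-- By the choice of the midpoint, (b - x)² exceeds (a k - x)(a (k + 1) - x) by step²/4, and the
latter product is positive outside the interval. -/
theorem ratio_eq_one_add {a : ℤ → ℝ} (k : ℤ) {x : ℝ} (hx : x ∉ Set.Icc (a k) (a (k + 1)))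
    (hk : a k < a (k + 1)) :
    ratio a k x = 1 + step a k ^ 2 / (4 * (|a k - x| * |a (k + 1) - x|)) := by
  have hpos : 0 < (a k - x) * (a (k + 1) - x) := by
    rw [Set.mem_Icc, not_and_or, not_le, not_le] at hx
    rcases hx with hx | hx
    · exact mul_pos (by linarith) (by linarith)
    · exact mul_pos_of_neg_of_neg (by linarith) (by linarith)
  rw [ratio_ofReal, ← abs_mul, abs_of_pos hpos]
  have hid : 4 * (midpt a k - x) ^ 2 = 4 * ((a k - x) * (a (k + 1) - x)) + step a k ^ 2 := by
    unfold midpt step; ring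
  rw [div_eq_iff hpos.ne', add_mul, div_mul_eq_mul_div, mul_div_mul_right _ _ hpos.ne']
  linarith

namespace LogSpaced

variable {a : ℤ → ℝ} {δ C : ℝ}

theorem one_le_ratio (h : LogSpaced a δ C) {k : ℤ} {x : ℝ}
    (hx : x ∉ Set.Icc (a k) (a (k + 1))) : 1 ≤ ratio a k x := by
  rw [ratio_eq_one_add k hx (h.lt_succ k)]
  have : 0 ≤ step a k ^ 2 / (4 * (|a k - x| * |a (k + 1) - x|)) := by positivity
  linarith

theorem tendsto_edge_div_edge (h : LogSpaced a δ C) (z : ℂ) :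
    Tendsto (fun N : ℕ => edge a z N / edge a z (-N)) Filter.atTop (nhds 1) := by
  have h1 : Tendsto (fun N : ℕ => edge a z N) Filter.atTop (nhds 1) :=
    (tendsto_norm_sub_div_norm_sub tendsto_abs_atTop_atTop z).comp h.tendsto_atTop
  have h2 : Tendsto (fun N : ℕ => edge a z (-N)) Filter.atTop (nhds 1) :=
    (tendsto_norm_sub_div_norm_sub tendsto_abs_atBot_atTop z).comp h.tendsto_atBot
  simpa [Pi.div_def] using h1.div h2 one_ne_zero

theorem tendsto_prod_factor (h : LogSpaced a δ C) (z : ℂ) :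
    Tendsto (fun N : ℕ => ∏ k ∈ Finset.Ico (-N : ℤ) N, factor a k z) Filter.atTop
      (nhds (fullProd a z)) :=
  (h.hasProd_factor z).comp Finset.tendsto_Ico_neg

theorem ratio_nonneg (a : ℤ → ℝ) (k : ℤ) (z : ℂ) : 0 ≤ ratio a k z := by
  unfold ratio; positivity

/-- On the line the edge quotients tend to 1 and the ratios at i have bounded products, so only the
ratios at x count. Those outside T are at least 1 and may be dropped from below; from above they
cost the bound B. -/
theorem exists_norm_fullProd_bounds (h : LogSpaced a δ C) : ∃ K : ℝ, 1 ≤ K ∧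
    ∀ (x : ℝ) (T : Finset ℤ), (∀ k, x ≠ a k) → (∀ k, k ∉ T → x ∉ Set.Icc (a k) (a (k + 1))) →
      K⁻¹ * ∏ k ∈ T, ratio a k x ≤ ‖fullProd a x‖ ^ 2 ∧
      ∀ B : ℝ, (∀ s : Finset ℤ, Disjoint s T → ∏ k ∈ s, ratio a k x ≤ B) →
        ‖fullProd a x‖ ^ 2 ≤ K * B * ∏ k ∈ T, ratio a k x := by
  obtain ⟨K, hK1, hK⟩ := h.exists_prod_ratio_bounds
  have hK0 : 0 < K := by linarith
  have hKi : 0 < K⁻¹ := inv_pos.2 hK0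
  refine ⟨K, hK1, fun x T hx hT => ?_⟩
  have hx' : ∀ k, (x : ℂ) ≠ a k := fun k e => hx k (Complex.ofReal_injective e)
  have hlim : Tendsto (fun N : ℕ => ‖∏ k ∈ Finset.Ico (-N : ℤ) N, factor a k x‖ ^ 2) Filter.atTop
      (nhds (‖fullProd a x‖ ^ 2)) := (h.tendsto_prod_factor x).norm.pow 2
  have hedge : ∀ (N : ℕ), 0 ≤ edge a x N / edge a x (-N) := fun N => by unfold edge; positivity
  have hP : 0 ≤ ∏ k ∈ T, ratio a k x := Finset.prod_nonneg fun k _ => ratio_nonneg a k x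
  have hsub : ∀ᶠ N : ℕ in Filter.atTop, T ⊆ Finset.Ico (-N : ℤ) N :=
    (Finset.tendsto_Ico_neg (R := ℤ)).eventually (eventually_ge_atTop T)
  constructor
  · have h1 := (h.tendsto_edge_div_edge x).const_mul (K⁻¹ * ∏ k ∈ T, ratio a k x)
    rw [mul_one] at h1
    refine le_of_tendsto_of_tendsto h1 hlim ?_
    filter_upwards [hsub] with N hN
    obtain ⟨v1, v2⟩ := hK 1 le_rfl (Finset.Ico (-N : ℤ) N)
    simp only [Complex.ofReal_one, one_mul] at v1 v2
    rw [norm_prod_factor_sq hx']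
    refine mul_le_mul_of_nonneg_right ?_ (hedge N)
    rw [← Finset.prod_sdiff hN, le_div_iff₀ (hKi.trans_le v1)]
    have h2 : 1 ≤ ∏ k ∈ Finset.Ico (-N : ℤ) N \ T, ratio a k x := by
      rw [← Finset.prod_const_one (s := Finset.Ico (-N : ℤ) N \ T)]
      exact Finset.prod_le_prod (fun _ _ => zero_le_one)
        fun k hk => h.one_le_ratio (hT k (Finset.mem_sdiff.1 hk).2)
    calc K⁻¹ * (∏ k ∈ T, ratio a k x) * ∏ k ∈ Finset.Ico (-N : ℤ) N, ratio a k Complex.I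
        ≤ K⁻¹ * (∏ k ∈ T, ratio a k x) * K := by gcongr
      _ = 1 * ∏ k ∈ T, ratio a k x := by field_simp
      _ ≤ _ := by gcongr
  · intro B hB
    have h1 := (h.tendsto_edge_div_edge x).const_mul (K * B * ∏ k ∈ T, ratio a k x)
    rw [mul_one] at h1
    refine le_of_tendsto_of_tendsto hlim h1 ?_
    filter_upwards [hsub] with N hN
    obtain ⟨v1, v2⟩ := hK 1 le_rfl (Finset.Ico (-N : ℤ) N)
    simp only [Complex.ofReal_one, one_mul] at v1 v2
    rw [norm_prod_factor_sq hx']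
    refine mul_le_mul_of_nonneg_right ?_ (hedge N)
    have hB' := hB (Finset.Ico (-N : ℤ) N \ T) Finset.sdiff_disjoint
    have hB0 : 0 ≤ B := (Finset.prod_nonneg fun k _ => ratio_nonneg a k x).trans hB'
    rw [← Finset.prod_sdiff hN, div_le_iff₀ (hKi.trans_le v1)]
    calc _ ≤ B * ∏ k ∈ T, ratio a k x := by gcongr
      _ = K * B * (∏ k ∈ T, ratio a k x) * K⁻¹ := by field_simp
      _ ≤ _ := by gcongr

end LogSpaced

/-! ### Discrete Herglotz representations and their limits -/

theorem integrable_pointMasses {E : Type*} [NormedAddCommGroup E] {p α : ℤ → ℝ} {f : ℝ → E}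
    (hα : ∀ n, 0 ≤ α n) (hs : Summable fun n => α n * ‖f (p n)‖) : Integrable f (pointMasses p α) := by
  unfold pointMasses
  rw [integrable_sum_measure_iff]
  refine ⟨fun n => Integrable.smul_measure ?_ ENNReal.ofReal_ne_top, ?_⟩
  · exact (integrable_dirac (by simp [enorm_lt_top]))
  · refine hs.congr fun n => ?_
    rw [integral_smul_measure, integral_dirac, ENNReal.toReal_ofReal (hα n), smul_eq_mul]

theorem integral_pointMasses {p α : ℤ → ℝ} {f : ℝ → ℂ} (hα : ∀ n, 0 ≤ α n)
    (hs : Summable fun n => α n * ‖f (p n)‖) :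
    ∫ t, f t ∂(pointMasses p α) = ∑' n, (α n : ℂ) * f (p n) := by
  have hi := integrable_pointMasses hα hs
  unfold pointMasses at hi ⊢
  rw [integral_sum_measure hi]
  refine tsum_congr fun n => ?_
  rw [integral_smul_measure, integral_dirac, ENNReal.toReal_ofReal (hα n), Complex.real_smul]

theorem cauchyKernel_mul_I_im (t R : ℝ) :
    (cauchyKernel (R * Complex.I) t).im = R / (t ^ 2 + R ^ 2) := by
  have h2 : (t : ℂ) / (1 + (t : ℂ) ^ 2) = ((t / (1 + t ^ 2) : ℝ) : ℂ) := by push_cast; rfl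
  unfold cauchyKernel
  rw [h2, Complex.sub_im, Complex.ofReal_im, sub_zero, one_div, Complex.inv_im,
    Complex.normSq_apply]
  simp
  ring

theorem cauchyKernel_I_re (t : ℝ) : (cauchyKernel Complex.I t).re = 0 := by
  have h2 : (t : ℂ) / (1 + (t : ℂ) ^ 2) = ((t / (1 + t ^ 2) : ℝ) : ℂ) := by push_cast; rfl
  unfold cauchyKernel
  rw [h2, Complex.sub_re, Complex.ofReal_re, one_div, Complex.inv_re, Complex.normSq_apply]
  simp
  ring

theorem re_one_div_pi_I_mul (w : ℂ) :
    (1 / ((Real.pi : ℂ) * Complex.I) * w).re = w.im / Real.pi := by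
  have : 1 / ((Real.pi : ℂ) * Complex.I) * w = ((Real.pi⁻¹ : ℝ) : ℂ) * (-Complex.I * w) := by
    have := Complex.ofReal_ne_zero.2 Real.pi_ne_zero
    push_cast
    rw [one_div, mul_inv, Complex.inv_I]
    ring
  rw [this, Complex.re_ofReal_mul]
  simp
  ring

theorem im_one_div_pi_I_mul (w : ℂ) :
    (1 / ((Real.pi : ℂ) * Complex.I) * w).im = -w.re / Real.pi := by
  have : 1 / ((Real.pi : ℂ) * Complex.I) * w = ((Real.pi⁻¹ : ℝ) : ℂ) * (-Complex.I * w) := by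
    have := Complex.ofReal_ne_zero.2 Real.pi_ne_zero
    push_cast
    rw [one_div, mul_inv, Complex.inv_I]
    ring
  rw [this, Complex.im_ofReal_mul]
  simp
  ring

theorem norm_one_div_pi_I : ‖1 / ((Real.pi : ℂ) * Complex.I)‖ = Real.pi⁻¹ := by
  rw [norm_div, norm_mul, Complex.norm_I, Complex.norm_real, norm_one, Real.norm_of_nonneg
    Real.pi_pos.le, mul_one, one_div]

/-- A pointwise limit of functions that have a discrete Herglotz representation without linear term
has such a representation if the functions are uniformly `O(√R)` at the points `i R`. -/
theorem exists_cauchyMeasure_eq_of_tendsto {p : ℤ → ℝ} (hp : Tendsto (fun n => |p n|) cofinite atTop)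
    {F : ℂ → ℂ} {G : ℕ → ℂ → ℂ} {w : ℕ → ℤ → ℝ} {α : ℤ → ℝ} {d : ℕ → ℝ} {s : ℕ → Finset ℤ} {K : ℝ}
    (hw : ∀ N n, 0 ≤ w N n) (hlim : ∀ n, Tendsto (fun N => w N n) atTop (nhds (α n)))
    (hF : ∀ z : ℂ, 0 < z.im → Tendsto (fun N => G N z) atTop (nhds (F z)))
    (hrep : ∀ N (z : ℂ), 0 < z.im → G N z = 1 / ((Real.pi : ℂ) * Complex.I) *
      ∑ n ∈ s N, (w N n : ℂ) * cauchyKernel z (p n) + Complex.I * (d N : ℂ))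
    (hs : Tendsto s atTop atTop)
    (hK : ∀ N (R : ℝ), 1 ≤ R → ‖G N (R * Complex.I)‖ ^ 2 ≤ K * R) :
    Integrable (fun t : ℝ => 1 / (1 + t ^ 2)) (pointMasses p α) ∧
      ∃ D : ℝ, ∀ z : ℂ, 0 < z.im →
        F z = cauchyMeasure (pointMasses p α) z + Complex.I * (D : ℂ) := by
  have hpi := Real.pi_pos
  have hα : ∀ n, 0 ≤ α n := fun n => ge_of_tendsto' (hlim n) fun N => hw N n
  have hK0 : 0 ≤ K := by
    have := (sq_nonneg _).trans (hK 0 1 le_rfl)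
    linarith
  have hRI : ∀ R : ℝ, 1 ≤ R → 0 < ((R : ℂ) * Complex.I).im := by
    intro R hR; simp; linarith
  -- The real part of `G N` at iR is, up to the factor 1/π, the Poisson sum of its masses.
  have hA : ∀ N (R : ℝ), 1 ≤ R →
      ∑ n ∈ s N, w N n * (R / (p n ^ 2 + R ^ 2)) ≤ Real.pi * √(K * R) := by
    intro N R hR
    have h1 : (G N (R * Complex.I)).re ≤ √(K * R) :=
      (Complex.re_le_norm _).trans (Real.le_sqrt_of_sq_le (hK N R hR))
    rw [hrep N _ (hRI R hR), Complex.add_re, re_one_div_pi_I_mul, Complex.im_sum] at h1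
    simp only [Complex.im_ofReal_mul, cauchyKernel_mul_I_im] at h1
    simp only [Complex.mul_re, Complex.I_re, Complex.ofReal_re, Complex.I_im, Complex.ofReal_im,
      zero_mul, mul_zero, sub_self, add_zero] at h1
    rw [div_le_iff₀ hpi] at h1
    linarith
  -- For |p n| ≥ R the weight 1/(1 + p²) is at most 2/R times the Poisson weight R/(p² + R²), so the
  -- tails of the masses are O(1/√R) uniformly in N.
  have hC : ∀ R : ℝ, 1 ≤ R → ∀ N, ∀ T : Finset ℤ, T ⊆ s N → (∀ n ∈ T, R ≤ |p n|) →
      ∑ n ∈ T, w N n * (1 / (1 + p n ^ 2)) ≤ 2 * Real.pi * √K / √R := by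
    intro R hR N T hT hTR
    have hR0 : 0 < R := by linarith
    have h1 : ∑ n ∈ T, w N n * (1 / (1 + p n ^ 2)) ≤
        ∑ n ∈ T, 2 / R * (w N n * (R / (p n ^ 2 + R ^ 2))) := by
      refine Finset.sum_le_sum fun n hn => ?_
      have h2 : R ^ 2 ≤ p n ^ 2 := by
        rw [← sq_abs (p n)]; have := hTR n hn; gcongr
      have h3 : 1 / (1 + p n ^ 2) ≤ 2 / R * (R / (p n ^ 2 + R ^ 2)) := by
        have : 2 / R * (R / (p n ^ 2 + R ^ 2)) = 2 / (p n ^ 2 + R ^ 2) := by field_simp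
        rw [this, div_le_div_iff₀ (by positivity) (by positivity)]
        linarith
      calc _ ≤ w N n * (2 / R * (R / (p n ^ 2 + R ^ 2))) :=
            mul_le_mul_of_nonneg_left h3 (hw N n)
        _ = _ := by ring
    rw [← Finset.mul_sum] at h1
    have h4 : ∑ n ∈ T, w N n * (R / (p n ^ 2 + R ^ 2)) ≤
        ∑ n ∈ s N, w N n * (R / (p n ^ 2 + R ^ 2)) :=
      Finset.sum_le_sum_of_subset_of_nonneg hT fun n _ _ => mul_nonneg (hw N n) (by positivity)
    refine h1.trans ((mul_le_mul_of_nonneg_left (h4.trans (hA N R hR)) (by positivity)).trans ?_)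
    rw [Real.sqrt_mul hK0]
    have hR2 : √R * √R = R := Real.mul_self_sqrt hR0.le
    have hsR : 0 < √R := Real.sqrt_pos.2 hR0
    rw [div_mul_eq_mul_div, div_le_div_iff₀ hR0 hsR]
    apply le_of_eq
    linear_combination (2 * Real.pi * √K) * hR2
  have hsum : Summable fun n => α n * (1 / (1 + p n ^ 2)) := by
    refine summable_of_sum_le (c := Real.pi * √(K * 1))
      (fun n => mul_nonneg (hα n) (by positivity)) fun T => ?_
    have ht : Tendsto (fun N => ∑ n ∈ T, w N n * (1 / (1 + p n ^ 2))) atTop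
        (nhds (∑ n ∈ T, α n * (1 / (1 + p n ^ 2)))) :=
      tendsto_finsetSum _ fun n _ => (hlim n).mul_const _
    refine le_of_tendsto ht ?_
    filter_upwards [hs.eventually_ge_atTop T] with N hN
    refine le_trans ?_ (hA N 1 le_rfl)
    simp only [one_pow, add_comm]
    exact Finset.sum_le_sum_of_subset_of_nonneg hN fun n _ _ => mul_nonneg (hw N n) (by positivity)
  have hint : Integrable (fun t : ℝ => 1 / (1 + t ^ 2)) (pointMasses p α) := by
    refine integrable_pointMasses hα ?_
    refine hsum.congr fun n => ?_
    rw [Real.norm_of_nonneg (by positivity)]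
  -- The kernel at i is purely imaginary, so the constant `d N` is the imaginary part of `G N` at i
  -- and converges with it.
  have hd : Tendsto d atTop (nhds (F Complex.I).im) := by
    have h1 := (Complex.continuous_im.tendsto _).comp (hF Complex.I (by simp))
    refine h1.congr fun N => ?_
    simp only [Function.comp_apply]
    rw [hrep N Complex.I (by simp), Complex.add_im, im_one_div_pi_I_mul, Complex.re_sum]
    simp [cauchyKernel_I_re]
  refine ⟨hint, (F Complex.I).im, fun z hz => ?_⟩
  obtain ⟨M, hM0, hM⟩ := exists_norm_cauchyKernel_le hz
  have hbd : ∀ N, ∀ T : Finset ℤ, ‖∑ n ∈ T, (w N n : ℂ) * cauchyKernel z (p n)‖ ≤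
      M * ∑ n ∈ T, w N n * (1 / (1 + p n ^ 2)) := by
    intro N T
    refine (norm_sum_le _ _).trans ?_
    rw [Finset.mul_sum]
    refine Finset.sum_le_sum fun n _ => ?_
    rw [norm_mul, Complex.norm_real, Real.norm_of_nonneg (hw N n)]
    calc _ ≤ w N n * (M * (1 / (1 + p n ^ 2))) := mul_le_mul_of_nonneg_left (hM _) (hw N n)
      _ = _ := by ring
  -- With S fixed the limit in N concerns finitely many masses; the others are covered by the
  -- uniform tail bound.
  have hS : ∀ R : ℝ, 1 ≤ R → ∀ S : Finset ℤ, (∀ n, n ∉ S → R ≤ |p n|) →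
      ‖1 / ((Real.pi : ℂ) * Complex.I) * ∑ n ∈ S, (α n : ℂ) * cauchyKernel z (p n) -
        (F z - Complex.I * ((F Complex.I).im : ℂ))‖ ≤
        Real.pi⁻¹ * (M * (2 * Real.pi * √K / √R)) := by
    intro R hR S hSR
    have ht : Tendsto (fun N => 1 / ((Real.pi : ℂ) * Complex.I) *
        ∑ n ∈ S, (w N n : ℂ) * cauchyKernel z (p n) - (G N z - Complex.I * (d N : ℂ))) atTop
        (nhds (1 / ((Real.pi : ℂ) * Complex.I) * ∑ n ∈ S, (α n : ℂ) * cauchyKernel z (p n) -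
          (F z - Complex.I * ((F Complex.I).im : ℂ)))) := by
      refine Tendsto.sub (Tendsto.const_mul _ (tendsto_finsetSum _ fun n _ => Tendsto.mul_const _ ?_))
        ((hF z hz).sub (Tendsto.const_mul _ ?_))
      · exact (Complex.continuous_ofReal.tendsto _).comp (hlim n)
      · exact (Complex.continuous_ofReal.tendsto _).comp hd
    refine le_of_tendsto ht.norm ?_
    filter_upwards [hs.eventually_ge_atTop S] with N hN
    rw [hrep N z hz, add_sub_cancel_right, ← mul_sub, norm_mul, norm_one_div_pi_I,
      ← Finset.sum_sdiff hN, sub_add_cancel_right, norm_neg]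
    gcongr
    refine (hbd N _).trans ?_
    gcongr
    exact hC R hR N _ Finset.sdiff_subset fun n hn => hSR n (Finset.mem_sdiff.1 hn).2
  have hHS : HasSum (fun n => 1 / ((Real.pi : ℂ) * Complex.I) * ((α n : ℂ) * cauchyKernel z (p n)))
      (F z - Complex.I * ((F Complex.I).im : ℂ)) := by
    rw [HasSum, SummationFilter.unconditional_filter, Metric.tendsto_atTop]
    intro ε hε
    have ht : Tendsto (fun R : ℝ => Real.pi⁻¹ * (M * (2 * Real.pi * √K / √R))) atTop (nhds 0) := by
      have := ((Real.tendsto_sqrt_atTop.const_div_atTop (2 * Real.pi * √K)).const_mul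
        M).const_mul Real.pi⁻¹
      simpa using this
    obtain ⟨R, hR, hR1⟩ := ((ht.eventually_lt_const hε).and (eventually_ge_atTop 1)).exists
    have hfin := hp.eventually_ge_atTop R
    rw [Filter.eventually_cofinite] at hfin
    refine ⟨hfin.toFinset, fun S hSS => ?_⟩
    rw [dist_eq_norm, ← Finset.mul_sum]
    refine (hS R hR1 S fun n hn => ?_).trans_lt hR
    by_contra hcon
    exact hn (hSS (hfin.mem_toFinset.2 hcon))
  unfold cauchyMeasure
  rw [integral_pointMasses hα, ← tsum_mul_left, hHS.tsum_eq]
  · ring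
  · refine Summable.of_nonneg_of_le (fun n => mul_nonneg (hα n) (norm_nonneg _)) (fun n => ?_)
      (hsum.mul_left M)
    calc _ ≤ α n * (M * (1 / (1 + p n ^ 2))) := mul_le_mul_of_nonneg_left (hM _) (hα n)
      _ = _ := by ring

/-- The residue at `p k` of `∏ (q j - z) / (p j - z)`, up to sign. -/
noncomputable def residue (s : Finset ℤ) (p q : ℤ → ℝ) (k : ℤ) : ℝ :=
  (q k - p k) * ∏ j ∈ s.erase k, (q j - p k) / (p j - p k)

/-- Partial fractions by induction: the new factor is 1 + (q m - p m)/(p m - z), and its products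
with the old simple fractions split because the poles are distinct. -/
theorem prod_div_eq_one_add_sum {p q : ℤ → ℝ} (hp : Function.Injective p) (s : Finset ℤ) :
    ∀ z : ℂ, (∀ k ∈ s, (p k : ℂ) ≠ z) → ∏ k ∈ s, ((q k : ℂ) - z) / ((p k : ℂ) - z) =
      1 + ∑ k ∈ s, (residue s p q k : ℂ) / ((p k : ℂ) - z) := by
  induction s using Finset.induction_on with
  | empty => simp
  | insert m s hm ih =>
    intro z hz
    have hzm : (p m : ℂ) - z ≠ 0 := sub_ne_zero.2 (hz m (Finset.mem_insert_self m s))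
    have hzs : ∀ k ∈ s, (p k : ℂ) ≠ z := fun k hk => hz k (Finset.mem_insert_of_mem hk)
    have hne : ∀ k ∈ s, (p k : ℂ) ≠ p m := fun k hk e => by
      have := hp (Complex.ofReal_injective e); subst this; exact hm hk
    have hrm : (residue (insert m s) p q m : ℂ) =
        ((q m : ℂ) - p m) * (1 + ∑ k ∈ s, (residue s p q k : ℂ) / ((p k : ℂ) - p m)) := by
      rw [← ih _ hne]
      unfold residue
      rw [Finset.erase_insert hm]
      push_cast
      rfl
    have hrk : ∀ k ∈ s, (residue (insert m s) p q k : ℂ) =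
        residue s p q k * (((q m : ℂ) - p k) / ((p m : ℂ) - p k)) := by
      intro k hk
      have hkm : k ≠ m := fun e => hm (e ▸ hk)
      unfold residue
      rw [Finset.erase_insert_of_ne hkm.symm, Finset.prod_insert (by simp [hm])]
      push_cast
      ring
    rw [Finset.prod_insert hm, Finset.sum_insert hm, ih z hzs, hrm]
    have h1 : ∑ k ∈ s, (residue (insert m s) p q k : ℂ) / ((p k : ℂ) - z) =
        ∑ k ∈ s, ((((q m : ℂ) - z) / ((p m : ℂ) - z)) * ((residue s p q k : ℂ) / ((p k : ℂ) - z)) -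
          ((q m : ℂ) - p m) / ((p m : ℂ) - z) * ((residue s p q k : ℂ) / ((p k : ℂ) - p m))) := by
      refine Finset.sum_congr rfl fun k hk => ?_
      have e1 := sub_ne_zero.2 (hne k hk)
      have e2 := sub_ne_zero.2 (hne k hk).symm
      have e3 := sub_ne_zero.2 (hzs k hk)
      rw [hrk k hk]
      have e4 : (p m : ℂ) - p k = -((p k : ℂ) - p m) := by ring
      rw [e4]
      have e5 : -((p k : ℂ) - p m) ≠ 0 := neg_ne_zero.2 e1
      field_simp
      ring
    rw [h1, Finset.sum_sub_distrib, ← Finset.mul_sum, ← Finset.mul_sum]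
    field_simp
    ring

/-- Since -ic = (πi)⁻¹ · πc, a residue becomes a mass after multiplication by πc; the constants left
over are i times a real number. -/
theorem neg_I_mul_prod_eq {p q : ℤ → ℝ} (hp : Function.Injective p) (s : Finset ℤ) (c : ℝ) {z : ℂ}
    (hz : 0 < z.im) : -Complex.I * c * ∏ k ∈ s, ((q k : ℂ) - z) / ((p k : ℂ) - z) =
      1 / ((Real.pi : ℂ) * Complex.I) *
        ∑ k ∈ s, ((Real.pi * c * residue s p q k : ℝ) : ℂ) * cauchyKernel z (p k) +
      Complex.I * ((-c * (1 + ∑ k ∈ s, residue s p q k * (p k / (1 + p k ^ 2))) : ℝ) : ℂ) := by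
  have hpi := Complex.ofReal_ne_zero.2 Real.pi_ne_zero
  have hI := Complex.I_ne_zero
  rw [prod_div_eq_one_add_sum hp s z fun k _ => sub_ne_zero.1 (ofReal_sub_ne_zero hz (p k))]
  have h1 : ∑ k ∈ s, ((Real.pi * c * residue s p q k : ℝ) : ℂ) * cauchyKernel z (p k) =
      Real.pi * c * (∑ k ∈ s, (residue s p q k : ℂ) / ((p k : ℂ) - z) -
        ∑ k ∈ s, (residue s p q k : ℂ) * ((p k : ℂ) / (1 + (p k : ℂ) ^ 2))) := by
    rw [← Finset.sum_sub_distrib, Finset.mul_sum]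
    refine Finset.sum_congr rfl fun k _ => ?_
    unfold cauchyKernel
    push_cast
    ring
  rw [h1]
  push_cast
  have h2 : 1 / ((Real.pi : ℂ) * Complex.I) * (Real.pi * c) = -Complex.I * c := by
    rw [one_div, mul_inv, Complex.inv_I]
    field_simp
  rw [← mul_assoc, h2]
  ring

/-! ### The product of the far ratios -/

theorem log_one_add_le_two_mul_sqrt {s : ℝ} (hs : 0 ≤ s) : Real.log (1 + s) ≤ 2 * √s := by
  have h1 : 1 + s ≤ (1 + √s) ^ 2 := by
    nlinarith [Real.sq_sqrt hs, Real.sqrt_nonneg s]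
  have h2 := Real.log_le_log (by positivity) h1
  have h3 := Real.log_le_sub_one_of_pos (show 0 < 1 + √s by positivity)
  rw [Real.log_pow] at h2
  push_cast at h2
  linarith

theorem one_le_log_three_add {y : ℝ} (hy : 0 ≤ y) : 1 ≤ Real.log (3 + y) := by
  rw [Real.le_log_iff_exp_le (by positivity)]
  linarith [Real.exp_one_lt_d9]

/-- If log(1 + s) ≤ log(3 + y), each bound on d is used once. Otherwise the logarithmic bound is at
most a multiple of log(1 + s) ≤ 2√s, and its square suffices. -/
theorem sq_le_mul_log_mul {A C d s y : ℝ} (hA : 1 ≤ A) (hC : 1 ≤ C) (hd : 0 ≤ d) (hs : 0 < s)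
    (hy : 0 ≤ y) (h1 : d ≤ A * s) (h2 : d ≤ C * Real.log (2 + y + s)) :
    d ^ 2 ≤ 16 * A * C ^ 2 * (Real.log (3 + y) * s) := by
  set M := Real.log (3 + y) with hM
  have hM1 : 1 ≤ M := one_le_log_three_add hy
  have h3 : Real.log (2 + y + s) ≤ M + Real.log (1 + s) := by
    rw [hM, ← Real.log_mul (by positivity) (by positivity)]
    apply Real.log_le_log (by positivity)
    nlinarith
  have h4 : d ≤ C * (M + Real.log (1 + s)) := h2.trans (by gcongr)
  rcases le_total (Real.log (1 + s)) M with h | h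
  · have h5 : d ≤ C * (2 * M) := h4.trans (by gcongr; linarith)
    calc d ^ 2 = d * d := sq d
      _ ≤ (A * s) * (C * (2 * M)) := by gcongr
      _ = 2 * A * C * 1 * (M * s) := by ring
      _ ≤ 16 * A * C * C * (M * s) := by gcongr; norm_num
      _ = _ := by ring
  · have h5 : d ≤ C * (2 * (2 * √s)) := by
      refine h4.trans ?_
      gcongr
      linarith [log_one_add_le_two_mul_sqrt hs.le]
    calc d ^ 2 ≤ (C * (2 * (2 * √s))) ^ 2 := by gcongr
      _ = 16 * 1 * C ^ 2 * (1 * √s ^ 2) := by ring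
      _ ≤ 16 * A * C ^ 2 * (M * s) := by rw [Real.sq_sqrt hs.le]; gcongr

/-- The s j are distances from x to successive points of the sequence. As the increments are
O(√(log(3 + y) s j)), each term is at most a multiple of √log(3 + y) · (1/√(s j) - 1/√(s (j + 1))),
and the sum telescopes to its value at the first distance. -/
theorem prod_one_add_le_exp {s : ℕ → ℝ} {A C y : ℝ} (hA : 1 ≤ A) (hC : 1 ≤ C) (hy : 0 ≤ y)
    (hs : ∀ j, 0 < s j) (hmono : ∀ j, s j ≤ s (j + 1)) (h1 : ∀ j, s (j + 1) - s j ≤ A * s j)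
    (h2 : ∀ j, s (j + 1) - s j ≤ C * Real.log (2 + y + s j)) (J : ℕ) :
    ∏ j ∈ Finset.range J, (1 + (s (j + 1) - s j) ^ 2 / (4 * (s j * s (j + 1)))) ≤
      Real.exp (√(16 * A * C ^ 2) / 2 * √(Real.log (3 + y) / s 0)) := by
  set M := Real.log (3 + y) with hM
  have hM1 : 1 ≤ M := one_le_log_three_add hy
  set B := √(16 * A * C ^ 2) with hB
  have hterm : ∀ j, (s (j + 1) - s j) ^ 2 / (4 * (s j * s (j + 1))) ≤
      B / 2 * √M * (1 / √(s j) - 1 / √(s (j + 1))) := by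
    intro j
    have hd0 : 0 ≤ s (j + 1) - s j := sub_nonneg.2 (hmono j)
    have h3 := sq_le_mul_log_mul hA hC hd0 (hs j) hy (h1 j) (h2 j)
    have h4 : s (j + 1) - s j ≤ B * (√M * √(s j)) := by
      rw [hB, ← Real.sqrt_mul (by positivity), ← Real.sqrt_mul (by positivity)]
      exact Real.le_sqrt_of_sq_le h3
    have hu := Real.sqrt_pos.2 (hs j)
    have hv := Real.sqrt_pos.2 (hs (j + 1))
    have hu2 := Real.sq_sqrt (hs j).le
    have hv2 := Real.sq_sqrt (hs (j + 1)).le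
    have huv := Real.sqrt_le_sqrt (hmono j)
    set u := √(s j)
    set v := √(s (j + 1))
    rw [← hu2, ← hv2] at h4 ⊢
    have hP : 0 ≤ B * √M := by positivity
    -- One factor v² - u² is bounded by B√M u, the other by 2v(v - u); what remains is a difference
    -- of reciprocals.
    calc (v ^ 2 - u ^ 2) ^ 2 / (4 * (u ^ 2 * v ^ 2))
        = (v ^ 2 - u ^ 2) * (v ^ 2 - u ^ 2) / (4 * (u ^ 2 * v ^ 2)) := by rw [sq (v ^ 2 - u ^ 2)]
      _ ≤ (B * (√M * u)) * ((v - u) * (2 * v)) / (4 * (u ^ 2 * v ^ 2)) := by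
          gcongr ?_ / _
          refine mul_le_mul h4 ?_ (by nlinarith) (by positivity)
          nlinarith
      _ = B / 2 * √M * (1 / u - 1 / v) := by field_simp; ring
  have htel : ∀ J, ∑ j ∈ Finset.range J, (1 / √(s j) - 1 / √(s (j + 1))) =
      1 / √(s 0) - 1 / √(s J) := fun J => Finset.sum_range_sub' (fun j => 1 / √(s j)) J
  calc _ ≤ ∏ j ∈ Finset.range J, Real.exp (B / 2 * √M * (1 / √(s j) - 1 / √(s (j + 1)))) := by
        refine Finset.prod_le_prod (fun j _ => ?_) fun j _ => ?_
        · have := hs j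
          have := hs (j + 1)
          positivity
        · rw [add_comm]
          exact (Real.add_one_le_exp _).trans (Real.exp_le_exp.2 (hterm j))
    _ = Real.exp (B / 2 * √M * (1 / √(s 0) - 1 / √(s J))) := by
        rw [← Real.exp_sum, ← Finset.mul_sum, htel]
    _ ≤ Real.exp (B / 2 * √M * (1 / √(s 0))) := by
        gcongr
        have : 0 ≤ 1 / √(s J) := by positivity
        linarith
    _ = _ := by rw [Real.sqrt_div (by positivity)]; ring_nf

theorem exists_subset_image_add {s : Finset ℤ} {m : ℤ} (h : ∀ k ∈ s, m ≤ k) :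
    ∃ J : ℕ, s ⊆ (Finset.range J).image (fun j : ℕ => m + j) := by
  obtain ⟨M, hM⟩ := s.bddAbove
  refine ⟨(M - m + 1).toNat, fun k hk => ?_⟩
  have h1 := h k hk
  have h2 : k ≤ M := hM hk
  exact Finset.mem_image.2 ⟨(k - m).toNat, by simp; omega, by omega⟩

theorem exists_subset_image_sub {s : Finset ℤ} {m : ℤ} (h : ∀ k ∈ s, k ≤ m) :
    ∃ J : ℕ, s ⊆ (Finset.range J).image (fun j : ℕ => m - j) := by
  obtain ⟨M, hM⟩ := s.bddBelow
  refine ⟨(m - M + 1).toNat, fun k hk => ?_⟩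
  have h1 := h k hk
  have h2 : M ≤ k := hM hk
  exact Finset.mem_image.2 ⟨(m - k).toNat, by simp; omega, by omega⟩

theorem prod_le_prod_of_subset_of_one_le {s t : Finset ℤ} {f : ℤ → ℝ} (hst : s ⊆ t)
    (h0 : ∀ k ∈ s, 0 ≤ f k) (h1 : ∀ k ∈ t, 1 ≤ f k) : ∏ k ∈ s, f k ≤ ∏ k ∈ t, f k := by
  rw [← Finset.prod_sdiff hst]
  refine le_mul_of_one_le_left (Finset.prod_nonneg h0) ?_
  rw [← Finset.prod_const_one (s := t \ s)]
  exact Finset.prod_le_prod (fun _ _ => zero_le_one) fun k hk => h1 k (Finset.mem_sdiff.1 hk).1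

namespace LogSpaced

variable {a : ℤ → ℝ} {δ C : ℝ}

theorem notMem_Icc (h : LogSpaced a δ C) {l r : ℤ} {x : ℝ} (hl : a l < x) (hr : x < a r) {k : ℤ}
    (hk : k ∉ Finset.Ico l r) : x ∉ Set.Icc (a k) (a (k + 1)) := by
  rw [Finset.mem_Ico, not_and_or, not_le, not_lt] at hk
  rintro ⟨h1, h2⟩
  rcases hk with hk | hk
  · have := h.strictMono.monotone (show k + 1 ≤ l by omega)
    linarith
  · have := h.strictMono.monotone hk
    linarith

/-- The distances are a (r + j) - x. Only the first step needs an assumption: each later step is at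
most C times its predecessor, which lies between x and the current point. -/
theorem prod_ratio_right_le (h : LogSpaced a δ C) {A x : ℝ} (hA : C ≤ A) {r : ℤ} (hr : x < a r)
    (hA' : step a r ≤ A * (a r - x)) {s : Finset ℤ} (hs : ∀ k ∈ s, r ≤ k) :
    ∏ k ∈ s, ratio a k x ≤
      Real.exp (√(16 * A * C ^ 2) / 2 * √(Real.log (3 + |x|) / (a r - x))) := by
  obtain ⟨J, hJ⟩ := exists_subset_image_add hs
  have hC := h.one_le
  have hmono : ∀ j : ℕ, a r ≤ a (r + j) := fun j => h.strictMono.monotone (by omega)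
  have hout : ∀ j : ℕ, x ∉ Set.Icc (a (r + j)) (a (r + j + 1)) := fun j hx => by
    have := hmono j; linarith [hx.1]
  have key := prod_one_add_le_exp (s := fun j => a (r + j) - x) (A := A) (C := C) (y := |x|)
    (hC.trans hA) hC (abs_nonneg x) (fun j => by have := hmono j; linarith)
    (fun j => by
      have := (h.lt_succ (r + j)).le
      push_cast; rw [← add_assoc]; linarith)
    (fun j => by
      have e : a (r + (j + 1 : ℕ)) - x - (a (r + j) - x) = step a (r + j) := by
        unfold step; push_cast; rw [← add_assoc]; ring
      rw [e]
      rcases j with _ | j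
      · simpa using hA'
      · have h1 := h.step_succ_le (r + j)
        have h2 := hmono j
        have h3 : step a (r + j) = a (r + (j + 1 : ℕ)) - a (r + j) := by
          unfold step; push_cast; rw [← add_assoc]
        have h4 := h.step_pos (r + j)
        have h5 : step a (r + (j + 1 : ℕ)) = step a (r + j + 1) := by push_cast; rw [← add_assoc]
        rw [h5]
        calc _ ≤ C * step a (r + j) := h1
          _ ≤ A * (a (r + (j + 1 : ℕ)) - x) := by
            refine mul_le_mul hA (by linarith) h4.le (by linarith))
    (fun j => by
      have e : a (r + (j + 1 : ℕ)) - x - (a (r + j) - x) = step a (r + j) := by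
        unfold step; push_cast; rw [← add_assoc]; ring
      rw [e]
      refine (h.step_le_log (r + j)).trans ?_
      gcongr C * Real.log ?_
      have h1 : |a (r + j)| ≤ |x| + |a (r + j) - x| := by
        simpa using abs_add_le x (a (r + j) - x)
      rw [abs_of_pos (a := a (r + j) - x) (by have := hmono j; linarith)] at h1
      linarith) J
  simp only [Nat.cast_zero, add_zero] at key
  refine le_trans ?_ key
  calc ∏ k ∈ s, ratio a k x ≤ ∏ k ∈ (Finset.range J).image (fun j : ℕ => r + j), ratio a k x := by
        refine prod_le_prod_of_subset_of_one_le hJ (fun k _ => ratio_nonneg a k x) fun k hk => ?_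
        obtain ⟨j, -, rfl⟩ := Finset.mem_image.1 hk
        exact h.one_le_ratio (hout j)
    _ = ∏ j ∈ Finset.range J, ratio a (r + j) x :=
        Finset.prod_image fun i _ j _ hij => by simpa using hij
    _ = _ := by
        refine Finset.prod_congr rfl fun j _ => ?_
        rw [ratio_eq_one_add _ (hout j) (h.lt_succ _)]
        have h1 := hmono j
        have h2 := h.lt_succ (r + j)
        rw [abs_of_pos (by linarith), abs_of_pos (by linarith)]
        unfold step
        push_cast
        rw [← add_assoc]
        congr 2
        ring

/-- Mirror image of the right-hand case. The end of a step nearer to x is now its right end, which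
is why `LogSpaced` has logarithmic bounds at both ends and compares neighbouring steps in both
directions. -/
theorem prod_ratio_left_le (h : LogSpaced a δ C) {A x : ℝ} (hA : C ≤ A) {l : ℤ} (hl : a l < x)
    (hA' : step a (l - 1) ≤ A * (x - a l)) {s : Finset ℤ} (hs : ∀ k ∈ s, k ≤ l - 1) :
    ∏ k ∈ s, ratio a k x ≤
      Real.exp (√(16 * A * C ^ 2) / 2 * √(Real.log (3 + |x|) / (x - a l))) := by
  obtain ⟨J, hJ⟩ := exists_subset_image_sub hs
  have hC := h.one_le
  have hmono : ∀ j : ℕ, a (l - j) ≤ a l := fun j => h.strictMono.monotone (by omega)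
  have hsucc : ∀ j : ℕ, a (l - 1 - j + 1) = a (l - j) := fun j => congrArg a (by ring)
  have hpred : ∀ j : ℕ, a (l - (j + 1 : ℕ)) = a (l - 1 - j) := fun j =>
    congrArg a (by push_cast; ring)
  have hlt : ∀ j : ℕ, a (l - 1 - j) < a (l - j) := fun j => by
    have := h.lt_succ (l - 1 - j); rwa [hsucc] at this
  have hout : ∀ j : ℕ, x ∉ Set.Icc (a (l - 1 - j)) (a (l - 1 - j + 1)) := fun j hx => by
    have := hmono j; rw [hsucc] at hx; linarith [hx.2]
  have e : ∀ j : ℕ, x - a (l - (j + 1 : ℕ)) - (x - a (l - j)) = step a (l - 1 - j) := fun j => by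
    unfold step; rw [hsucc, hpred]; ring
  have key := prod_one_add_le_exp (s := fun j => x - a (l - j)) (A := A) (C := C) (y := |x|)
    (hC.trans hA) hC (abs_nonneg x) (fun j => by have := hmono j; linarith)
    (fun j => by rw [hpred]; linarith [hlt j])
    (fun j => by
      rw [e]
      rcases j with _ | j
      · simpa using hA'
      · have h1 := h.step_le_succ (l - 1 - (j + 1 : ℕ))
        have h2 := hmono j
        have h3 : step a (l - 1 - (j + 1 : ℕ) + 1) = a (l - j) - a (l - (j + 1 : ℕ)) := by
          rw [hpred, show l - 1 - ((j + 1 : ℕ) : ℤ) + 1 = l - 1 - j by push_cast; ring]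
          unfold step
          rw [hsucc]
        rw [h3] at h1
        have h4 := hlt j
        rw [← hpred] at h4
        calc _ ≤ C * (a (l - j) - a (l - (j + 1 : ℕ))) := h1
          _ ≤ A * (x - a (l - (j + 1 : ℕ))) :=
            mul_le_mul hA (by linarith) (by linarith) (by linarith))
    (fun j => by
      rw [e]
      refine (h.step_le_log_succ (l - 1 - j)).trans ?_
      rw [hsucc]
      gcongr C * Real.log ?_
      have h1 : |a (l - j)| ≤ |x| + |a (l - j) - x| := by
        simpa using abs_add_le x (a (l - j) - x)
      rw [abs_sub_comm, abs_of_pos (a := x - a (l - j)) (by have := hmono j; linarith)] at h1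
      linarith) J
  simp only [Nat.cast_zero, sub_zero] at key
  refine le_trans ?_ key
  calc ∏ k ∈ s, ratio a k x ≤
        ∏ k ∈ (Finset.range J).image (fun j : ℕ => l - 1 - j), ratio a k x := by
        refine prod_le_prod_of_subset_of_one_le hJ (fun k _ => ratio_nonneg a k x) fun k hk => ?_
        obtain ⟨j, -, rfl⟩ := Finset.mem_image.1 hk
        exact h.one_le_ratio (hout j)
    _ = ∏ j ∈ Finset.range J, ratio a (l - 1 - j) x :=
        Finset.prod_image fun i _ j _ hij => by simpa using hij
    _ = _ := by
        refine Finset.prod_congr rfl fun j _ => ?_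
        rw [ratio_eq_one_add _ (hout j) (h.lt_succ _), e, hsucc, hpred]
        have h1 := hmono j
        have h2 := hlt j
        rw [abs_of_neg (by linarith), abs_of_neg (by linarith)]
        congr 2
        ring

theorem prod_ratio_le (h : LogSpaced a δ C) {A x : ℝ} (hA : C ≤ A) {l r : ℤ} (hl : a l < x)
    (hr : x < a r) (hl' : step a (l - 1) ≤ A * (x - a l)) (hr' : step a r ≤ A * (a r - x))
    {s : Finset ℤ} (hs : Disjoint s (Finset.Ico l r)) :
    ∏ k ∈ s, ratio a k x ≤
      Real.exp (√(16 * A * C ^ 2) / 2 * √(Real.log (3 + |x|) / (x - a l))) *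
      Real.exp (√(16 * A * C ^ 2) / 2 * √(Real.log (3 + |x|) / (a r - x))) := by
  rw [← Finset.prod_filter_mul_prod_filter_not s (fun k => k ≤ l - 1)]
  refine mul_le_mul (h.prod_ratio_left_le hA hl hl' fun k hk => (Finset.mem_filter.1 hk).2)
    (h.prod_ratio_right_le hA hr hr' fun k hk => ?_)
    (Finset.prod_nonneg fun k _ => ratio_nonneg a k x) (Real.exp_pos _).le
  obtain ⟨h1, h2⟩ := Finset.mem_filter.1 hk
  have h3 := Finset.disjoint_left.1 hs h1
  rw [Finset.mem_Ico] at h3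
  omega

end LogSpaced

/-! ### The product near its poles and zeros -/

/-- The inequality B√(QL) ≤ B²Q/2 + L/2. With L = log log Δ it bounds the contribution of one side
by a multiple of √(log Δ). -/
theorem exp_mul_sqrt_div_le {B Q L M s : ℝ} (hs : 0 < s) (hL : 0 ≤ L) (hQ : 0 ≤ Q)
    (h : M ≤ Q * s * L) : Real.exp (B * √(M / s)) ≤ Real.exp (B ^ 2 * Q / 2) * Real.exp (L / 2) := by
  have h1 : M / s ≤ Q * L := by rw [div_le_iff₀ hs]; linarith
  have h2 : √(M / s) ≤ √Q * √L := by
    rw [← Real.sqrt_mul hQ]; exact Real.sqrt_le_sqrt h1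
  rw [← Real.exp_add, Real.exp_le_exp]
  have h3 := Real.sq_sqrt hQ
  have h4 := Real.sq_sqrt hL
  rcases le_total 0 B with hB | hB
  · have h5 : B * √(M / s) ≤ B * (√Q * √L) := by gcongr
    nlinarith [sq_nonneg (B * √Q - √L)]
  · have : B * √(M / s) ≤ 0 := mul_nonpos_of_nonpos_of_nonneg hB (Real.sqrt_nonneg _)
    have : 0 ≤ B ^ 2 * Q / 2 + L / 2 := by positivity
    linarith

namespace LogSpaced

variable {a : ℤ → ℝ} {δ C : ℝ}

theorem step_pred_succ (a : ℤ → ℝ) (n : ℤ) : step a (n - 1) = a n - a (n - 1) := by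
  simp [step]

/-- A gap is one of the two steps adjacent to its index, depending on the sign; comparability
removes the distinction. -/
theorem gap_bounds (h : LogSpaced a δ C) (n : ℤ) : gap a n ≤ C * step a n ∧
    step a n ≤ C * gap a n ∧ gap a n ≤ C * step a (n - 1) ∧ step a (n - 1) ≤ C * gap a n := by
  have h1 := h.step_succ_le (n - 1)
  have h2 := h.step_le_succ (n - 1)
  rw [sub_add_cancel] at h1 h2
  have h3 := h.one_le
  have h4 := h.step_pos n
  have h5 := h.step_pos (n - 1)
  have e1 : step a n ≤ C * step a n := le_mul_of_one_le_left h4.le h3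
  have e2 : step a (n - 1) ≤ C * step a (n - 1) := le_mul_of_one_le_left h5.le h3
  by_cases hn : 0 < n
  · have : gap a n = step a n := by simp [gap, step, hn]
    rw [this]
    exact ⟨e1, e1, h1, h2⟩
  · have : gap a n = step a (n - 1) := by simp [gap, step, hn]
    rw [this]
    exact ⟨h2, h1, e2, e2⟩

theorem ne_of_mem_Ioo (h : LogSpaced a δ C) {n : ℤ} {x : ℝ} (h1 : a n < x) (h2 : x < a (n + 1))
    (k : ℤ) : x ≠ a k := by
  rintro rfl
  have h3 := h.strictMono.lt_iff_lt.1 h1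
  have h4 := h.strictMono.lt_iff_lt.1 h2
  omega

theorem ne_of_near (h : LogSpaced a δ C) {n : ℤ} {x : ℝ} (h1 : x ≠ a n) (h2 : |x - a n| ≤ δ / 4)
    (k : ℤ) : x ≠ a k := by
  have hδ := h.pos
  have hd := h.le_step n
  have hd' := h.le_step (n - 1)
  rw [step_pred_succ] at hd'
  unfold step at hd
  rw [abs_le] at h2
  rcases lt_or_gt_of_ne h1 with hx | hx
  · refine h.ne_of_mem_Ioo (n := n - 1) (by linarith) ?_ k
    rwa [sub_add_cancel]
  · exact h.ne_of_mem_Ioo (n := n) hx (by linarith) k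

theorem Ico_pred_succ (n : ℤ) : Finset.Ico (n - 1) (n + 1) = {n - 1, n} := by
  ext k; simp only [Finset.mem_Ico, Finset.mem_insert, Finset.mem_singleton]; omega

theorem Ico_self_succ (n : ℤ) : Finset.Ico n (n + 1) = {n} := by
  ext k; simp only [Finset.mem_Ico, Finset.mem_singleton]; omega

/-- Both ratios adjacent to `a n` have |a n - x| in the denominator, so (x - a n)² cancels the
singularity exactly. -/
theorem ratio_mul_near {n : ℤ} {x : ℝ} (h1 : x ≠ a n) :
    (∏ k ∈ Finset.Ico (n - 1) (n + 1), ratio a k x) * (x - a n) ^ 2 =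
      ((midpt a (n - 1) - x) ^ 2 / |a (n - 1) - x|) * ((midpt a n - x) ^ 2 / |a (n + 1) - x|) := by
  have h2 : |a n - x| ≠ 0 := abs_ne_zero.2 (sub_ne_zero.2 h1.symm)
  have h3 : (x - a n) ^ 2 = |a n - x| ^ 2 := by rw [sq_abs]; ring
  rw [Ico_pred_succ, Finset.prod_pair (by omega), ratio_ofReal, ratio_ofReal, sub_add_cancel, h3]
  rw [div_mul_div_comm, div_mul_div_comm, div_mul_eq_mul_div]
  have : |a (n - 1) - x| * |a n - x| * (|a n - x| * |a (n + 1) - x|) =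
      |a (n - 1) - x| * |a (n + 1) - x| * |a n - x| ^ 2 := by ring
  rw [this, mul_div_mul_right _ _ (pow_ne_zero 2 h2)]

theorem near_geometry (h : LogSpaced a δ C) {n : ℤ} {x : ℝ} (h2 : |x - a n| ≤ δ / 4) :
    a (n - 1) < x ∧ x < a (n + 1) ∧
    3 / 4 * step a (n - 1) ≤ x - a (n - 1) ∧ x - a (n - 1) ≤ 2 * step a (n - 1) ∧
    3 / 4 * step a n ≤ a (n + 1) - x ∧ a (n + 1) - x ≤ 2 * step a n ∧
    step a (n - 1) / 4 ≤ x - midpt a (n - 1) ∧ x - midpt a (n - 1) ≤ step a (n - 1) ∧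
    step a n / 4 ≤ midpt a n - x ∧ midpt a n - x ≤ step a n := by
  have hδ := h.pos
  have hd := h.le_step n
  have hd' := h.le_step (n - 1)
  have e1 := step_pred_succ a n
  have e2 : step a n = a (n + 1) - a n := rfl
  have e3 := midpt_eq_sub_step a (n - 1)
  rw [sub_add_cancel] at e3
  have e4 := midpt_eq_add_step a n
  rw [abs_le] at h2
  refine ⟨?_, ?_, ?_, ?_, ?_, ?_, ?_, ?_, ?_, ?_⟩ <;> linarith

theorem exists_le_norm_fullProd_near (h : LogSpaced a δ C) : ∃ c : ℝ, 0 < c ∧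
    ∀ (n : ℤ) (x : ℝ), x ≠ a n → |x - a n| ≤ δ / 4 → c ≤ ‖fullProd a x‖ ^ 2 * (x - a n) ^ 2 := by
  obtain ⟨K, hK1, hK⟩ := h.exists_norm_fullProd_bounds
  have hδ := h.pos
  have hK0 : 0 < K := by linarith
  refine ⟨K⁻¹ * ((δ / 32) * (δ / 32)), by positivity, fun n x hx hnear => ?_⟩
  obtain ⟨g1, g2, g3, g4, g5, g6, g7, g8, g9, g10⟩ := h.near_geometry hnear
  have hb := (hK x (Finset.Ico (n - 1) (n + 1)) (h.ne_of_near hx hnear)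
    fun k hk => h.notMem_Icc g1 g2 hk).1
  have hp1 := h.step_pos n
  have hp2 := h.step_pos (n - 1)
  have low : ∀ {d m u : ℝ}, δ ≤ d → 0 < u → u ≤ 2 * d → d / 4 ≤ m → δ / 32 ≤ m ^ 2 / u := by
    intro d m u hd hu hud hm
    have hd0 : 0 < d := hδ.trans_le hd
    rw [le_div_iff₀ hu]
    calc δ / 32 * u ≤ d / 32 * (2 * d) := by gcongr
      _ = (d / 4) ^ 2 := by ring
      _ ≤ m ^ 2 := by gcongr
  have u1 : δ / 32 ≤ (midpt a (n - 1) - x) ^ 2 / |a (n - 1) - x| := by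
    rw [abs_of_neg (by linarith), neg_sub, ← neg_sub x (midpt a (n - 1)), neg_sq]
    exact low (h.le_step (n - 1)) (by linarith) g4 g7
  have u2 : δ / 32 ≤ (midpt a n - x) ^ 2 / |a (n + 1) - x| := by
    rw [abs_of_pos (by linarith)]
    exact low (h.le_step n) (by linarith) g6 g9
  calc _ ≤ K⁻¹ * (((midpt a (n - 1) - x) ^ 2 / |a (n - 1) - x|) *
          ((midpt a n - x) ^ 2 / |a (n + 1) - x|)) :=
        mul_le_mul_of_nonneg_left (mul_le_mul u1 u2 (by positivity) (by positivity)) (by positivity)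
    _ = K⁻¹ * (∏ k ∈ Finset.Ico (n - 1) (n + 1), ratio a k x) * (x - a n) ^ 2 := by
        rw [← ratio_mul_near hx, mul_assoc]
    _ ≤ _ := by gcongr

/-- The single ratio of the interval containing x suffices, as both distances in its denominator are
at most the step. This serves for the masses at the midpoints. -/
theorem exists_le_norm_fullProd (h : LogSpaced a δ C) : ∃ c : ℝ, 0 < c ∧
    ∀ (n : ℤ) (x : ℝ), a n < x → x < a (n + 1) →
      c * (midpt a n - x) ^ 2 ≤ ‖fullProd a x‖ ^ 2 * step a n ^ 2 := by
  obtain ⟨K, hK1, hK⟩ := h.exists_norm_fullProd_bounds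
  have hK0 : 0 < K := by linarith
  refine ⟨K⁻¹, by positivity, fun n x h1 h2 => ?_⟩
  have hb := (hK x (Finset.Ico n (n + 1)) (h.ne_of_mem_Ioo h1 h2)
    fun k hk => h.notMem_Icc h1 h2 hk).1
  rw [Ico_self_succ, Finset.prod_singleton, ratio_ofReal] at hb
  have hd := h.step_pos n
  have e : step a n = a (n + 1) - a n := rfl
  refine le_trans ?_ (mul_le_mul_of_nonneg_right hb (sq_nonneg (step a n)))
  rw [abs_of_neg (by linarith), abs_of_pos (by linarith), mul_assoc]
  gcongr
  have hx1 : 0 < -(a n - x) := by linarith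
  have hx2 : 0 < a (n + 1) - x := by linarith
  rw [div_mul_eq_mul_div, le_div_iff₀ (mul_pos hx1 hx2)]
  gcongr
  rw [sq]
  exact mul_le_mul (by linarith) (by linarith) hx2.le hd.le

/-- The one place where log|a n| ≲ Δ log log Δ is needed: the far points on either side contribute a
multiple of √(log Δ) each. -/
theorem exists_prod_ratio_le_log_gap (h : LogSpaced a δ C) {Q : ℝ} (hQ0 : 0 ≤ Q)
    (hQ : ∀ᶠ n in cofinite, Real.exp 1 < gap a n ∧
      Real.log |a n| ≤ Q * gap a n * Real.log (Real.log (gap a n))) :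
    ∃ K : ℝ, 0 < K ∧ ∀ᶠ n in cofinite, ∀ (x : ℝ) (l r : ℤ), |x - a n| ≤ step a n → a l < x →
      x < a r → step a (l - 1) ≤ 4 * C * (x - a l) → step a r ≤ 4 * C * (a r - x) →
      gap a n ≤ 4 * C * (x - a l) → gap a n ≤ 4 * C * (a r - x) →
      ∀ s : Finset ℤ, Disjoint s (Finset.Ico l r) →
        ∏ k ∈ s, ratio a k x ≤ K * Real.log (gap a n) := by
  have hC := h.one_le
  set B := √(16 * (4 * C) * C ^ 2) / 2 with hB
  -- The 2 comes from log(3 + |x|) ≤ 2 log|a n|, the 4C from comparing the distances to the ends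
  -- with the gap.
  set W := Real.exp (B ^ 2 * (2 * Q * (4 * C)) / 2) with hW
  refine ⟨W * W, by positivity, ?_⟩
  filter_upwards [hQ, h.tendsto_abs.eventually_ge_atTop (5 + 16 * C ^ 2)]
    with n ⟨hn1, hn2⟩ hn3 x l r hx hl hr hl' hr' hgl hgr s hs
  have hD0 : 0 < gap a n := (Real.exp_pos 1).trans hn1
  have hlog1 : 1 < Real.log (gap a n) := (Real.lt_log_iff_exp_lt hD0).2 hn1
  set L := Real.log (Real.log (gap a n)) with hL
  have hL0 : 0 ≤ L := Real.log_nonneg hlog1.le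
  -- The threshold 5 + 16C² is chosen so that 3 + |x| ≤ |a n|² for x within one step of `a n`.
  have hM : Real.log (3 + |x|) ≤ 2 * Real.log |a n| := by
    have h1 : |x| ≤ |a n| + step a n := by
      have : |x| ≤ |a n| + |x - a n| := by simpa using abs_add_le (a n) (x - a n)
      linarith
    have h2 := h.step_le_half n
    have h3 : 3 + |x| ≤ |a n| ^ 2 := by nlinarith [sq_nonneg C]
    have h4 := Real.log_le_log (by positivity) h3
    rw [Real.log_pow] at h4
    exact_mod_cast h4
  have gen : ∀ {u : ℝ}, 0 < u → gap a n ≤ 4 * C * u →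
      Real.exp (B * √(Real.log (3 + |x|) / u)) ≤ W * Real.exp (L / 2) := by
    intro u hu hgu
    refine exp_mul_sqrt_div_le hu hL0 (by positivity) ?_
    calc Real.log (3 + |x|) ≤ 2 * (Q * gap a n * L) := hM.trans (by gcongr)
      _ ≤ 2 * (Q * (4 * C * u) * L) := by gcongr
      _ = _ := by ring
  refine (h.prod_ratio_le (A := 4 * C) (by linarith) hl hr hl' hr' hs).trans ?_
  calc _ ≤ (W * Real.exp (L / 2)) * (W * Real.exp (L / 2)) :=
        mul_le_mul (gen (by linarith) hgl) (gen (by linarith) hgr) (Real.exp_pos _).le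
          (by positivity)
    _ = W * W * Real.exp (L / 2 + L / 2) := by rw [Real.exp_add]; ring
    _ = _ := by rw [add_halves, hL, Real.exp_log (by linarith)]

theorem exists_norm_fullProd_near_le (h : LogSpaced a δ C) {Q : ℝ} (hQ0 : 0 ≤ Q)
    (hQ : ∀ᶠ n in cofinite, Real.exp 1 < gap a n ∧
      Real.log |a n| ≤ Q * gap a n * Real.log (Real.log (gap a n))) :
    ∃ K : ℝ, 0 < K ∧ ∀ᶠ n in cofinite, ∀ x : ℝ, x ≠ a n → |x - a n| ≤ δ / 4 →
      ‖fullProd a x‖ ^ 2 * (x - a n) ^ 2 ≤ K * (gap a n * Real.log (gap a n)) ^ 2 := by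
  obtain ⟨K₁, hK1, hK⟩ := h.exists_norm_fullProd_bounds
  obtain ⟨K₂, hK2, hev⟩ := h.exists_prod_ratio_le_log_gap hQ0 hQ
  have hC := h.one_le
  have hδ := h.pos
  have hK10 : 0 < K₁ := by linarith
  refine ⟨K₁ * K₂ * (2 * C * (2 * C)), by positivity, ?_⟩
  filter_upwards [hQ, hev] with n ⟨hn1, _⟩ hn x hx hnear
  have hD0 : 0 < gap a n := (Real.exp_pos 1).trans hn1
  have hlog1 : 1 < Real.log (gap a n) := (Real.lt_log_iff_exp_lt hD0).2 hn1
  obtain ⟨g1, g2, g3, g4, g5, g6, g7, g8, g9, g10⟩ := h.near_geometry hnear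
  obtain ⟨f1, f2, f3, f4⟩ := h.gap_bounds n
  have hp1 := h.step_pos n
  have hp2 := h.step_pos (n - 1)
  have s1 := h.step_le_succ (n - 1 - 1)
  have s2 := h.step_succ_le n
  rw [sub_add_cancel] at s1
  have hb := (hK x (Finset.Ico (n - 1) (n + 1)) (h.ne_of_near hx hnear)
    fun k hk => h.notMem_Icc g1 g2 hk).2 _
      (fun s hs => hn x (n - 1) (n + 1) (by linarith [h.le_step n]) g1 g2
        (by nlinarith) (by nlinarith) (by nlinarith) (by nlinarith) s hs)
  have up : ∀ {d m u : ℝ}, 0 < d → d ≤ C * gap a n → 3 / 4 * d ≤ u → 0 ≤ m → m ≤ d →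
      m ^ 2 / u ≤ 2 * C * gap a n := by
    intro d m u hd hdg hu hm hmd
    rw [div_le_iff₀ (by linarith)]
    calc m ^ 2 ≤ d ^ 2 := by gcongr
      _ ≤ 2 * d * (3 / 4 * d) := by nlinarith
      _ ≤ 2 * (C * gap a n) * u := by gcongr
      _ = _ := by ring
  have u1 : (midpt a (n - 1) - x) ^ 2 / |a (n - 1) - x| ≤ 2 * C * gap a n := by
    rw [abs_of_neg (by linarith), neg_sub, ← neg_sub x (midpt a (n - 1)), neg_sq]
    exact up hp2 f4 g3 (by linarith) g8
  have u2 : (midpt a n - x) ^ 2 / |a (n + 1) - x| ≤ 2 * C * gap a n := by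
    rw [abs_of_pos (by linarith)]
    exact up hp1 f2 g5 (by linarith) g10
  calc _ ≤ (K₁ * (K₂ * Real.log (gap a n)) * ∏ k ∈ Finset.Ico (n - 1) (n + 1), ratio a k x) *
          (x - a n) ^ 2 := by gcongr
    _ = K₁ * (K₂ * Real.log (gap a n)) * (((midpt a (n - 1) - x) ^ 2 / |a (n - 1) - x|) *
          ((midpt a n - x) ^ 2 / |a (n + 1) - x|)) := by rw [← ratio_mul_near hx, mul_assoc]
    _ ≤ K₁ * (K₂ * Real.log (gap a n)) * ((2 * C * gap a n) * (2 * C * gap a n)) :=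
        mul_le_mul_of_nonneg_left (mul_le_mul u1 u2 (by positivity) (by positivity)) (by positivity)
    _ = K₁ * K₂ * (2 * C * (2 * C)) * (gap a n ^ 2 * (Real.log (gap a n) * 1)) := by ring
    -- The estimate gives only one logarithm; a second is given away to make the bound a perfect
    -- square.
    _ ≤ K₁ * K₂ * (2 * C * (2 * C)) *
          (gap a n ^ 2 * (Real.log (gap a n) * Real.log (gap a n))) := by gcongr
    _ = _ := by ring

/-- The far ratios cost log Δ, while the local ratio gains a factor of order 1/step². As log Δ ≤ Δ ≤
C · step, what remains is of order 1/step, bounded by 1/δ. -/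
theorem exists_norm_fullProd_near_midpt_le (h : LogSpaced a δ C) {Q : ℝ} (hQ0 : 0 ≤ Q)
    (hQ : ∀ᶠ n in cofinite, Real.exp 1 < gap a n ∧
      Real.log |a n| ≤ Q * gap a n * Real.log (Real.log (gap a n))) :
    ∃ K : ℝ, 0 < K ∧ ∀ᶠ n in cofinite, ∀ x : ℝ, |x - midpt a n| ≤ δ / 4 →
      ‖fullProd a x‖ ^ 2 ≤ K * (x - midpt a n) ^ 2 := by
  obtain ⟨K₁, hK1, hK⟩ := h.exists_norm_fullProd_bounds
  obtain ⟨K₂, hK2, hev⟩ := h.exists_prod_ratio_le_log_gap hQ0 hQ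
  have hC := h.one_le
  have hδ := h.pos
  have hK10 : 0 < K₁ := by linarith
  refine ⟨K₁ * K₂ * (16 * C / δ), by positivity, ?_⟩
  filter_upwards [hQ, hev] with n ⟨hn1, _⟩ hn x hnear
  have hD0 : 0 < gap a n := (Real.exp_pos 1).trans hn1
  have hlog1 : 1 < Real.log (gap a n) := (Real.lt_log_iff_exp_lt hD0).2 hn1
  obtain ⟨f1, f2, f3, f4⟩ := h.gap_bounds n
  have hp1 := h.step_pos n
  have hd := h.le_step n
  have e1 := midpt_eq_add_step a n
  have e2 : step a n = a (n + 1) - a n := rfl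
  have hnear' := hnear
  rw [abs_le] at hnear'
  have g1 : step a n / 4 ≤ x - a n := by linarith
  have g2 : step a n / 4 ≤ a (n + 1) - x := by linarith
  have s1 := h.step_le_succ (n - 1)
  have s2 := h.step_succ_le n
  rw [sub_add_cancel] at s1
  have m1 : C * step a n ≤ 4 * C * (x - a n) := by nlinarith
  have m2 : C * step a n ≤ 4 * C * (a (n + 1) - x) := by nlinarith
  have hx1 : a n < x := by linarith
  have hx2 : x < a (n + 1) := by linarith
  have hb := (hK x (Finset.Ico n (n + 1)) (h.ne_of_mem_Ioo hx1 hx2)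
    fun k hk => h.notMem_Icc hx1 hx2 hk).2 _
      (fun s hs => hn x n (n + 1) (by rw [abs_of_pos (by linarith)]; linarith) hx1 hx2
        (by linarith) (by linarith) (by linarith) (by linarith) s hs)
  rw [Ico_self_succ, Finset.prod_singleton, ratio_ofReal, abs_of_neg (by linarith : a n - x < 0),
    abs_of_pos (by linarith : 0 < a (n + 1) - x)] at hb
  refine hb.trans ?_
  have hlog : Real.log (gap a n) ≤ C * step a n :=
    (Real.log_le_self hD0.le).trans f1
  have hden : step a n / 4 * (step a n / 4) ≤ -(a n - x) * (a (n + 1) - x) :=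
    mul_le_mul (by linarith) g2 (by linarith) (by linarith)
  calc K₁ * (K₂ * Real.log (gap a n)) *
          ((midpt a n - x) ^ 2 / (-(a n - x) * (a (n + 1) - x)))
      ≤ K₁ * (K₂ * (C * step a n)) * ((midpt a n - x) ^ 2 / (step a n / 4 * (step a n / 4))) := by
        gcongr
        exact div_nonneg (sq_nonneg _) ((by positivity : (0 : ℝ) ≤ _).trans hden)
    _ = K₁ * K₂ * (16 * C / step a n) * (x - midpt a n) ^ 2 := by
        field_simp
        ring
    _ ≤ K₁ * K₂ * (16 * C / δ) * (x - midpt a n) ^ 2 := by gcongr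

end LogSpaced

/-! ### The inner function -/

/-- The function `exp (π i (K u + i c))`, continued to the plane. -/
noncomputable def kreinFun (a : ℤ → ℝ) (c : ℝ) (z : ℂ) : ℂ :=
  -Complex.I * (Real.exp (-(Real.pi * c)) : ℝ) * fullProd a z

open Classical in
/-- The inner function with the Krein shift `u` and the constant `c`. -/
noncomputable def innerFun (a : ℤ → ℝ) (c : ℝ) (z : ℂ) : ℂ :=
  if ∃ k, z = a k then 1 else (kreinFun a c z - 1) / (kreinFun a c z + 1)

/-- The numerator of `kreinFun` when the pole `a n` is taken out. -/
noncomputable def localNum (a : ℤ → ℝ) (c : ℝ) (n : ℤ) (z : ℂ) : ℂ :=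
  -Complex.I * (Real.exp (-(Real.pi * c)) : ℝ) *
    (((midpt a n : ℂ) - z) * (normRatio a n : ℂ) * prodExcept a n z)

theorem im_eq_zero_of_hasProd {f : ℤ → ℂ} {v : ℂ} (h : HasProd f v) (hf : ∀ k, (f k).im = 0) :
    v.im = 0 := by
  have hcl : IsClosed {z : ℂ | z.im = 0} := isClosed_eq Complex.continuous_im continuous_const
  refine hcl.mem_of_tendsto h (.of_forall fun s => ?_)
  have : ∏ k ∈ s, f k = ((∏ k ∈ s, (f k).re : ℝ) : ℂ) := by
    rw [Complex.ofReal_prod]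
    exact Finset.prod_congr rfl fun k _ => Complex.ext rfl (by simp [hf k])
  simp only [Set.mem_ofPred_eq]
  rw [this, Complex.ofReal_im]

theorem factor_ofReal_im (a : ℤ → ℝ) (k : ℤ) (x : ℝ) : (factor a k x).im = 0 := by
  rw [factor_conj, Complex.ofReal_im]

theorem hasDerivAt_factor {a : ℤ → ℝ} {k : ℤ} {z : ℂ} (ha : z ≠ a k) (hb : z ≠ midpt a k) :
    HasDerivAt (factor a k) (factor a k z * (1 / ((a k : ℂ) - z) - 1 / ((midpt a k : ℂ) - z))) z := by
  have h1 := sub_ne_zero.2 ha.symm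
  have h2 := sub_ne_zero.2 hb.symm
  have h3 := ((((hasDerivAt_id z).const_sub (midpt a k : ℂ)).div
    ((hasDerivAt_id z).const_sub (a k : ℂ)) h1).mul_const (normRatio a k : ℂ))
  refine (h3.congr_deriv ?_)
  unfold factor
  simp only [id]
  field_simp
  ring

theorem logDeriv_factor {a : ℤ → ℝ} {k : ℤ} {z : ℂ} (ha : z ≠ a k) (hb : z ≠ midpt a k) :
    logDeriv (factor a k) z = 1 / ((a k : ℂ) - z) - 1 / ((midpt a k : ℂ) - z) := by
  rw [logDeriv_apply, (hasDerivAt_factor ha hb).deriv, mul_div_cancel_left₀ _ (factor_ne_zero ha hb)]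

namespace LogSpaced

variable {a : ℤ → ℝ} {δ C : ℝ}

theorem ofReal_mem_awayFrom (h : LogSpaced a δ C) (n : ℤ) : (a n : ℂ) ∈ awayFrom a n :=
  fun _ hk e => hk (h.strictMono.injective (Complex.ofReal_injective e)).symm

theorem midpt_ne (h : LogSpaced a δ C) (n k : ℤ) : (midpt a n : ℂ) ≠ a k := fun e =>
  h.ne_of_mem_Ioo (h.lt_midpt n) (h.midpt_lt n) k (Complex.ofReal_injective e)

theorem prodExcept_im (h : LogSpaced a δ C) {n : ℤ} {x : ℝ} (hx : (x : ℂ) ∈ awayFrom a n) :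
    (prodExcept a n x).im = 0 :=
  im_eq_zero_of_hasProd (h.hasProd_prodExcept hx) fun k => by
    split_ifs
    · exact Complex.one_im
    · exact factor_ofReal_im a k x

theorem fullProd_im (h : LogSpaced a δ C) (x : ℝ) : (fullProd a x).im = 0 :=
  im_eq_zero_of_hasProd (h.hasProd_factor x) fun k => factor_ofReal_im a k x

theorem prodExcept_self_ne_zero (h : LogSpaced a δ C) (n : ℤ) : prodExcept a n (a n) ≠ 0 :=
  h.prodExcept_ne_zero (h.ofReal_mem_awayFrom n) fun k _ => (h.midpt_ne k n).symm

theorem kreinFun_mul (h : LogSpaced a δ C) {c : ℝ} {n : ℤ} {z : ℂ} (hz : z ∈ awayFrom a n)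
    (hn : z ≠ a n) : kreinFun a c z * ((a n : ℂ) - z) = localNum a c n z := by
  have := sub_ne_zero.2 hn.symm
  unfold kreinFun localNum
  rw [h.fullProd_eq hz]
  unfold factor
  field_simp

theorem localNum_self_ne_zero (h : LogSpaced a δ C) (c : ℝ) (n : ℤ) : localNum a c n (a n) ≠ 0 := by
  unfold localNum
  refine mul_ne_zero (mul_ne_zero (neg_ne_zero.2 Complex.I_ne_zero)
    (Complex.ofReal_ne_zero.2 (Real.exp_ne_zero _)))
    (mul_ne_zero (mul_ne_zero (sub_ne_zero.2 (h.midpt_ne n n))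
      (Complex.ofReal_ne_zero.2 (normRatio_pos a n).ne')) (h.prodExcept_self_ne_zero n))

/-- Clearing the pole gives a formula that is valid at `a n` as well. There `kreinFun` has the
default value 0, which would give the quotient the wrong value -1; hence the case distinction in
`innerFun`. -/
theorem innerFun_eq (h : LogSpaced a δ C) (c : ℝ) {n : ℤ} {z : ℂ} (hz : z ∈ awayFrom a n) :
    innerFun a c z =
      (localNum a c n z - ((a n : ℂ) - z)) / (localNum a c n z + ((a n : ℂ) - z)) := by
  by_cases hn : z = a n
  · subst hn
    unfold innerFun
    rw [if_pos ⟨n, rfl⟩, sub_self, sub_zero, add_zero, div_self (h.localNum_self_ne_zero c n)]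
  · have hne : ¬ ∃ k, z = a k := by
      rintro ⟨k, hk⟩
      by_cases hkn : k = n
      · exact hn (hkn ▸ hk)
      · exact hz k hkn hk
    have h1 := sub_ne_zero.2 (Ne.symm hn)
    unfold innerFun
    rw [if_neg hne, ← h.kreinFun_mul hz hn, ← mul_div_mul_right _ _ h1]
    ring

theorem analyticAt_localNum (h : LogSpaced a δ C) (c : ℝ) {n : ℤ} {z : ℂ} (hz : z ∈ awayFrom a n) :
    AnalyticAt ℂ (localNum a c n) z := by
  have := h.analyticAt_prodExcept hz
  unfold localNum
  fun_prop

theorem innerFun_eventuallyEq (h : LogSpaced a δ C) (c : ℝ) {n : ℤ} {z : ℂ}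
    (hz : z ∈ awayFrom a n) : (fun z => (localNum a c n z - ((a n : ℂ) - z)) /
      (localNum a c n z + ((a n : ℂ) - z))) =ᶠ[nhds z] innerFun a c := by
  filter_upwards [(h.isOpen_awayFrom n).mem_nhds hz] with w hw
  exact (h.innerFun_eq c hw).symm

theorem meromorphicAt_innerFun (h : LogSpaced a δ C) (c : ℝ) (z : ℂ) :
    MeromorphicAt (innerFun a c) z := by
  obtain ⟨n, hn⟩ := h.exists_mem_awayFrom z
  have h1 := h.analyticAt_localNum c hn
  have h2 : AnalyticAt ℂ (fun z => (a n : ℂ) - z) z := by fun_prop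
  exact ((h1.sub h2).meromorphicAt.div (h1.add h2).meromorphicAt).congr
    ((h.innerFun_eventuallyEq c hn).filter_mono nhdsWithin_le_nhds)

theorem kreinFun_eq_exp (h : LogSpaced a δ C) (c : ℝ) {z : ℂ} (hz : 0 < z.im) :
    kreinFun a c z =
      Complex.exp ((∫ t : ℝ, (shiftFun a t : ℂ) * cauchyKernel z t) - (Real.pi * c : ℝ)) := by
  unfold kreinFun
  rw [integral_shiftFun_mul a hz, h.fullProd_eq_exp hz, sub_sub, Complex.exp_sub, Complex.exp_add,
    Complex.exp_pi_div_two_mul_I, Real.exp_neg, Complex.ofReal_inv, Complex.ofReal_exp]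
  have := Complex.exp_ne_zero ((Real.pi * c : ℝ) : ℂ)
  have hI := Complex.I_ne_zero
  rw [div_eq_mul_inv, mul_inv, Complex.inv_I]
  ring

theorem kreinFun_re_nonneg (h : LogSpaced a δ C) (c : ℝ) {z : ℂ} (hz : 0 < z.im) :
    0 ≤ (kreinFun a c z).re := by
  rw [h.kreinFun_eq_exp c hz, Complex.exp_re]
  refine mul_nonneg (Real.exp_pos _).le (Real.cos_nonneg_of_neg_pi_div_two_le_of_le ?_ ?_) <;>
  · have := abs_le.1 (abs_im_integral_shiftFun_le a hz)
    simp only [Complex.sub_im, Complex.ofReal_im, sub_zero]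
    linarith [this.1, this.2]

theorem log_kreinFun (h : LogSpaced a δ C) (c : ℝ) {z : ℂ} (hz : 0 < z.im) :
    Complex.log (kreinFun a c z) =
      (∫ t : ℝ, (shiftFun a t : ℂ) * cauchyKernel z t) - (Real.pi * c : ℝ) := by
  have := abs_le.1 (abs_im_integral_shiftFun_le a hz)
  have hpi := Real.pi_pos
  rw [h.kreinFun_eq_exp c hz, Complex.log_exp]
  · simp only [Complex.sub_im, Complex.ofReal_im, sub_zero]
    linarith [this.1]
  · simp only [Complex.sub_im, Complex.ofReal_im, sub_zero]
    linarith [this.2]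

theorem kreinFun_ne_zero (h : LogSpaced a δ C) (c : ℝ) {z : ℂ} (hz : 0 < z.im) :
    kreinFun a c z ≠ 0 := by
  rw [h.kreinFun_eq_exp c hz]; exact Complex.exp_ne_zero _

theorem add_one_ne_zero_of_re_nonneg {w : ℂ} (hw : 0 ≤ w.re) : w + 1 ≠ 0 := fun e => by
  have := congrArg Complex.re e
  simp at this
  linarith

theorem innerFun_of_im_pos {c : ℝ} {z : ℂ} (hz : 0 < z.im) :
    innerFun a c z = (kreinFun a c z - 1) / (kreinFun a c z + 1) := by
  unfold innerFun
  rw [if_neg]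
  rintro ⟨k, hk⟩
  exact (ofReal_sub_ne_zero hz (a k)) (sub_eq_zero.2 hk.symm)

theorem norm_innerFun_le (h : LogSpaced a δ C) (c : ℝ) {z : ℂ} (hz : 0 < z.im) :
    ‖innerFun a c z‖ ≤ 1 := by
  have hre := h.kreinFun_re_nonneg c hz
  have hne := add_one_ne_zero_of_re_nonneg hre
  rw [innerFun_of_im_pos hz, norm_div, div_le_one (norm_pos_iff.2 hne)]
  rw [← sq_le_sq₀ (norm_nonneg _) (norm_nonneg _), ← Complex.normSq_eq_norm_sq,
    ← Complex.normSq_eq_norm_sq, Complex.normSq_apply, Complex.normSq_apply]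
  simp only [Complex.sub_re, Complex.sub_im, Complex.add_re, Complex.add_im, Complex.one_re,
    Complex.one_im, sub_zero, add_zero]
  nlinarith

theorem one_add_div_one_sub (h : LogSpaced a δ C) (c : ℝ) {z : ℂ} (hz : 0 < z.im) :
    (1 + innerFun a c z) / (1 - innerFun a c z) = kreinFun a c z := by
  have hne := add_one_ne_zero_of_re_nonneg (h.kreinFun_re_nonneg c hz)
  rw [innerFun_of_im_pos hz]
  have h2 : (2 : ℂ) ≠ 0 := two_ne_zero
  have e1 : 1 + (kreinFun a c z - 1) / (kreinFun a c z + 1) =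
      2 * kreinFun a c z / (kreinFun a c z + 1) := by field_simp; ring
  have e2 : 1 - (kreinFun a c z - 1) / (kreinFun a c z + 1) = 2 / (kreinFun a c z + 1) := by
    field_simp; ring
  rw [e1, e2]
  field_simp

theorem kreinFun_ofReal (h : LogSpaced a δ C) (c x : ℝ) : kreinFun a c x =
    -Complex.I * ((Real.exp (-(Real.pi * c)) * (fullProd a x).re : ℝ) : ℂ) := by
  have : fullProd a x = ((fullProd a x).re : ℂ) := Complex.ext rfl (by simp [h.fullProd_im x])
  unfold kreinFun
  rw [mul_assoc]
  congr 1
  rw [Complex.ofReal_mul, ← this]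

theorem kreinFun_ofReal_re (h : LogSpaced a δ C) (c x : ℝ) : (kreinFun a c x).re = 0 := by
  rw [h.kreinFun_ofReal, mul_comm, Complex.re_ofReal_mul, Complex.neg_re, Complex.I_re, neg_zero,
    mul_zero]

/-- Off `a n` this is (F + 1)(a n - z), and Re F ≥ 0 on the closed half-plane away from the poles;
at `a n` only the nonzero numerator is left. -/
theorem localNum_add_ne_zero (h : LogSpaced a δ C) (c : ℝ) {n : ℤ} {z : ℂ} (hz : z ∈ awayFrom a n)
    (him : 0 ≤ z.im) : localNum a c n z + ((a n : ℂ) - z) ≠ 0 := by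
  by_cases hn : z = a n
  · subst hn
    rw [sub_self, add_zero]
    exact h.localNum_self_ne_zero c n
  · have h1 := sub_ne_zero.2 (Ne.symm hn)
    have e : localNum a c n z + ((a n : ℂ) - z) = (kreinFun a c z + 1) * ((a n : ℂ) - z) := by
      rw [← h.kreinFun_mul hz hn]; ring
    rw [e]
    refine mul_ne_zero (add_one_ne_zero_of_re_nonneg ?_) h1
    rcases him.lt_or_eq with hlt | heq
    · exact h.kreinFun_re_nonneg c hlt
    · have : z = (z.re : ℂ) := Complex.ext rfl (by simp [← heq])
      rw [this, h.kreinFun_ofReal_re]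

theorem analyticAt_innerFun (h : LogSpaced a δ C) (c : ℝ) {z : ℂ} (him : 0 ≤ z.im) :
    AnalyticAt ℂ (innerFun a c) z := by
  obtain ⟨n, hn⟩ := h.exists_mem_awayFrom z
  have h1 := h.analyticAt_localNum c hn
  have h2 : AnalyticAt ℂ (fun z => (a n : ℂ) - z) z := by fun_prop
  exact ((h1.sub h2).div (h1.add h2) (h.localNum_add_ne_zero c hn him)).congr
    (h.innerFun_eventuallyEq c hn)

theorem norm_innerFun_ofReal (h : LogSpaced a δ C) (c x : ℝ) : ‖innerFun a c x‖ = 1 := by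
  unfold innerFun
  split_ifs with hx
  · exact norm_one
  · have hne : kreinFun a c x + 1 ≠ 0 :=
      add_one_ne_zero_of_re_nonneg (h.kreinFun_ofReal_re c x).ge
    rw [norm_div, div_eq_one_iff_eq (norm_ne_zero_iff.2 hne), h.kreinFun_ofReal]
    set r := Real.exp (-(Real.pi * c)) * (fullProd a x).re
    rw [Complex.norm_eq_sqrt_sq_add_sq, Complex.norm_eq_sqrt_sq_add_sq]
    simp

theorem innerSpectrum_innerFun (h : LogSpaced a δ C) (c : ℝ) :
    innerSpectrum (innerFun a c) = Set.range a := by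
  ext x
  simp only [innerSpectrum, Set.mem_ofPred_eq, Set.mem_range]
  constructor
  · intro hx
    by_contra hcon
    have hne : ¬ ∃ k, (x : ℂ) = a k := fun ⟨k, hk⟩ =>
      hcon ⟨k, (Complex.ofReal_injective hk).symm⟩
    unfold innerFun at hx
    have hne1 : kreinFun a c x + 1 ≠ 0 :=
      add_one_ne_zero_of_re_nonneg (h.kreinFun_ofReal_re c x).ge
    rw [if_neg hne, div_eq_one_iff_eq hne1, sub_eq_add_neg, add_right_inj] at hx
    norm_num at hx
  · rintro ⟨k, rfl⟩
    unfold innerFun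
    rw [if_pos ⟨k, rfl⟩]

theorem isMeromorphicInner_innerFun (h : LogSpaced a δ C) (c : ℝ) :
    IsMeromorphicInner (innerFun a c) where
  analytic := fun _ hz => h.analyticAt_innerFun c hz
  bounded := ⟨1, fun _ hz => h.norm_innerFun_le c hz⟩
  unimodular := .of_forall fun x => h.norm_innerFun_ofReal c x
  meromorphic := fun z _ => h.meromorphicAt_innerFun c z

/-! ### The logarithmic derivative on the line -/

theorem logDeriv_term_nonneg (h : LogSpaced a δ C) {n : ℤ} {x : ℝ} (h1 : a n < x)
    (h2 : x < a (n + 1)) {k : ℤ} (hk : k ≠ n) : 0 ≤ 1 / (a k - x) - 1 / (midpt a k - x) := by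
  rcases lt_or_gt_of_ne hk with hlt | hlt
  · have h3 := h.strictMono.monotone (show k + 1 ≤ n by omega)
    have h4 := h.midpt_lt k
    have h5 := h.lt_midpt k
    exact sub_nonneg.2 (one_div_le_one_div_of_neg_of_le (by linarith) (by linarith))
  · have h3 := h.strictMono.monotone (show n + 1 ≤ k by omega)
    have h5 := h.lt_midpt k
    exact sub_nonneg.2 (one_div_le_one_div_of_le (by linarith) (by linarith))

/-- Replacing each midpoint by the next point of the sequence enlarges the nonnegative terms and
makes the sum telescope. -/
theorem sum_logDeriv_term_right_le (h : LogSpaced a δ C) {r : ℤ} {x : ℝ} (h2 : x < a r)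
    {s : Finset ℤ} (hs : ∀ k ∈ s, r ≤ k) :
    ∑ k ∈ s, (1 / (a k - x) - 1 / (midpt a k - x)) ≤ 1 / (a r - x) := by
  obtain ⟨J, hJ⟩ := exists_subset_image_add hs
  have hmono : ∀ j : ℕ, a r ≤ a (r + j) := fun j => h.strictMono.monotone (by omega)
  have hterm : ∀ j : ℕ, 1 / (a (r + j) - x) - 1 / (midpt a (r + j) - x) ≤
      1 / (a (r + j) - x) - 1 / (a (r + (j + 1 : ℕ)) - x) := by
    intro j
    have h3 := hmono j
    have h4 := h.lt_midpt (r + j)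
    have h5 := h.midpt_lt (r + j)
    push_cast
    rw [← add_assoc]
    exact sub_le_sub_left (one_div_le_one_div_of_le (by linarith) (by linarith)) _
  calc _ ≤ ∑ k ∈ (Finset.range J).image (fun j : ℕ => r + j),
          (1 / (a k - x) - 1 / (midpt a k - x)) := by
        refine Finset.sum_le_sum_of_subset_of_nonneg hJ fun k hk _ => ?_
        obtain ⟨j, -, rfl⟩ := Finset.mem_image.1 hk
        have h3 := hmono j
        have h4 := h.lt_midpt (r + j)
        exact sub_nonneg.2 (one_div_le_one_div_of_le (by linarith) (by linarith))
    _ = ∑ j ∈ Finset.range J, (1 / (a (r + j) - x) - 1 / (midpt a (r + j) - x)) :=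
        Finset.sum_image fun i _ j _ hij => by simpa using hij
    _ ≤ ∑ j ∈ Finset.range J, (1 / (a (r + j) - x) - 1 / (a (r + (j + 1 : ℕ)) - x)) :=
        Finset.sum_le_sum fun j _ => hterm j
    _ = 1 / (a r - x) - 1 / (a (r + J) - x) := by
        rw [Finset.sum_range_sub' (fun j : ℕ => 1 / (a (r + j) - x))]
        simp
    _ ≤ _ := by
        have h3 := hmono J
        have : 0 ≤ 1 / (a (r + J) - x) := one_div_nonneg.2 (by linarith)
        linarith

/-- On this side `a k` is replaced by the preceding midpoint, so the sum telescopes along midpoints.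
The resulting bound involves the last midpoint and not the last pole, and so stays bounded as x
approaches `a (l + 1)`. -/
theorem sum_logDeriv_term_left_le (h : LogSpaced a δ C) {l : ℤ} {x : ℝ} (h2 : a (l + 1) ≤ x)
    {s : Finset ℤ} (hs : ∀ k ∈ s, k ≤ l) :
    ∑ k ∈ s, (1 / (a k - x) - 1 / (midpt a k - x)) ≤ 1 / (x - midpt a l) := by
  obtain ⟨J, hJ⟩ := exists_subset_image_sub hs
  have hb : midpt a l < x := (h.midpt_lt l).trans_le h2
  have hmono : ∀ j : ℕ, midpt a (l - j) ≤ midpt a l := fun j =>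
    h.midpt_strictMono.monotone (by omega)
  have hneg : ∀ u : ℝ, 1 / (u - x) = -(1 / (x - u)) := fun u => by
    rw [← neg_sub, one_div_neg_eq_neg_one_div]
  have hterm : ∀ j : ℕ, 1 / (a (l - j) - x) - 1 / (midpt a (l - j) - x) ≤
      1 / (x - midpt a (l - j)) - 1 / (x - midpt a (l - (j + 1 : ℕ))) := by
    intro j
    have h3 := hmono j
    have h4 := h.lt_midpt (l - j)
    have h5 := h.midpt_lt (l - (j + 1 : ℕ))
    have e : l - ((j + 1 : ℕ) : ℤ) + 1 = l - j := by push_cast; ring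
    rw [e] at h5
    rw [hneg, hneg]
    have := one_div_le_one_div_of_le (show 0 < x - a (l - j) by linarith)
      (show x - a (l - j) ≤ x - midpt a (l - (j + 1 : ℕ)) by linarith)
    linarith
  calc _ ≤ ∑ k ∈ (Finset.range J).image (fun j : ℕ => l - j),
          (1 / (a k - x) - 1 / (midpt a k - x)) := by
        refine Finset.sum_le_sum_of_subset_of_nonneg hJ fun k hk _ => ?_
        obtain ⟨j, -, rfl⟩ := Finset.mem_image.1 hk
        have h3 := hmono j
        have h4 := h.lt_midpt (l - j)
        exact sub_nonneg.2 (one_div_le_one_div_of_neg_of_le (by linarith) (by linarith))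
    _ = ∑ j ∈ Finset.range J, (1 / (a (l - j) - x) - 1 / (midpt a (l - j) - x)) :=
        Finset.sum_image fun i _ j _ hij => by simpa using hij
    _ ≤ ∑ j ∈ Finset.range J,
          (1 / (x - midpt a (l - j)) - 1 / (x - midpt a (l - (j + 1 : ℕ)))) :=
        Finset.sum_le_sum fun j _ => hterm j
    _ = 1 / (x - midpt a l) - 1 / (x - midpt a (l - J)) := by
        rw [Finset.sum_range_sub' (fun j : ℕ => 1 / (x - midpt a (l - j)))]
        simp
    _ ≤ _ := by
        have h3 := hmono J
        have : 0 ≤ 1 / (x - midpt a (l - J)) := one_div_nonneg.2 (by linarith)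
        linarith

theorem sum_logDeriv_term_le (h : LogSpaced a δ C) {n : ℤ} {x : ℝ} (h1 : a n < x)
    (h2 : x < a (n + 1)) (s : Finset ℤ) :
    ∑ k ∈ s, (if k = n then 0 else 1 / (a k - x) - 1 / (midpt a k - x)) ≤
      1 / (a (n + 1) - x) + 2 / δ := by
  have hδ := h.pos
  have e : ∑ k ∈ s, (if k = n then 0 else 1 / (a k - x) - 1 / (midpt a k - x)) =
      ∑ k ∈ s.filter (fun k => n + 1 ≤ k), (1 / (a k - x) - 1 / (midpt a k - x)) +
      ∑ k ∈ s.filter (fun k => k ≤ n - 1), (1 / (a k - x) - 1 / (midpt a k - x)) := by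
    rw [Finset.sum_filter, Finset.sum_filter, ← Finset.sum_add_distrib]
    refine Finset.sum_congr rfl fun k _ => ?_
    rcases lt_trichotomy k n with hk | hk | hk
    · rw [if_neg hk.ne, if_neg (by omega), if_pos (by omega), zero_add]
    · rw [if_pos hk, if_neg (by omega), if_neg (by omega), zero_add]
    · rw [if_neg hk.ne', if_pos (by omega), if_neg (by omega), add_zero]
  have h3 := h.sum_logDeriv_term_right_le h2 (s := s.filter (fun k => n + 1 ≤ k))
    fun k hk => (Finset.mem_filter.1 hk).2
  have h4 := h.sum_logDeriv_term_left_le (l := n - 1) (x := x) (by rw [sub_add_cancel]; exact h1.le)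
    (s := s.filter (fun k => k ≤ n - 1)) fun k hk => (Finset.mem_filter.1 hk).2
  have h5 : 1 / (x - midpt a (n - 1)) ≤ 2 / δ := by
    have h6 := h.le_step (n - 1)
    have h7 := midpt_eq_sub_step a (n - 1)
    rw [sub_add_cancel] at h7
    rw [div_le_div_iff₀ (by linarith) hδ]
    linarith
  rw [e]
  linarith

theorem norm_logDeriv_prodExcept_le (h : LogSpaced a δ C) {n : ℤ} {x : ℝ} (h1 : a n < x)
    (h2 : x < a (n + 1)) :
    ‖logDeriv (prodExcept a n) x‖ ≤ 1 / (a (n + 1) - x) + 2 / δ := by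
  have hxa : ∀ k, (x : ℂ) ≠ a k := fun k e => h.ne_of_mem_Ioo h1 h2 k (Complex.ofReal_injective e)
  have hxb : ∀ k, k ≠ n → (x : ℂ) ≠ midpt a k := by
    intro k hk e
    have e' := Complex.ofReal_injective e
    subst e'
    have h3 := h.strictMono.lt_iff_lt.1 (h1.trans (h.midpt_lt k))
    have h4 := h.strictMono.lt_iff_lt.1 ((h.lt_midpt k).trans h2)
    omega
  have hmem : (x : ℂ) ∈ awayFrom a n := fun k _ => hxa k
  set t : ℤ → ℝ := fun k => if k = n then 0 else 1 / (a k - x) - 1 / (midpt a k - x) with ht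
  have ht0 : ∀ k, 0 ≤ t k := by
    intro k
    simp only [ht]
    split_ifs with hk
    · exact le_rfl
    · exact h.logDeriv_term_nonneg h1 h2 hk
  have hts := summable_of_sum_le ht0 (h.sum_logDeriv_term_le h1 h2)
  have hlog : ∀ k, logDeriv (fun z => if k = n then 1 else factor a k z) x = (t k : ℂ) := by
    intro k
    by_cases hk : k = n
    · simp [ht, hk, logDeriv_apply]
    · simp only [ht, hk, if_false]
      rw [logDeriv_factor (hxa k) (hxb k hk)]
      push_cast
      rfl
  have hfun : prodExcept a n = fun z => ∏' k, if k = n then 1 else factor a k z := rfl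
  have key := logDeriv_tprod_eq_tsum
    ((h.isOpen_awayFrom n).inter (Metric.isOpen_ball (x := (0 : ℂ)) (ε := ‖(x : ℂ)‖ + 1)))
    (x := (x : ℂ)) ⟨hmem, by simp⟩ (f := fun k z => if k = n then 1 else factor a k z)
    (fun k => by
      split_ifs with hk
      · exact one_ne_zero
      · exact factor_ne_zero (hxa k) (hxb k hk))
    (fun k => differentiableOn_ite_factor n _ k)
    (by simp only [hlog]; exact_mod_cast hts)
    (h.multipliableLocallyUniformlyOn n _)
    (h.prodExcept_ne_zero hmem hxb)
  rw [hfun, key]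
  simp only [hlog]
  rw [← Complex.ofReal_tsum, Complex.norm_real, Real.norm_of_nonneg (tsum_nonneg ht0)]
  exact hts.tsum_le_of_sum_le (h.sum_logDeriv_term_le h1 h2)

theorem exists_hasDerivAt_fullProd (h : LogSpaced a δ C) {n : ℤ} {x : ℝ} (h1 : a n < x)
    (h2 : x < a (n + 1)) (h3 : x ≠ midpt a n) :
    ∃ L : ℂ, HasDerivAt (fullProd a) (fullProd a x * L) x ∧
      ‖L‖ ≤ 1 / |x - a n| + 1 / |x - midpt a n| + 1 / (a (n + 1) - x) + 2 / δ := by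
  have hxa : ∀ k, (x : ℂ) ≠ a k := fun k e => h.ne_of_mem_Ioo h1 h2 k (Complex.ofReal_injective e)
  have hxb : (x : ℂ) ≠ midpt a n := fun e => h3 (Complex.ofReal_injective e)
  have hmem : (x : ℂ) ∈ awayFrom a n := fun k _ => hxa k
  have hxb' : ∀ k, k ≠ n → (x : ℂ) ≠ midpt a k := by
    intro k hk e
    have e' := Complex.ofReal_injective e
    subst e'
    have h3 := h.strictMono.lt_iff_lt.1 (h1.trans (h.midpt_lt k))
    have h4 := h.strictMono.lt_iff_lt.1 ((h.lt_midpt k).trans h2)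
    omega
  have hQ0 := h.prodExcept_ne_zero hmem hxb'
  have hQ := (h.analyticAt_prodExcept hmem).differentiableAt.hasDerivAt
  have hQ' : deriv (prodExcept a n) x = prodExcept a n x * logDeriv (prodExcept a n) x := by
    rw [logDeriv_apply, mul_div_cancel₀ _ hQ0]
  have hm := (hasDerivAt_factor (hxa n) hxb).mul hQ
  refine ⟨(1 / ((a n : ℂ) - x) - 1 / ((midpt a n : ℂ) - x)) + logDeriv (prodExcept a n) x, ?_, ?_⟩
  · refine (hm.congr_of_eventuallyEq ?_).congr_deriv ?_
    · filter_upwards [(h.isOpen_awayFrom n).mem_nhds hmem] with w hw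
      exact h.fullProd_eq hw
    · rw [h.fullProd_eq hmem, hQ']; ring
  · have e1 : ‖1 / ((a n : ℂ) - x)‖ = 1 / |x - a n| := by
      rw [norm_div, norm_one, ← Complex.ofReal_sub, Complex.norm_real, Real.norm_eq_abs, abs_sub_comm]
    have e2 : ‖1 / ((midpt a n : ℂ) - x)‖ = 1 / |x - midpt a n| := by
      rw [norm_div, norm_one, ← Complex.ofReal_sub, Complex.norm_real, Real.norm_eq_abs, abs_sub_comm]
    refine (norm_add_le _ _).trans ?_
    have h4 := norm_sub_le (1 / ((a n : ℂ) - x)) (1 / ((midpt a n : ℂ) - x))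
    rw [e1, e2] at h4
    linarith [h.norm_logDeriv_prodExcept_le h1 h2]

end LogSpaced

/-! ### Boundedness of the derivative -/

theorem norm_add_one_sq_of_re_eq_zero {w : ℂ} (hw : w.re = 0) : ‖w + 1‖ ^ 2 = 1 + ‖w‖ ^ 2 := by
  rw [← Complex.normSq_eq_norm_sq, ← Complex.normSq_eq_norm_sq, Complex.normSq_apply,
    Complex.normSq_apply]
  simp [hw]

theorem two_mul_div_one_add_sq_le_one (G : ℝ) : 2 * G / (1 + G ^ 2) ≤ 1 := by
  rw [div_le_one (by positivity)]; nlinarith [sq_nonneg (G - 1)]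

theorem two_mul_div_one_add_sq_le {G : ℝ} (hG : 0 ≤ G) : 2 * G / (1 + G ^ 2) ≤ 2 * G :=
  div_le_self (by positivity) (by nlinarith)

/-- Since 2G/(1 + G²) ≤ 2/G, a lower bound for G r cancels the singularity 1/r. -/
theorem two_mul_div_mul_le {G m r : ℝ} (hG : 0 ≤ G) (hm : 0 < m) (hr : 0 < r) (h : m ≤ G * r) :
    2 * G / (1 + G ^ 2) * (1 / r) ≤ 2 / m := by
  rw [mul_one_div, div_div, div_le_div_iff₀ (by positivity) hm]
  nlinarith [mul_le_mul_of_nonneg_left h hG]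

namespace LogSpaced

variable {a : ℤ → ℝ} {δ C : ℝ}

theorem norm_kreinFun (a : ℤ → ℝ) (c : ℝ) (z : ℂ) :
    ‖kreinFun a c z‖ = Real.exp (-(Real.pi * c)) * ‖fullProd a z‖ := by
  unfold kreinFun
  rw [norm_mul, norm_mul, norm_neg, Complex.norm_I, Complex.norm_real,
    Real.norm_of_nonneg (Real.exp_pos _).le, one_mul]

theorem norm_deriv_innerFun_le (h : LogSpaced a δ C) (c : ℝ) {n : ℤ} {x : ℝ} (h1 : a n < x)
    (h2 : x < a (n + 1)) (h3 : x ≠ midpt a n) :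
    ‖deriv (innerFun a c) x‖ ≤ 2 * ‖kreinFun a c x‖ / (1 + ‖kreinFun a c x‖ ^ 2) *
      (1 / |x - a n| + 1 / |x - midpt a n| + 1 / (a (n + 1) - x) + 2 / δ) := by
  obtain ⟨L, hL, hLn⟩ := h.exists_hasDerivAt_fullProd h1 h2 h3
  have hxa : ∀ k, (x : ℂ) ≠ a k := fun k e => h.ne_of_mem_Ioo h1 h2 k (Complex.ofReal_injective e)
  have hF : HasDerivAt (kreinFun a c) (kreinFun a c x * L) x := by
    refine (hL.const_mul (-Complex.I * (Real.exp (-(Real.pi * c)) : ℝ))).congr_deriv ?_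
    unfold kreinFun
    ring
  have hre := h.kreinFun_ofReal_re c x
  have hne := add_one_ne_zero_of_re_nonneg hre.ge
  have hΘ : HasDerivAt (innerFun a c)
      (2 * (kreinFun a c x * L) / (kreinFun a c x + 1) ^ 2) x := by
    refine (((hF.sub_const 1).div (hF.add_const 1) hne).congr_of_eventuallyEq ?_).congr_deriv ?_
    · have hmem : (x : ℂ) ∈ awayFrom a n := fun k _ => hxa k
      filter_upwards [(h.isOpen_awayFrom n).mem_nhds hmem, isOpen_ne.mem_nhds (hxa n)] with w hw hwn
      unfold innerFun
      rw [if_neg]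
      · rfl
      · rintro ⟨k, hk⟩
        by_cases hkn : k = n
        · exact hwn (hkn ▸ hk)
        · exact hw k hkn hk
    · ring
  rw [hΘ.deriv, norm_div, norm_pow, norm_add_one_sq_of_re_eq_zero hre, norm_mul, norm_mul,
    Complex.norm_ofNat, ← mul_assoc, mul_div_right_comm]
  gcongr

theorem exists_norm_deriv_innerFun_le (h : LogSpaced a δ C) {Q : ℝ} (hQ0 : 0 ≤ Q)
    (hQ : ∀ᶠ n in cofinite, Real.exp 1 < gap a n ∧
      Real.log |a n| ≤ Q * gap a n * Real.log (Real.log (gap a n))) (c : ℝ) :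
    ∃ B : ℝ, ∀ᶠ n in cofinite, ∀ x : ℝ, a n < x → x < a (n + 1) → x ≠ midpt a n →
      ‖deriv (innerFun a c) x‖ ≤ B := by
  obtain ⟨c₁, hc1, hlow⟩ := h.exists_le_norm_fullProd_near
  obtain ⟨K, hK, hev⟩ := h.exists_norm_fullProd_near_midpt_le hQ0 hQ
  have hδ := h.pos
  set e := Real.exp (-(Real.pi * c)) with he
  have he0 : 0 < e := Real.exp_pos _
  have hm : 0 < e * √c₁ := mul_pos he0 (Real.sqrt_pos.2 hc1)
  -- The first term pays for a nearby pole, the second for a nearby zero; 14/δ is the sum of three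
  -- reciprocals of distances of at least δ/4 and the constant 2/δ.
  refine ⟨2 / (e * √c₁) + 2 * (e * √K) + 14 / δ, ?_⟩
  filter_upwards [hev] with n hn x h1 h2 h3
  refine (h.norm_deriv_innerFun_le c h1 h2 h3).trans ?_
  set G := ‖kreinFun a c x‖ with hG
  have hGe : G = e * ‖fullProd a x‖ := norm_kreinFun a c x
  have hG0 : 0 ≤ G := norm_nonneg _
  have ht1 := two_mul_div_one_add_sq_le_one G
  have ht2 := two_mul_div_one_add_sq_le hG0
  have ht0 : 0 ≤ 2 * G / (1 + G ^ 2) := by positivity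
  have hd := h.le_step n
  have e1 := midpt_eq_add_step a n
  have e2 : step a n = a (n + 1) - a n := rfl
  have hxn : 0 < x - a n := by linarith
  have hxn' : 0 < a (n + 1) - x := by linarith
  have hxb : 0 < |x - midpt a n| := abs_pos.2 (sub_ne_zero.2 h3)
  rw [abs_of_pos hxn]
  have hfar : ∀ {u : ℝ}, δ / 4 ≤ u → 1 / u ≤ 4 / δ := by
    intro u hu
    rw [div_le_div_iff₀ (by linarith) hδ]
    linarith
  have hp1 : 0 < 2 / (e * √c₁) := by positivity
  have hp2 : 0 ≤ 2 * (e * √K) := by positivity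
  have hcl : ∀ m : ℤ, x ≠ a m → |x - a m| ≤ δ / 4 → e * √c₁ ≤ G * |x - a m| := by
    intro m hxm hnear
    have h5 := Real.sqrt_le_sqrt (hlow m x hxm hnear)
    rw [← mul_pow, Real.sqrt_sq_eq_abs, abs_mul, abs_of_nonneg (norm_nonneg _)] at h5
    rw [hGe, mul_assoc]
    gcongr
  have e4 : ∀ y : ℝ, y / δ = y * (1 / δ) := fun y => by ring
  have hδ1 : 0 < 1 / δ := by positivity
  have htail : ∀ {y : ℝ}, 0 ≤ y → 2 * G / (1 + G ^ 2) * y ≤ y := fun hy =>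
    mul_le_of_le_one_left hy ht1
  set T := 2 * G / (1 + G ^ 2) with hT
  rw [e4 14, e4 2]
  rcases le_total (x - a n) (δ / 4) with hA | hA
  · have k1 := two_mul_div_mul_le hG0 hm hxn
      (by
        have := hcl n h1.ne' (by rw [abs_of_pos hxn]; exact hA)
        rwa [abs_of_pos hxn] at this)
    have k2 : 1 / |x - midpt a n| ≤ 4 / δ :=
      hfar (by rw [abs_of_neg (by linarith)]; linarith)
    have k3 : 1 / (a (n + 1) - x) ≤ 4 / δ := hfar (by linarith)
    have k4 := htail (y := 1 / |x - midpt a n| + 1 / (a (n + 1) - x) + 2 / δ) (by positivity)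
    rw [← hT] at k1
    rw [e4] at k2 k3 k4
    linarith
  rcases le_total (a (n + 1) - x) (δ / 4) with hB | hB
  · have k1 := two_mul_div_mul_le hG0 hm hxn'
      (by
        have := hcl (n + 1) h2.ne (by rw [abs_sub_comm, abs_of_pos hxn']; exact hB)
        rwa [abs_sub_comm, abs_of_pos hxn'] at this)
    have k2 : 1 / |x - midpt a n| ≤ 4 / δ :=
      hfar (by rw [abs_of_pos (by linarith)]; linarith)
    have k3 : 1 / (x - a n) ≤ 4 / δ := hfar hA
    have k4 := htail (y := 1 / (x - a n) + 1 / |x - midpt a n| + 2 / δ) (by positivity)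
    rw [← hT] at k1
    rw [e4] at k2 k3 k4
    linarith
  have k2 : 1 / (x - a n) ≤ 4 / δ := hfar hA
  have k3 : 1 / (a (n + 1) - x) ≤ 4 / δ := hfar hB
  rcases le_total |x - midpt a n| (δ / 4) with hM | hM
  · have h5 := Real.sqrt_le_sqrt (hn x hM)
    rw [Real.sqrt_sq (norm_nonneg _), Real.sqrt_mul hK.le, Real.sqrt_sq_eq_abs] at h5
    have h6 : G ≤ e * √K * |x - midpt a n| := by
      rw [hGe, mul_assoc]; gcongr
    have k1 : 2 * G / (1 + G ^ 2) * (1 / |x - midpt a n|) ≤ 2 * (e * √K) := by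
      rw [mul_one_div, div_le_iff₀ hxb]
      linarith
    have k4 := htail (y := 1 / (x - a n) + 1 / (a (n + 1) - x) + 2 / δ) (by positivity)
    rw [← hT] at k1
    rw [e4] at k2 k3 k4
    linarith
  · have k1 : 1 / |x - midpt a n| ≤ 4 / δ := hfar hM
    have k4 := htail (y := 1 / (x - a n) + 1 / |x - midpt a n| + 1 / (a (n + 1) - x) + 2 / δ)
      (by positivity)
    rw [e4] at k1 k2 k3 k4
    linarith

/-- The finitely many exceptional intervals are compact and Θ' is continuous on the line; in the
other intervals continuity supplies the ends and the midpoint. -/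
theorem exists_norm_deriv_innerFun_le_all (h : LogSpaced a δ C) {Q : ℝ} (hQ0 : 0 ≤ Q)
    (hQ : ∀ᶠ n in cofinite, Real.exp 1 < gap a n ∧
      Real.log |a n| ≤ Q * gap a n * Real.log (Real.log (gap a n))) (c : ℝ) :
    ∃ B : ℝ, ∀ x : ℝ, ‖deriv (innerFun a c) x‖ ≤ B := by
  have hcont : Continuous fun x : ℝ => ‖deriv (innerFun a c) x‖ := by
    refine continuous_iff_continuousAt.2 fun x => ContinuousAt.norm ?_
    exact ContinuousAt.comp (f := fun x : ℝ => (x : ℂ))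
      (h.analyticAt_innerFun c (by simp)).deriv.continuousAt Complex.continuous_ofReal.continuousAt
  obtain ⟨B, hB⟩ := h.exists_norm_deriv_innerFun_le hQ0 hQ c
  rw [eventually_cofinite] at hB
  have hloc : ∀ n : ℤ, ∃ D : ℝ, ∀ x ∈ Set.Icc (a n) (a (n + 1)),
      ‖deriv (innerFun a c) x‖ ≤ D := by
    intro n
    obtain ⟨D, hD⟩ := isCompact_Icc.bddAbove_image (f := fun x : ℝ => ‖deriv (innerFun a c) x‖)
      (K := Set.Icc (a n) (a (n + 1))) hcont.continuousOn
    exact ⟨D, fun x hx => hD (Set.mem_image_of_mem _ hx)⟩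
  choose D hD using hloc
  refine ⟨|B| + ∑ n ∈ hB.toFinset, |D n|, fun x => ?_⟩
  obtain ⟨n, hn1, hn2⟩ := h.exists_mem_Ico x
  have hsum : 0 ≤ ∑ n ∈ hB.toFinset, |D n| := Finset.sum_nonneg fun _ _ => abs_nonneg _
  by_cases hn : n ∈ hB.toFinset
  · have h1 := hD n x ⟨hn1, hn2.le⟩
    have h2 := Finset.single_le_sum (f := fun n => |D n|) (fun _ _ => abs_nonneg _) hn
    have h3 := abs_nonneg B
    have h4 := le_abs_self (D n)
    linarith
  · have hgood : ∀ x : ℝ, a n < x → x < a (n + 1) → x ≠ midpt a n →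
        ‖deriv (innerFun a c) x‖ ≤ B := by
      by_contra hcon
      exact hn (hB.mem_toFinset.2 hcon)
    have hcl : IsClosed {x : ℝ | ‖deriv (innerFun a c) x‖ ≤ B} := isClosed_le hcont continuous_const
    have hs1 : Set.Icc (a n) (midpt a n) ⊆ {x : ℝ | ‖deriv (innerFun a c) x‖ ≤ B} := by
      rw [← closure_Ioo (h.lt_midpt n).ne]
      exact hcl.closure_subset_iff.2 fun y hy =>
        hgood y hy.1 (hy.2.trans (h.midpt_lt n)) hy.2.ne
    have hs2 : Set.Icc (midpt a n) (a (n + 1)) ⊆ {x : ℝ | ‖deriv (innerFun a c) x‖ ≤ B} := by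
      rw [← closure_Ioo (h.midpt_lt n).ne]
      exact hcl.closure_subset_iff.2 fun y hy =>
        hgood y ((h.lt_midpt n).trans hy.1) hy.2 hy.1.ne'
    have : ‖deriv (innerFun a c) x‖ ≤ B := by
      rcases le_total x (midpt a n) with hx | hx
      · exact hs1 ⟨hn1, hx⟩
      · exact hs2 ⟨hx, hn2.le⟩
    linarith [le_abs_self B]

end LogSpaced

/-! ### The Clark measures -/

theorem prod_factor (a : ℤ → ℝ) (s : Finset ℤ) (z : ℂ) :
    ∏ k ∈ s, factor a k z =
      ((∏ k ∈ s, normRatio a k : ℝ) : ℂ) * ∏ k ∈ s, ((midpt a k : ℂ) - z) / ((a k : ℂ) - z) := by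
  unfold factor
  rw [Finset.prod_mul_distrib, Complex.ofReal_prod, mul_comm]

theorem prod_normRatio_pos (a : ℤ → ℝ) (s : Finset ℤ) : 0 < ∏ k ∈ s, normRatio a k :=
  Finset.prod_pos fun k _ => normRatio_pos a k

theorem prod_normRatio_mul_residue (a : ℤ → ℝ) {s : Finset ℤ} {n : ℤ} (hn : n ∈ s) :
    (∏ k ∈ s, normRatio a k) * residue s a (midpt a) n = normRatio a n * (midpt a n - a n) *
      ∏ j ∈ s.erase n, (midpt a j - a n) / (a j - a n) * normRatio a j := by
  rw [← Finset.mul_prod_erase s _ hn, Finset.prod_mul_distrib]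
  unfold residue
  ring

theorem inv_prod_normRatio_mul_residue (a : ℤ → ℝ) {s : Finset ℤ} {n : ℤ} (hn : n ∈ s) :
    -(∏ k ∈ s, normRatio a k)⁻¹ * residue s (midpt a) a n =
      (normRatio a n)⁻¹ * (midpt a n - a n) *
        (∏ j ∈ s.erase n, (midpt a j - midpt a n) / (a j - midpt a n) * normRatio a j)⁻¹ := by
  have e : ∏ j ∈ s.erase n, (a j - midpt a n) / (midpt a j - midpt a n) =
      (∏ j ∈ s.erase n, (midpt a j - midpt a n) / (a j - midpt a n))⁻¹ := by
    rw [← Finset.prod_inv_distrib]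
    simp only [inv_div]
  unfold residue
  rw [← Finset.mul_prod_erase s _ hn, Finset.prod_mul_distrib, mul_inv, mul_inv, e]
  ring

namespace LogSpaced

variable {a : ℤ → ℝ} {δ C : ℝ}

theorem ofReal_midpt_mem_awayFrom (h : LogSpaced a δ C) (n : ℤ) : (midpt a n : ℂ) ∈ awayFrom a n :=
  fun k _ => h.midpt_ne n k

theorem tendsto_prod_erase (h : LogSpaced a δ C) {n : ℤ} {x : ℝ} (hx : (x : ℂ) ∈ awayFrom a n) :
    Tendsto (fun s : Finset ℤ => ∏ j ∈ s.erase n, (midpt a j - x) / (a j - x) * normRatio a j)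
      atTop (nhds (prodExcept a n x).re) := by
  have h1 := (Complex.continuous_re.tendsto _).comp (h.hasProd_prodExcept hx)
  refine h1.congr fun s => ?_
  rw [Function.comp_apply, ← Finset.prod_erase s (a := n) (f := fun k => if k = n then 1 else factor a k x)
      (if_pos rfl), ← Complex.ofReal_re
    (∏ j ∈ s.erase n, (midpt a j - x) / (a j - x) * normRatio a j), Complex.ofReal_prod]
  congr 1
  refine Finset.prod_congr rfl fun k hk => ?_
  rw [if_neg (Finset.ne_of_mem_erase hk), factor_conj]

theorem ratio_self_pos (h : LogSpaced a δ C) {j n : ℤ} (hj : j ≠ n) :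
    0 < (midpt a j - a n) / (a j - a n) := by
  have h1 := h.lt_midpt j
  rcases lt_or_gt_of_ne hj with hlt | hlt
  · have h3 := h.strictMono.monotone (show j + 1 ≤ n by omega)
    have h4 := h.midpt_lt j
    exact div_pos_of_neg_of_neg (by linarith) (by linarith)
  · have h3 := h.strictMono hlt
    exact div_pos (by linarith) (by linarith)

theorem ratio_midpt_pos (h : LogSpaced a δ C) {j n : ℤ} (hj : j ≠ n) :
    0 < (midpt a j - midpt a n) / (a j - midpt a n) := by
  have h1 := h.lt_midpt j
  have h2 := h.lt_midpt n
  have h3 := h.midpt_lt n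
  rcases lt_or_gt_of_ne hj with hlt | hlt
  · have h4 := h.midpt_strictMono hlt
    exact div_pos_of_neg_of_neg (by linarith) (by linarith)
  · have h4 := h.strictMono.monotone (show n + 1 ≤ j by omega)
    exact div_pos (by linarith) (by linarith)

theorem residue_self_nonneg (h : LogSpaced a δ C) (s : Finset ℤ) (n : ℤ) :
    0 ≤ residue s a (midpt a) n :=
  mul_nonneg (sub_nonneg.2 (h.lt_midpt n).le)
    (Finset.prod_nonneg fun _ hj => (h.ratio_self_pos (Finset.ne_of_mem_erase hj)).le)

theorem residue_midpt_nonpos (h : LogSpaced a δ C) (s : Finset ℤ) (n : ℤ) :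
    residue s (midpt a) a n ≤ 0 :=
  mul_nonpos_of_nonpos_of_nonneg (sub_nonpos.2 (h.lt_midpt n).le)
    (Finset.prod_nonneg fun j hj => by
      rw [← inv_div]
      exact (inv_pos.2 (h.ratio_midpt_pos (Finset.ne_of_mem_erase hj))).le)

/-- A limit of positive products is nonnegative, and the infinite product does not vanish. -/
theorem prodExcept_re_pos (h : LogSpaced a δ C) {n : ℤ} {x : ℝ} (hx : (x : ℂ) ∈ awayFrom a n)
    (hb : ∀ k, k ≠ n → (x : ℂ) ≠ midpt a k)
    (hpos : ∀ j, j ≠ n → 0 < (midpt a j - x) / (a j - x)) : 0 < (prodExcept a n x).re := by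
  refine lt_of_le_of_ne (ge_of_tendsto' (h.tendsto_prod_erase hx) fun s =>
    Finset.prod_nonneg fun j hj =>
      (mul_pos (hpos j (Finset.ne_of_mem_erase hj)) (normRatio_pos a j)).le) fun e => ?_
  exact h.prodExcept_ne_zero hx hb (Complex.ext e.symm (h.prodExcept_im hx))

theorem prodExcept_self_re_pos (h : LogSpaced a δ C) (n : ℤ) : 0 < (prodExcept a n (a n)).re :=
  h.prodExcept_re_pos (h.ofReal_mem_awayFrom n) (fun k _ => (h.midpt_ne k n).symm)
    fun _ hj => h.ratio_self_pos hj

theorem prodExcept_midpt_re_pos (h : LogSpaced a δ C) (n : ℤ) :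
    0 < (prodExcept a n (midpt a n)).re :=
  h.prodExcept_re_pos (h.ofReal_midpt_mem_awayFrom n)
    (fun _ hk e => hk (h.midpt_strictMono.injective (Complex.ofReal_injective e)).symm)
    fun _ hj => h.ratio_midpt_pos hj

theorem eventually_mem_Ico (n : ℤ) : ∀ᶠ N : ℕ in atTop, n ∈ Finset.Ico (-N : ℤ) N :=
  ((Finset.tendsto_Ico_neg (R := ℤ)).eventually (eventually_ge_atTop {n})).mono
    fun _ hN => hN (Finset.mem_singleton_self n)

end LogSpaced

/-- The mass at `a n` of the Clark measure of `innerFun a c` at `1`. -/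
noncomputable def clarkMass (a : ℤ → ℝ) (c : ℝ) (n : ℤ) : ℝ :=
  Real.pi * (Real.exp (-(Real.pi * c)) *
    (normRatio a n * (midpt a n - a n) * (prodExcept a n (a n)).re))

/-- The mass at `b n` of the Clark measure of `innerFun a c` at `-1`. -/
noncomputable def clarkMassNeg (a : ℤ → ℝ) (c : ℝ) (n : ℤ) : ℝ :=
  Real.pi * ((Real.exp (-(Real.pi * c)))⁻¹ *
    ((normRatio a n)⁻¹ * (midpt a n - a n) * (prodExcept a n (midpt a n)).re⁻¹))

namespace LogSpaced

variable {a : ℤ → ℝ} {δ C : ℝ}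

theorem clarkMass_pos (h : LogSpaced a δ C) (c : ℝ) (n : ℤ) : 0 < clarkMass a c n :=
  mul_pos Real.pi_pos (mul_pos (Real.exp_pos _) (mul_pos (mul_pos (normRatio_pos a n)
    (sub_pos.2 (h.lt_midpt n))) (h.prodExcept_self_re_pos n)))

theorem clarkMassNeg_pos (h : LogSpaced a δ C) (c : ℝ) (n : ℤ) : 0 < clarkMassNeg a c n :=
  mul_pos Real.pi_pos (mul_pos (inv_pos.2 (Real.exp_pos _)) (mul_pos (mul_pos
    (inv_pos.2 (normRatio_pos a n)) (sub_pos.2 (h.lt_midpt n)))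
    (inv_pos.2 (h.prodExcept_midpt_re_pos n))))

theorem exists_cauchyMeasure_eq_kreinFun (h : LogSpaced a δ C) (c : ℝ) :
    Integrable (fun t : ℝ => 1 / (1 + t ^ 2)) (pointMasses a (clarkMass a c)) ∧
      ∃ D : ℝ, ∀ z : ℂ, 0 < z.im →
        kreinFun a c z = cauchyMeasure (pointMasses a (clarkMass a c)) z + Complex.I * (D : ℂ) := by
  obtain ⟨K, -, hK⟩ := h.exists_norm_prod_factor_mul_I_bounds
  set e := Real.exp (-(Real.pi * c)) with he
  have he0 : 0 < e := Real.exp_pos _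
  have hrep : ∀ N : ℕ, ∃ d : ℝ, ∀ z : ℂ, 0 < z.im →
      -Complex.I * e * ∏ k ∈ Finset.Ico (-N : ℤ) N, factor a k z =
        1 / ((Real.pi : ℂ) * Complex.I) * ∑ n ∈ Finset.Ico (-N : ℤ) N,
          ((Real.pi * (e * ∏ k ∈ Finset.Ico (-N : ℤ) N, normRatio a k) *
            residue (Finset.Ico (-N : ℤ) N) a (midpt a) n : ℝ) : ℂ) * cauchyKernel z (a n) +
          Complex.I * (d : ℂ) := by
    refine fun N => ⟨_, fun z hz =>
      Eq.trans ?_ (neg_I_mul_prod_eq h.strictMono.injective _ _ hz)⟩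
    rw [prod_factor]
    push_cast
    ring
  choose d hd using hrep
  refine exists_cauchyMeasure_eq_of_tendsto h.tendsto_abs
    (G := fun N z => -Complex.I * e * ∏ k ∈ Finset.Ico (-N : ℤ) N, factor a k z)
    (w := fun N n => Real.pi * (e * ∏ k ∈ Finset.Ico (-N : ℤ) N, normRatio a k) *
      residue (Finset.Ico (-N : ℤ) N) a (midpt a) n)
    (s := fun N => Finset.Ico (-N : ℤ) N) (K := e ^ 2 * K) (fun N n => ?_) (fun n => ?_)
    (fun z _ => (h.tendsto_prod_factor z).const_mul _) hd
    Finset.tendsto_Ico_neg (fun N R hR => ?_)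
  · have := prod_normRatio_pos a (Finset.Ico (-N : ℤ) N)
    have := h.residue_self_nonneg (Finset.Ico (-N : ℤ) N) n
    have := Real.pi_pos
    positivity
  · refine (((((h.tendsto_prod_erase (h.ofReal_mem_awayFrom n)).comp
      Finset.tendsto_Ico_neg).const_mul _).const_mul e).const_mul Real.pi).congr' ?_
    filter_upwards [eventually_mem_Ico n] with N hN
    rw [Function.comp_apply, ← prod_normRatio_mul_residue a hN]
    ring
  · rw [norm_mul, norm_mul, norm_neg, Complex.norm_I, one_mul, Complex.norm_real,
      Real.norm_of_nonneg he0.le, mul_pow, mul_assoc]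
    gcongr
    exact (hK R hR N).2

/-- Reciprocals exchange the roles of zeros and poles. The residues become nonpositive, and (-i)⁻¹ =
-i · (-1) makes the constant negative too, so the masses are again nonnegative. The bound at iR is
now the lower bound for the products. -/
theorem exists_cauchyMeasure_eq_inv_kreinFun (h : LogSpaced a δ C) (c : ℝ) :
    Integrable (fun t : ℝ => 1 / (1 + t ^ 2)) (pointMasses (midpt a) (clarkMassNeg a c)) ∧
      ∃ D : ℝ, ∀ z : ℂ, 0 < z.im → (kreinFun a c z)⁻¹ =
        cauchyMeasure (pointMasses (midpt a) (clarkMassNeg a c)) z + Complex.I * (D : ℂ) := by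
  obtain ⟨K, hK1, hK⟩ := h.exists_norm_prod_factor_mul_I_bounds
  set e := Real.exp (-(Real.pi * c)) with he
  have he0 : 0 < e := Real.exp_pos _
  have hrep : ∀ N : ℕ, ∃ d : ℝ, ∀ z : ℂ, 0 < z.im →
      (-Complex.I * e * ∏ k ∈ Finset.Ico (-N : ℤ) N, factor a k z)⁻¹ =
        1 / ((Real.pi : ℂ) * Complex.I) * ∑ n ∈ Finset.Ico (-N : ℤ) N,
          ((Real.pi * (-(e⁻¹ * (∏ k ∈ Finset.Ico (-N : ℤ) N, normRatio a k)⁻¹)) *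
            residue (Finset.Ico (-N : ℤ) N) (midpt a) a n : ℝ) : ℂ) *
              cauchyKernel z (midpt a n) + Complex.I * (d : ℂ) := by
    refine fun N => ⟨_, fun z hz =>
      Eq.trans ?_ (neg_I_mul_prod_eq h.midpt_strictMono.injective _ _ hz)⟩
    have e1 : ∏ k ∈ Finset.Ico (-N : ℤ) N, ((a k : ℂ) - z) / ((midpt a k : ℂ) - z) =
        (∏ k ∈ Finset.Ico (-N : ℤ) N, ((midpt a k : ℂ) - z) / ((a k : ℂ) - z))⁻¹ := by
      rw [← Finset.prod_inv_distrib]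
      simp only [inv_div]
    rw [prod_factor, e1, mul_inv,
      mul_inv, mul_inv, inv_neg, Complex.inv_I]
    push_cast
    ring
  choose d hd using hrep
  refine exists_cauchyMeasure_eq_of_tendsto h.tendsto_abs_midpt
    (G := fun N z => (-Complex.I * e * ∏ k ∈ Finset.Ico (-N : ℤ) N, factor a k z)⁻¹)
    (w := fun N n => Real.pi * (-(e⁻¹ * (∏ k ∈ Finset.Ico (-N : ℤ) N, normRatio a k)⁻¹)) *
      residue (Finset.Ico (-N : ℤ) N) (midpt a) a n)
    (s := fun N => Finset.Ico (-N : ℤ) N) (K := (e⁻¹) ^ 2 * K) (fun N n => ?_) (fun n => ?_)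
    (fun z hz => ((h.tendsto_prod_factor z).const_mul _).inv₀ (h.kreinFun_ne_zero c hz))
    hd Finset.tendsto_Ico_neg (fun N R hR => ?_)
  · have h1 := prod_normRatio_pos a (Finset.Ico (-N : ℤ) N)
    have h2 := h.residue_midpt_nonpos (Finset.Ico (-N : ℤ) N) n
    refine mul_nonneg_of_nonpos_of_nonpos (mul_nonpos_of_nonneg_of_nonpos Real.pi_pos.le ?_) h2
    exact neg_nonpos.2 (by positivity)
  · refine ((((((h.tendsto_prod_erase (h.ofReal_midpt_mem_awayFrom n)).comp
      Finset.tendsto_Ico_neg).inv₀ (h.prodExcept_midpt_re_pos n).ne').const_mul _).const_mul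
        e⁻¹).const_mul Real.pi).congr' ?_
    filter_upwards [eventually_mem_Ico n] with N hN
    rw [Function.comp_apply, ← inv_prod_normRatio_mul_residue a hN]
    ring
  · have hR0 : 0 < K * R := by positivity
    have h1 := inv_anti₀ (inv_pos.2 hR0) (hK R hR N).1
    rw [inv_inv] at h1
    rw [norm_inv, norm_mul, norm_mul, norm_neg, Complex.norm_I, one_mul, Complex.norm_real,
      Real.norm_of_nonneg he0.le, mul_inv, mul_pow, mul_assoc, inv_pow ‖_‖]
    gcongr

theorem isClarkMeasure_one (h : LogSpaced a δ C) (c : ℝ) :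
    IsClarkMeasure (innerFun a c) 1 (pointMasses a (clarkMass a c)) := by
  obtain ⟨h1, D, hD⟩ := h.exists_cauchyMeasure_eq_kreinFun c
  exact ⟨h1, D, fun z hz => by rw [h.one_add_div_one_sub c hz, hD z hz]⟩

theorem isClarkMeasure_neg_one (h : LogSpaced a δ C) (c : ℝ) :
    IsClarkMeasure (innerFun a c) (-1) (pointMasses (midpt a) (clarkMassNeg a c)) := by
  obtain ⟨h1, D, hD⟩ := h.exists_cauchyMeasure_eq_inv_kreinFun c
  refine ⟨h1, D, fun z hz => ?_⟩
  rw [← hD z hz, ← h.one_add_div_one_sub c hz, inv_div, ← neg_div_neg_eq]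
  ring

theorem krein_shift_formula (h : LogSpaced a δ C) (c : ℝ) {z : ℂ} (hz : 0 < z.im) :
    1 / ((Real.pi : ℂ) * Complex.I) *
        Complex.log ((1 + innerFun a c z) / (1 - innerFun a c z)) =
      cauchyFun (shiftFun a) z + Complex.I * (c : ℂ) := by
  have hpi := Complex.ofReal_ne_zero.2 Real.pi_ne_zero
  rw [h.one_add_div_one_sub c hz, h.log_kreinFun c hz]
  unfold cauchyFun
  rw [mul_sub, sub_eq_add_neg, add_right_inj]
  push_cast
  rw [one_div, mul_inv, Complex.inv_I]
  field_simp

/-! ### Bounds for the point masses -/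

/-- Away from the poles, the product is its local part times the rest. -/
theorem norm_fullProd_mul_abs (h : LogSpaced a δ C) {n : ℤ} {x : ℝ} (hx : (x : ℂ) ∈ awayFrom a n)
    (hn : x ≠ a n) : ‖fullProd a x‖ * |x - a n| =
      normRatio a n * |midpt a n - x| * ‖prodExcept a n x‖ := by
  have h1 : |a n - x| ≠ 0 := abs_ne_zero.2 (sub_ne_zero.2 hn.symm)
  rw [h.fullProd_eq hx, factor_conj, norm_mul, Complex.norm_real, Real.norm_eq_abs, abs_mul,
    abs_div, abs_of_pos (normRatio_pos a n), abs_sub_comm x]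
  field_simp

theorem continuousAt_norm_prodExcept (h : LogSpaced a δ C) {n : ℤ} {x : ℝ}
    (hx : (x : ℂ) ∈ awayFrom a n) : ContinuousAt (fun x : ℝ => ‖prodExcept a n x‖) x :=
  (ContinuousAt.comp (f := fun x : ℝ => (x : ℂ)) (h.analyticAt_prodExcept hx).continuousAt
    Complex.continuous_ofReal.continuousAt).norm

theorem norm_prodExcept_eq_re (h : LogSpaced a δ C) {n : ℤ} {x : ℝ} (hx : (x : ℂ) ∈ awayFrom a n)
    (hre : 0 ≤ (prodExcept a n x).re) : ‖prodExcept a n x‖ = (prodExcept a n x).re := by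
  conv_lhs => rw [show prodExcept a n x = (((prodExcept a n x).re : ℝ) : ℂ) from
    Complex.ext rfl (h.prodExcept_im hx)]
  rw [Complex.norm_real, Real.norm_of_nonneg hre]

/-- The mass is π e^{-πc} times the limit of |fullProd x||x - a n| at `a n`, so the estimate near
the pole passes to the limit. -/
theorem exists_clarkMass_le (h : LogSpaced a δ C) {Q : ℝ} (hQ0 : 0 ≤ Q)
    (hQ : ∀ᶠ n in cofinite, Real.exp 1 < gap a n ∧
      Real.log |a n| ≤ Q * gap a n * Real.log (Real.log (gap a n))) (c : ℝ) :
    ∃ B : ℝ, 0 ≤ B ∧ ∀ᶠ n in cofinite,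
      clarkMass a c n ≤ B * (gap a n * Real.log (gap a n)) := by
  obtain ⟨K, hK, hev⟩ := h.exists_norm_fullProd_near_le hQ0 hQ
  have hpi := Real.pi_pos
  have hδ := h.pos
  refine ⟨Real.pi * (Real.exp (-(Real.pi * c)) * √K), by positivity, ?_⟩
  filter_upwards [hev, hQ] with n hn hg
  have hg1 : 1 ≤ gap a n := (Real.one_le_exp zero_le_one).trans hg.1.le
  have hL : 0 ≤ gap a n * Real.log (gap a n) :=
    mul_nonneg (by linarith) (Real.log_nonneg hg1)
  have hmem := h.ofReal_mem_awayFrom n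
  have hlim : Tendsto (fun x : ℝ => normRatio a n * |midpt a n - x| * ‖prodExcept a n x‖)
      (nhdsWithin (a n) {a n}ᶜ)
      (nhds (normRatio a n * |midpt a n - a n| * ‖prodExcept a n (a n)‖)) := by
    refine Tendsto.mono_left ?_ nhdsWithin_le_nhds
    refine Tendsto.mul ?_ (h.continuousAt_norm_prodExcept hmem)
    exact Continuous.tendsto (by fun_prop) _
  have hle : normRatio a n * |midpt a n - a n| * ‖prodExcept a n (a n)‖ ≤
      √K * (gap a n * Real.log (gap a n)) := by
    refine le_of_tendsto hlim ?_
    have e1 : ∀ᶠ x : ℝ in nhds (a n), |x - a n| ≤ δ / 4 :=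
      (Metric.closedBall_mem_nhds (a n) (by positivity : 0 < δ / 4))
    have e2 : ∀ᶠ x : ℝ in nhds (a n), (x : ℂ) ∈ awayFrom a n :=
      Complex.continuous_ofReal.continuousAt.eventually ((h.isOpen_awayFrom n).mem_nhds hmem)
    filter_upwards [e1.filter_mono nhdsWithin_le_nhds, e2.filter_mono nhdsWithin_le_nhds,
      self_mem_nhdsWithin] with x h1 h2 h3
    rw [← h.norm_fullProd_mul_abs h2 h3]
    have h5 := Real.sqrt_le_sqrt (hn x h3 h1)
    rwa [← sq_abs (x - a n), ← mul_pow, Real.sqrt_sq (by positivity), Real.sqrt_mul hK.le,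
      Real.sqrt_sq hL] at h5
  rw [abs_of_pos (sub_pos.2 (h.lt_midpt n)),
    h.norm_prodExcept_eq_re hmem (h.prodExcept_self_re_pos n).le] at hle
  unfold clarkMass
  rw [mul_assoc Real.pi, mul_assoc (Real.exp _)]
  gcongr

/-- The mass is π e^{πc} times the limit of |x - b n|/|fullProd x|. The general lower bound makes it
O(step); a gap above e has logarithm at least 1, so the required bound is weaker. -/
theorem exists_clarkMassNeg_le (h : LogSpaced a δ C)
    (hg : ∀ᶠ n in cofinite, Real.exp 1 < gap a n) (c : ℝ) :
    ∃ B : ℝ, 0 ≤ B ∧ ∀ᶠ n in cofinite,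
      clarkMassNeg a c n ≤ B * (gap a n * Real.log (gap a n)) := by
  obtain ⟨c₁, hc1, hlow⟩ := h.exists_le_norm_fullProd
  have hpi := Real.pi_pos
  have hC := h.one_le
  refine ⟨Real.pi * ((Real.exp (-(Real.pi * c)))⁻¹ * ((√c₁)⁻¹ * C)), by positivity, ?_⟩
  filter_upwards [hg] with n hgn
  have hg1 : 0 < gap a n := (Real.exp_pos 1).trans hgn
  have hL : 1 ≤ Real.log (gap a n) := (Real.le_log_iff_exp_le hg1).2 hgn.le
  have hmem := h.ofReal_midpt_mem_awayFrom n
  have hd := h.step_pos n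
  have hlim : Tendsto (fun x : ℝ => normRatio a n * ‖prodExcept a n x‖ * step a n)
      (nhdsWithin (midpt a n) {midpt a n}ᶜ)
      (nhds (normRatio a n * ‖prodExcept a n (midpt a n)‖ * step a n)) :=
    ((((h.continuousAt_norm_prodExcept hmem).tendsto).const_mul _).mul_const _).mono_left
      nhdsWithin_le_nhds
  have hlim2 : Tendsto (fun x : ℝ => √c₁ * |x - a n|) (nhdsWithin (midpt a n) {midpt a n}ᶜ)
      (nhds (√c₁ * |midpt a n - a n|)) :=
    (Continuous.tendsto (by fun_prop) _).mono_left nhdsWithin_le_nhds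
  have hle : √c₁ * |midpt a n - a n| ≤
      normRatio a n * ‖prodExcept a n (midpt a n)‖ * step a n := by
    refine le_of_tendsto_of_tendsto hlim2 hlim ?_
    have e1 : ∀ᶠ x : ℝ in nhds (midpt a n), x ∈ Set.Ioo (a n) (a (n + 1)) :=
      Ioo_mem_nhds (h.lt_midpt n) (h.midpt_lt n)
    filter_upwards [e1.filter_mono nhdsWithin_le_nhds, self_mem_nhdsWithin] with x h1 h3
    have h2 : (x : ℂ) ∈ awayFrom a n := fun k _ e =>
      h.ne_of_mem_Ioo h1.1 h1.2 k (Complex.ofReal_injective e)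
    have hb : 0 < |midpt a n - x| := abs_pos.2 (sub_ne_zero.2 (Ne.symm h3))
    have h5 := Real.sqrt_le_sqrt (hlow n x h1.1 h1.2)
    rw [← mul_pow, Real.sqrt_sq (by positivity), Real.sqrt_mul hc1.le, Real.sqrt_sq_eq_abs] at h5
    have h6 := mul_le_mul_of_nonneg_right h5 (abs_nonneg (x - a n))
    rw [mul_right_comm ‖_‖, h.norm_fullProd_mul_abs h2 h1.1.ne'] at h6
    refine le_of_mul_le_mul_right ?_ hb
    linarith
  rw [abs_of_pos (sub_pos.2 (h.lt_midpt n)),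
    h.norm_prodExcept_eq_re hmem (h.prodExcept_midpt_re_pos n).le] at hle
  have hν := normRatio_pos a n
  have hP := h.prodExcept_midpt_re_pos n
  have hsc : 0 < √c₁ := Real.sqrt_pos.2 hc1
  have h7 : (normRatio a n)⁻¹ * (midpt a n - a n) * (prodExcept a n (midpt a n)).re⁻¹ ≤
      (√c₁)⁻¹ * step a n := by
    have : (normRatio a n)⁻¹ * (midpt a n - a n) * (prodExcept a n (midpt a n)).re⁻¹ =
        (√c₁ * (midpt a n - a n)) / (normRatio a n * (prodExcept a n (midpt a n)).re * √c₁) := by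
      field_simp
    rw [this, inv_mul_eq_div, div_le_div_iff₀ (by positivity) hsc]
    nlinarith
  have h8 : step a n ≤ C * (gap a n * Real.log (gap a n)) :=
    ((h.gap_bounds n).2.1).trans (by gcongr; exact le_mul_of_one_le_right hg1.le hL)
  unfold clarkMassNeg
  rw [mul_assoc Real.pi, mul_assoc (Real.exp _)⁻¹, mul_assoc (√c₁)⁻¹]
  have h9 := h7.trans (mul_le_mul_of_nonneg_left h8 (inv_pos.2 hsc).le)
  gcongr

end LogSpaced

/-! ### From asymptotic hypotheses to uniform constants -/

theorem exists_forall_le_mul_of_eventually {f g : ℤ → ℝ} {c : ℝ} (hg : ∀ n, 0 < g n)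
    (h : ∀ᶠ n in cofinite, f n ≤ c * g n) : ∃ C : ℝ, 1 ≤ C ∧ ∀ n, f n ≤ C * g n := by
  rw [eventually_cofinite] at h
  have hsum : 0 ≤ ∑ n ∈ h.toFinset, |f n| / g n :=
    Finset.sum_nonneg fun n _ => div_nonneg (abs_nonneg _) (hg n).le
  refine ⟨1 + |c| + ∑ n ∈ h.toFinset, |f n| / g n, by linarith [abs_nonneg c], fun n => ?_⟩
  by_cases hn : n ∈ h.toFinset
  · have h1 := Finset.single_le_sum (f := fun n => |f n| / g n)
      (fun n _ => div_nonneg (abs_nonneg _) (hg n).le) hn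
    refine (le_abs_self _).trans ((div_le_iff₀ (hg n)).1 (h1.trans ?_))
    linarith [abs_nonneg c]
  · have h1 : f n ≤ c * g n := by
      by_contra hcon
      exact hn (h.mem_toFinset.2 hcon)
    refine h1.trans (mul_le_mul_of_nonneg_right ?_ (hg n).le)
    linarith [le_abs_self c]

/-- Gap n is step n for n > 0 and step n - 1 for n ≤ 0, so step 0 is not a gap at all. Bounds
involving it come from absorbing finitely many indices into the constants. -/
theorem exists_logSpaced {a : ℤ → ℝ} (ha : StrictMono a)
    (hgap : ∀ᶠ n in cofinite, Real.exp 1 < gap a n)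
    (hcomp : AsympEq (fun n => gap a (n + 1)) (gap a))
    (hupper : LessSim (gap a) (fun n => Real.log |a n|)) : ∃ δ C : ℝ, LogSpaced a δ C := by
  have hst : ∀ n, 0 < step a n := fun n => sub_pos.2 (ha (lt_add_one n))
  have hright : ∀ {n : ℤ}, 0 < n → step a n = gap a n := fun {n} hn => by
    rw [gap, if_pos hn, step]
  have hleft : ∀ {n : ℤ}, n < 0 → step a n = gap a (n + 1) := fun {n} hn => by
    rw [gap, if_neg (by omega), step, add_sub_cancel_right]
  have hpos : ∀ n, 0 < gap a n := by
    intro n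
    unfold gap
    split_ifs
    · exact sub_pos.2 (ha (lt_add_one n))
    · exact sub_pos.2 (ha (sub_one_lt n))
  have hlog : ∀ n, 0 < Real.log (2 + |a n|) := fun n =>
    Real.log_pos (by linarith [abs_nonneg (a n)])
  obtain ⟨c₁, c₂, hc1, -, hev⟩ := hcomp
  obtain ⟨A, hA1, hA⟩ := exists_forall_le_mul_of_eventually (fun n => hpos (n + 1))
    (hev.mono fun n hn => hn.2)
  obtain ⟨B, hB1, hB⟩ := exists_forall_le_mul_of_eventually (f := fun n => gap a (n + 1))
    (c := c₁⁻¹) hpos (hev.mono fun n hn => by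
      rw [inv_mul_eq_div, le_div_iff₀ hc1, mul_comm]; exact hn.1)
  obtain ⟨c₃, hc3, hev3⟩ := hupper
  obtain ⟨D, hD1, hD⟩ := exists_forall_le_mul_of_eventually (c := c₃) hlog
    (hev3.mono fun n hn => by
      refine hn.trans (mul_le_mul_of_nonneg_left ?_ hc3)
      -- If a n = 0 the logarithm has the default value 0, and monotonicity of log is not available.
      rcases (abs_nonneg (a n)).eq_or_lt with h0 | h0
      · beta_reduce
        rw [← h0, Real.log_zero]
        exact Real.log_nonneg (by norm_num)
      · exact Real.log_le_log h0 (by linarith))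
  obtain ⟨E, hE1, hE⟩ := exists_forall_le_mul_of_eventually (f := fun _ => 1) (c := 1) hpos
    (hgap.mono fun n hn => by
      rw [one_mul]; exact (Real.one_le_exp zero_le_one).trans hn.le)
  -- For these indices n and n + 1 have the same strict sign, so consecutive steps are consecutive
  -- gaps.
  have hne : ∀ᶠ n : ℤ in cofinite, (0 < n ∨ n < -1) := by
    filter_upwards [eventually_cofinite_ne (0 : ℤ), eventually_cofinite_ne (-1 : ℤ)] with n h1 h2
    omega
  obtain ⟨E', hE1', hE'⟩ := exists_forall_le_mul_of_eventually (f := fun _ => 1) (c := E) hst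
    (hne.mono fun n hn => by
      rcases hn with hn | hn
      · rw [hright hn]; exact hE n
      · rw [hleft (by omega)]; exact hE (n + 1))
  obtain ⟨A', hA1', hA'⟩ := exists_forall_le_mul_of_eventually (f := step a) (c := A)
    (fun n => hst (n + 1)) (hne.mono fun n hn => by
      rcases hn with hn | hn
      · rw [hright hn, hright (by omega)]; exact hA n
      · rw [hleft (by omega), hleft (by omega)]; exact hA (n + 1))
  obtain ⟨B', hB1', hB'⟩ := exists_forall_le_mul_of_eventually (f := fun n => step a (n + 1))
    (c := B) hst (hne.mono fun n hn => by
      rcases hn with hn | hn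
      · rw [hright hn, hright (by omega)]; exact hB n
      · rw [hleft (by omega), hleft (by omega)]; exact hB (n + 1))
  obtain ⟨D', hD1', hD'⟩ := exists_forall_le_mul_of_eventually (f := step a) (c := B * D) hlog
    (hne.mono fun n hn => by
      have h1 : B * gap a n ≤ B * D * Real.log (2 + |a n|) := by
        rw [mul_assoc]; exact mul_le_mul_of_nonneg_left (hD n) (by linarith)
      rcases hn with hn | hn
      · rw [hright hn]; exact (le_mul_of_one_le_left (hpos n).le hB1).trans h1
      · rw [hleft (by omega)]; exact (hB n).trans h1)
  obtain ⟨F', hF1', hF'⟩ := exists_forall_le_mul_of_eventually (f := step a) (c := A * D)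
    (fun n => hlog (n + 1)) (hne.mono fun n hn => by
      have h1 : A * gap a (n + 1) ≤ A * D * Real.log (2 + |a (n + 1)|) := by
        rw [mul_assoc]; exact mul_le_mul_of_nonneg_left (hD (n + 1)) (by linarith)
      rcases hn with hn | hn
      · rw [hright hn]; exact (hA n).trans h1
      · rw [hleft (by omega)]
        exact (le_mul_of_one_le_left (hpos (n + 1)).le hA1).trans h1)
  refine ⟨E'⁻¹, A' + B' + D' + F', by positivity, by linarith, fun k => ?_, fun k => ?_,
    fun k => ?_, fun k => ?_, fun k => ?_⟩
  · rw [inv_le_iff_one_le_mul₀' (by linarith)]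
    exact hE' k
  · exact (hB' k).trans (mul_le_mul_of_nonneg_right (by linarith) (hst k).le)
  · exact (hA' k).trans (mul_le_mul_of_nonneg_right (by linarith) (hst (k + 1)).le)
  · exact (hD' k).trans (mul_le_mul_of_nonneg_right (by linarith) (hlog k).le)
  · exact (hF' k).trans (mul_le_mul_of_nonneg_right (by linarith) (hlog (k + 1)).le)

theorem exists_log_abs_le {a : ℤ → ℝ} (hgap : ∀ᶠ n in cofinite, Real.exp 1 < gap a n)
    (hlower : LessSim (fun n => Real.log |a n| / Real.log (Real.log (gap a n))) (gap a)) :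
    ∃ Q : ℝ, 0 ≤ Q ∧ ∀ᶠ n in cofinite, Real.exp 1 < gap a n ∧
      Real.log |a n| ≤ Q * gap a n * Real.log (Real.log (gap a n)) := by
  obtain ⟨Q, hQ, hev⟩ := hlower
  refine ⟨Q, hQ, ?_⟩
  filter_upwards [hgap, hev] with n h1 h2
  have h3 : 1 < Real.log (gap a n) := (Real.lt_log_iff_exp_lt ((Real.exp_pos 1).trans h1)).2 h1
  exact ⟨h1, (div_le_iff₀ (Real.log_pos h3)).1 h2⟩

end MIF

theorem mainTheorem2 (a : ℤ → ℝ) (ha : StrictMono a)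
    (hgap : ∀ᶠ n in Filter.cofinite, Real.exp 1 < MIF.gap a n)
    (hcomp : MIF.AsympEq (fun n => MIF.gap a (n + 1)) (MIF.gap a))
    (hlower : MIF.LessSim
      (fun n => Real.log |a n| / Real.log (Real.log (MIF.gap a n))) (MIF.gap a))
    (hupper : MIF.LessSim (MIF.gap a) (fun n => Real.log |a n|)) (c : ℝ) :
    ∃ Θ : ℂ → ℂ,
      MIF.IsMeromorphicInner Θ ∧
      MIF.innerSpectrum Θ = Set.range a ∧
      (∃ C : ℝ, ∀ x : ℝ, ‖deriv Θ (x : ℂ)‖ ≤ C) ∧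
      (∀ z : ℂ, 0 < z.im →
        1 / ((Real.pi : ℂ) * Complex.I) * Complex.log ((1 + Θ z) / (1 - Θ z)) =
          MIF.cauchyFun (MIF.shiftFun a) z + Complex.I * (c : ℂ)) ∧
      ∃ α β : ℤ → ℝ,
        (∀ n, 0 < α n) ∧ (∀ n, 0 < β n) ∧
        MIF.IsClarkMeasure Θ 1 (MIF.pointMasses a α) ∧
        MIF.IsClarkMeasure Θ (-1) (MIF.pointMasses (MIF.midpt a) β) ∧
        MIF.LessSim α (fun n => MIF.gap a n * Real.log (MIF.gap a n)) ∧
        MIF.LessSim β (fun n => MIF.gap a n * Real.log (MIF.gap a n)) := by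
  obtain ⟨δ, C, h⟩ := MIF.exists_logSpaced ha hgap hcomp hupper
  obtain ⟨Q, hQ0, hQ⟩ := MIF.exists_log_abs_le hgap hlower
  exact ⟨MIF.innerFun a c, h.isMeromorphicInner_innerFun c, h.innerSpectrum_innerFun c,
    h.exists_norm_deriv_innerFun_le_all hQ0 hQ c, fun z hz => h.krein_shift_formula c hz,
    MIF.clarkMass a c, MIF.clarkMassNeg a c, h.clarkMass_pos c, h.clarkMassNeg_pos c,
    h.isClarkMeasure_one c, h.isClarkMeasure_neg_one c, h.exists_clarkMass_le hQ0 hQ c,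
    h.exists_clarkMassNeg_le hgap c⟩
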